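/- Let $k$ be a commutative ring. A DG category is a category whose $\mathrm{Hom}$'s are complexes of $k$-modules (cohomological grading, $d$ of degree $1$) with composition given by morphisms of complexes; write $\mathrm{Ext}^n_{\mathcal C}(X,Y)=H^n(\mathrm{Hom}_{\mathcal C}(X,Y))$. Let $\mathcal K$ be the DG category with two objects $X_1,X_2$ which, as a graded $k$-category, is freely generated by morphisms $f:X_1\to X_2$ and $g:X_2\to X_1$ of degree $0$, $\alpha_i:X_i\to X_i$ ($i=1,2$) of degree $-1$ and $u:X_1\to X_2$ of degree $-2$, with the differential determined by $$df=dg=0,\quad d\alpha_1=gf-1,\quad d\alpha_2=fg-1,\quad du=f\alpha_1-\alpha_2f .$$ Let $\mathbf I_2$ be the $k$-linearization, viewed as a DG category concentrated in degree $0$, of the category $\mathbf J_2$ with two objects $X_1,X_2$ and precisely one morphism with any given source and target. Let $\mathcal A_0$ be the DG category with objects $X_1,X_2$ freely generated by one morphism $f:X_1\to X_2$ of degree $0$ with $df=0$; let $\mathcal A=\mathcal A_0^{\text{pre-tr}}$ be the DG category of one-sided twisted complexes over $\mathcal A_0$, and let $\mathcal B\subset\mathcal A$ be the full DG subcategory with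 the single object $\mathrm{Cone}(f)$. Let $\mathcal A/\mathcal B$ be the DG category obtained from $\mathcal A$ by freely adding a morphism $\varepsilon:\mathrm{Cone}(f)\to\mathrm{Cone}(f)$ of degree $-1$ with $d\varepsilon=\mathrm{id}$. Then: 1. $\mathcal K$ is a resolution of $\mathbf I_2$: the DG category $\mathcal K$ is semi-free, and there is a DG functor $\mathcal K\to\mathbf I_2$, identical on objects and sending $f$ and $g$ to the morphisms $X_1\to X_2$ and $X_2\to X_1$ of $\mathbf J_2$, which is a quasi-equivalence (i.e. it induces isomorphisms on the cohomology of all $\mathrm{Hom}$ complexes and is essentially surjective on homotopy categories). 2. There is a fully faithful DG functor $\mathcal K\to\mathcal A/\mathcal B$ with $X_i\mapsto X_i$ and $f\mapsto f$ (bijective on each $\mathrm{Hom}$ complex); so $\mathcal K$ is identified with the full DG subcategory of $\mathcal A/\mathcal B$ with objects $X_1$ and $X_2$. 3. $\mathrm{Ext}^n_{\mathcal A/\mathcal B}(X_i,X_j)=0$ for all $i,j\in\{1,2\}$ and all $n\neq 0$; $\mathrm{Ext}^0_{\mathcal A/\mathcal B}(X_i,X_i)$ is the free $k$-module generated by the class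 of $\mathrm{id}_{X_i}$; the class of $f$ is invertible in the homotopy category of $\mathcal A/\mathcal B$, and $\mathrm{Ext}^0_{\mathcal A/\mathcal B}(X_1,X_2)$ and $\mathrm{Ext}^0_{\mathcal A/\mathcal B}(X_2,X_1)$ are free $k$-modules generated by the classes of $f$ and $f^{-1}$ respectively. -/

import Mathlib

universe u v w u' v' g

noncomputable section

namespace DG

/-- The sign `(-1)^n` as an element of the ground ring `k`. -/
def sgn (k : Type w) [CommRing k] (n : ℤ) : k := ((n.negOnePow : ℤ) : k)

section sgn
variable (k : Type w) [CommRing k]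

@[simp] theorem sgn_zero : sgn k 0 = 1 := by simp [sgn]
@[simp] theorem sgn_neg_one : sgn k (-1) = -1 := by simp [sgn]
theorem sgn_add (m n : ℤ) : sgn k (m + n) = sgn k m * sgn k n := by
  simp [sgn, Int.negOnePow_add]
theorem sgn_succ (m : ℤ) : sgn k (m + 1) = - sgn k m := by
  simp [sgn, Int.negOnePow_succ]
@[simp] theorem sgn_mul_self (m : ℤ) : sgn k m * sgn k m = 1 := by
  rw [← sgn_add]; simp [sgn]
theorem sgn_sub (m n : ℤ) : sgn k (m - n) = sgn k m * sgn k n := by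
  simp [sgn, Int.negOnePow_sub]

end sgn

/-- A `ℤ`-graded `k`-category. `Hom X Y n` is the module of morphisms `X → Y` of degree `n`;
`comp h g f` is the composite `g ∘ f`. -/
structure GrCat (k : Type w) [CommRing k] where
  Obj : Type u
  Hom : Obj → Obj → ℤ → Type v
  [addCommGroup : ∀ X Y n, AddCommGroup (Hom X Y n)]
  [module : ∀ X Y n, Module k (Hom X Y n)]
  id : ∀ X, Hom X X 0
  comp : ∀ {X Y Z : Obj} {p q n : ℤ}, p + q = n → (Hom Y Z p →ₗ[k] Hom X Y q →ₗ[k] Hom X Z n)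
  id_comp : ∀ {X Y : Obj} {n : ℤ} (h : 0 + n = n) (f : Hom X Y n), comp h (id Y) f = f
  comp_id : ∀ {X Y : Obj} {n : ℤ} (h : n + 0 = n) (f : Hom X Y n), comp h f (id X) = f
  assoc : ∀ {W X Y Z : Obj} {p q r s t n : ℤ} (hpq : p + q = s) (hqr : q + r = t)
    (hs : s + r = n) (ht : p + t = n) (c : Hom Y Z p) (b : Hom X Y q) (a : Hom W X r),
    comp hs (comp hpq c b) a = comp ht c (comp hqr b a)

attribute [instance] GrCat.addCommGroup GrCat.module

/-- A DG category over `k`. -/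
structure DGCat (k : Type w) [CommRing k] extends GrCat.{u, v, w} k where
  d : ∀ {X Y : Obj} {m n : ℤ}, m + 1 = n → (Hom X Y m →ₗ[k] Hom X Y n)
  d_d : ∀ {X Y : Obj} {l m n : ℤ} (h : l + 1 = m) (h' : m + 1 = n) (f : Hom X Y l),
    d h' (d h f) = 0
  leibniz : ∀ {X Y Z : Obj} {p q n p' q' n' : ℤ} (h : p + q = n) (hn : n + 1 = n')
    (hp : p + 1 = p') (hq : q + 1 = q') (hl : p' + q = n') (hr : p + q' = n')
    (b : Hom Y Z p) (a : Hom X Y q),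
    d hn (comp h b a) = comp hl (d hp b) a + sgn k p • comp hr b (d hq a)

section basic
variable {k : Type w} [CommRing k]

/-- Transport of morphisms along an equality of degrees. -/
def GrCat.castDeg (A : GrCat.{u, v, w} k) {X Y : A.Obj} {m n : ℤ} (h : m = n) :
    A.Hom X Y m →ₗ[k] A.Hom X Y n :=
  h ▸ LinearMap.id

variable (A : DGCat.{u, v, w} k)

/-- Closed morphisms of degree `n`. -/
def DGCat.cocycles (X Y : A.Obj) (n : ℤ) : Submodule k (A.Hom X Y n) :=
  LinearMap.ker (A.d (X := X) (Y := Y) (rfl : n + 1 = n + 1))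

/-- Exact morphisms of degree `n`. -/
def DGCat.coboundaries (X Y : A.Obj) (n : ℤ) : Submodule k (A.Hom X Y n) :=
  LinearMap.range (A.d (X := X) (Y := Y) (sub_add_cancel n 1))

/-- `Ext^n(X, Y)`: the `n`-th cohomology of the complex `Hom(X, Y)`. -/
abbrev DGCat.Ext (X Y : A.Obj) (n : ℤ) : Type v :=
  A.cocycles X Y n ⧸ (A.coboundaries X Y n).submoduleOf (A.cocycles X Y n)

/-- The class in `Ext^n(X, Y)` of a closed morphism. -/
def DGCat.cls {X Y : A.Obj} {n : ℤ} (f : A.cocycles X Y n) : A.Ext X Y n :=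
  Submodule.Quotient.mk f

/-- `f : X → Y` and `g : Y → X` are closed of degree `0` and represent mutually inverse
morphisms of the homotopy category. -/
structure DGCat.IsHoInverse {X Y : A.Obj} (f : A.Hom X Y 0) (g : A.Hom Y X 0) : Prop where
  closed_left : f ∈ A.cocycles X Y 0
  closed_right : g ∈ A.cocycles Y X 0
  left : A.comp (add_zero 0) g f - A.id X ∈ A.coboundaries X X 0
  right : A.comp (add_zero 0) f g - A.id Y ∈ A.coboundaries Y Y 0

/-- A DG functor from `A` to `B` with the map `φ` on objects. -/
structure DGFunctor (A : DGCat.{u, v, w} k) (B : DGCat.{u', v', w} k) (φ : A.Obj → B.Obj) where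
  map : ∀ {X Y : A.Obj} (n : ℤ), A.Hom X Y n →ₗ[k] B.Hom (φ X) (φ Y) n
  map_id : ∀ X : A.Obj, map 0 (A.id X) = B.id (φ X)
  map_comp : ∀ {X Y Z : A.Obj} {p q n : ℤ} (h : p + q = n) (b : A.Hom Y Z p) (a : A.Hom X Y q),
    map n (A.comp h b a) = B.comp h (map p b) (map q a)
  map_d : ∀ {X Y : A.Obj} {m n : ℤ} (h : m + 1 = n) (f : A.Hom X Y m),
    map n (A.d h f) = B.d h (map m f)

variable {A} {B : DGCat.{u', v', w} k} {φ : A.Obj → B.Obj}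

theorem DGFunctor.cocycles_le (F : DGFunctor A B φ) (X Y : A.Obj) (n : ℤ) :
    A.cocycles X Y n ≤ (B.cocycles (φ X) (φ Y) n).comap (F.map n) := by
  intro f hf
  have hf' : A.d (rfl : n + 1 = n + 1) f = 0 := hf
  change B.d (rfl : n + 1 = n + 1) (F.map n f) = 0
  rw [← F.map_d, hf', map_zero]

/-- The map induced by a DG functor on closed morphisms. -/
def DGFunctor.mapCocycles (F : DGFunctor A B φ) (X Y : A.Obj) (n : ℤ) :
    A.cocycles X Y n →ₗ[k] B.cocycles (φ X) (φ Y) n :=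
  (F.map n).restrict (F.cocycles_le X Y n)

/-- The map induced by a DG functor on cohomology. -/
def DGFunctor.mapExt (F : DGFunctor A B φ) (X Y : A.Obj) (n : ℤ) :
    A.Ext X Y n →ₗ[k] B.Ext (φ X) (φ Y) n :=
  Submodule.mapQ _ _ (F.mapCocycles X Y n) (by
    rintro ⟨f, hf⟩ ⟨a, ha⟩
    refine ⟨F.map (n - 1) a, ?_⟩
    rw [← F.map_d, ha]
    rfl)

/-- A DG functor is fully faithful if it is bijective on morphisms. -/
def DGFunctor.FullyFaithful (F : DGFunctor A B φ) : Prop :=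
  ∀ (X Y : A.Obj) (n : ℤ), Function.Bijective (F.map (X := X) (Y := Y) n)

/-- Quasi-equivalence: fully faithful on graded homotopy categories and essentially surjective
on homotopy categories. -/
structure DGFunctor.IsQuasiEquivalence (F : DGFunctor A B φ) : Prop where
  fullyFaithful : ∀ (X Y : A.Obj) (n : ℤ), Function.Bijective (F.mapExt X Y n)
  essSurj : ∀ Z : B.Obj, ∃ (X : A.Obj) (a : B.Hom (φ X) Z 0) (b : B.Hom Z (φ X) 0),
    B.IsHoInverse a b

/-- `x` is a free generator of the `k`-module `M`. -/
def IsFreeGenerator (k : Type w) [CommRing k] {M : Type v} [AddCommGroup M] [Module k M]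
    (x : M) : Prop :=
  Function.Bijective fun c : k => c • x

end basic

/-! ### Words in a family of arrows -/

/-- Words (paths) in a family of arrows `E`; `cons e p` is the composite `e ∘ p`. -/
inductive Word {V : Type u} (E : V → V → Type g) (a : V) : V → Type (max u g)
  | nil : Word E a a
  | cons {b c : V} (e : E b c) (p : Word E a b) : Word E a c

namespace Word
variable {V : Type u} {E : V → V → Type g}

/-- The composite word `q ∘ p`. -/
def comp {a b : V} (p : Word E a b) : ∀ {c : V}, Word E b c → Word E a c
  | _, nil => p
  | _, cons e q => cons e (comp p q)

/-- The degree of a word, given the degrees of the arrows. -/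
def deg (δ : ∀ a b : V, E a b → ℤ) {a : V} : ∀ {b : V}, Word E a b → ℤ
  | _, nil => 0
  | _, cons e p => δ _ _ e + deg δ p

/-- All the arrows of the word have level less than `N`. -/
def LevelLT (lev : ∀ a b : V, E a b → ℕ) (N : ℕ) {a : V} : ∀ {b : V}, Word E a b → Prop
  | _, nil => True
  | _, cons e p => lev _ _ e < N ∧ LevelLT lev N p

theorem nil_comp {a b : V} (q : Word E a b) : comp nil q = q := by
  induction q with
  | nil => rfl
  | cons e q ih => simp [comp, ih]

theorem comp_assoc {a b c d : V} (p : Word E a b) (q : Word E b c) (r : Word E c d) :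
    comp (comp p q) r = comp p (comp q r) := by
  induction r with
  | nil => rfl
  | cons e r ih => simp [comp, ih]

theorem deg_comp (δ : ∀ a b : V, E a b → ℤ) {a b c : V} (p : Word E a b) (q : Word E b c) :
    deg δ (comp p q) = deg δ p + deg δ q := by
  induction q with
  | nil => simp [comp, deg]
  | cons e q ih => simp only [comp, deg, ih]; ring

end Word

/-- The category of words. -/
abbrev wordCat {V : Type u} (E : V → V → Type g) : CategoryTheory.Category.{max u g} V where
  Hom a b := Word E a b
  id _ := Word.nil
  comp p q := Word.comp p q
  id_comp := Word.nil_comp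
  comp_id _ := rfl
  assoc := Word.comp_assoc

/-! ### Graded linearization of a category -/

section lin
variable (k : Type w) [CommRing k] {V : Type u} (C : CategoryTheory.Category.{v} V)
  (deg : ∀ X Y : V, C.Hom X Y → ℤ)
  (deg_comp : ∀ (X Y Z : V) (f : C.Hom X Y) (g : C.Hom Y Z),
    deg X Z (C.comp f g) = deg X Y f + deg Y Z g)

/-- The bilinear extension of the composition of a category. -/
def linComp {X Y Z : V} {p q n : ℤ} (h : p + q = n) :
    ({f : C.Hom Y Z // deg _ _ f = p} →₀ k) →ₗ[k] ({f : C.Hom X Y // deg _ _ f = q} →₀ k) →ₗ[k]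
      ({f : C.Hom X Z // deg _ _ f = n} →₀ k) :=
  Finsupp.lift _ k _ fun b =>
    Finsupp.lmapDomain k k fun a : {f : C.Hom X Y // deg _ _ f = q} =>
      ⟨C.comp a.1 b.1, by rw [deg_comp, a.2, b.2, ← h, add_comm]⟩

theorem linComp_single {X Y Z : V} {p q n : ℤ} (h : p + q = n)
    (b : {f : C.Hom Y Z // deg _ _ f = p}) (a : {f : C.Hom X Y // deg _ _ f = q}) (y x : k) :
    linComp k C deg deg_comp h (Finsupp.single b y) (Finsupp.single a x) =
      Finsupp.single ⟨C.comp a.1 b.1, by rw [deg_comp, a.2, b.2, ← h, add_comm]⟩ (y * x) := by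
  simp [linComp, Finsupp.lmapDomain_apply, Finsupp.mapDomain_single]

/-- The `k`-linearization of a category whose morphisms carry an additive degree: the morphisms
of degree `n` of the category form a basis of the module of morphisms of degree `n`. -/
def GrCat.lin (deg_id : ∀ X, deg X X (C.id X) = 0) : GrCat.{u, max v w, w} k where
  Obj := V
  Hom X Y n := {f : C.Hom X Y // deg _ _ f = n} →₀ k
  id X := Finsupp.single ⟨C.id X, deg_id X⟩ 1
  comp h := linComp k C deg deg_comp h
  id_comp h f := by
    induction f using Finsupp.induction_linear with
    | zero => simp
    | add f g hf hg => rw [map_add, hf, hg]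
    | single a c => simp [linComp_single, C.comp_id]
  comp_id h f := by
    induction f using Finsupp.induction_linear with
    | zero => simp
    | add f g hf hg => rw [map_add, LinearMap.add_apply, hf, hg]
    | single a c => simp [linComp_single, C.id_comp]
  assoc hpq hqr hs ht c b a := by
    induction a using Finsupp.induction_linear with
    | zero => simp
    | add f g hf hg => rw [map_add, map_add, map_add, hf, hg]
    | single a x =>
      induction b using Finsupp.induction_linear with
      | zero => simp
      | add f g hf hg =>
        rw [map_add, map_add, map_add, LinearMap.add_apply, LinearMap.add_apply, map_add, hf, hg]
      | single b y =>
        induction c using Finsupp.induction_linear with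
        | zero => simp
        | add f g hf hg =>
          rw [map_add, map_add, LinearMap.add_apply, LinearMap.add_apply, map_add,
            LinearMap.add_apply, hf, hg]
        | single c z => simp only [linComp_single, C.assoc, mul_assoc]

/-- The `k`-category generated by a category, as a DG category concentrated in degree `0`. -/
def DGCat.lin : DGCat.{u, max v w, w} k where
  toGrCat := GrCat.lin k C (fun _ _ _ => 0) (fun _ _ _ _ _ => rfl) (fun _ => rfl)
  d _ := 0
  d_d _ _ _ := rfl
  leibniz _ _ _ _ _ _ _ _ := by simp

end lin

/-! ### Free DG categories -/

section free
variable (k : Type w) [CommRing k] {V : Type u} {E : V → V → Type g} (δ : ∀ a b : V, E a b → ℤ)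

/-- The graded `k`-category freely generated by a family `E` of arrows of degrees `δ`:
words form a basis of the morphisms. -/
def GrCat.free : GrCat.{u, max u g w, w} k :=
  GrCat.lin k (wordCat E) (fun _ _ => Word.deg δ) (fun _ _ _ => Word.deg_comp δ) (fun _ => rfl)

/-- The morphisms of degree `n` of the free graded category. -/
abbrev FreeHom (a b : V) (n : ℤ) : Type (max u g w) :=
  {p : Word E a b // Word.deg δ p = n} →₀ k

/-- A word as a morphism of the free graded category. -/
def word {a b : V} (p : Word E a b) {n : ℤ} (h : Word.deg δ p = n) : FreeHom k δ a b n :=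
  Finsupp.single ⟨p, h⟩ 1

/-- Composition in the free graded category. -/
def freeComp {a b c : V} {p q n : ℤ} (h : p + q = n) :
    FreeHom k δ b c p →ₗ[k] FreeHom k δ a b q →ₗ[k] FreeHom k δ a c n :=
  (GrCat.free k δ).comp h

variable {k δ}

theorem freeComp_word {a b c : V} (q : Word E b c) (p : Word E a b) {l m n : ℤ}
    (hq : Word.deg δ q = l) (hp : Word.deg δ p = m) (h : l + m = n) :
    freeComp k δ h (word k δ q hq) (word k δ p hp) =
      word k δ (p.comp q) (by rw [Word.deg_comp, hq, hp, ← h, add_comm]) := by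
  refine (linComp_single k (wordCat E) (fun _ _ => Word.deg δ) (fun _ _ _ => Word.deg_comp δ) h
    ⟨q, hq⟩ ⟨p, hp⟩ 1 1).trans ?_
  rw [mul_one]
  rfl

theorem freeComp_assoc {a b c e : V} {p q r s t n : ℤ} (hpq : p + q = s) (hqr : q + r = t)
    (hs : s + r = n) (ht : p + t = n) (x : FreeHom k δ c e p) (y : FreeHom k δ b c q)
    (z : FreeHom k δ a b r) :
    freeComp k δ hs (freeComp k δ hpq x y) z = freeComp k δ ht x (freeComp k δ hqr y z) :=
  (GrCat.free k δ).assoc hpq hqr hs ht x y z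

theorem freeComp_nil {a b : V} {z n : ℤ} (hz : Word.deg δ (.nil : Word E b b) = z) (h : z + n = n)
    (x : FreeHom k δ a b n) : freeComp k δ h (word k δ (.nil : Word E b b) hz) x = x := by
  obtain rfl : z = 0 := by omega
  exact (GrCat.free k δ).id_comp h x

theorem freeComp_nil_right {a b : V} {z n : ℤ} (hz : Word.deg δ (.nil : Word E a a) = z) (h : n + z = n)
    (x : FreeHom k δ a b n) : freeComp k δ h x (word k δ (.nil : Word E a a) hz) = x := by
  obtain rfl : z = 0 := by omega
  exact (GrCat.free k δ).comp_id h x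

theorem FreeHom.induction {a b : V} {n : ℤ} {P : FreeHom k δ a b n → Prop}
    (x : FreeHom k δ a b n) (zero : P 0) (add : ∀ x y, P x → P y → P (x + y))
    (smul : ∀ (c : k) (p : Word E a b) (h : Word.deg δ p = n), P (c • word k δ p h)) : P x := by
  induction x using Finsupp.induction_linear with
  | zero => exact zero
  | add f g hf hg => exact add f g hf hg
  | single a c => simpa [word] using smul c a.1 a.2

variable (k) in
/-- The derivation with prescribed values `dgen` on the generators, on words:
`d(e ∘ p) = dgen e ∘ p + (-1)^(δ e) e ∘ d p`. -/
def dWord (dgen : ∀ (a b : V) (e : E a b), FreeHom k δ a b (δ a b e + 1)) {a : V} :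
    ∀ {b : V} (p : Word E a b) {n : ℤ} (_ : Word.deg δ p + 1 = n), FreeHom k δ a b n
  | _, .nil, _, _ => 0
  | _, .cons (b := b) e p, n, h =>
    freeComp k δ (by rw [← h, Word.deg]; ring : (δ _ _ e + 1) + Word.deg δ p = n)
      (dgen _ _ e) (word k δ p rfl) +
    sgn k (δ _ _ e) • freeComp k δ
      (by rw [← h, Word.deg]; ring : δ _ _ e + (Word.deg δ p + 1) = n)
      (word k δ (.cons e (.nil : Word E b b)) (by simp [Word.deg])) (dWord dgen p rfl)

variable (dgen : ∀ (a b : V) (e : E a b), FreeHom k δ a b (δ a b e + 1))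

variable (k) in
/-- The derivation with prescribed values `dgen` on the generators. -/
def freeD {a b : V} {m n : ℤ} (h : m + 1 = n) : FreeHom k δ a b m →ₗ[k] FreeHom k δ a b n :=
  Finsupp.lift _ k _ fun p => dWord k dgen p.1 (by rw [p.2, h])

theorem freeD_word {a b : V} (p : Word E a b) {m n : ℤ} (hp : Word.deg δ p = m)
    (h : m + 1 = n) : freeD k dgen h (word k δ p hp) = dWord k dgen p (by rw [hp, h]) := by
  simp [freeD, word]

theorem dWord_nil {a : V} {n : ℤ} (h : Word.deg δ (.nil : Word E a a) + 1 = n) :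
    dWord k dgen (.nil : Word E a a) h = 0 := rfl

theorem dWord_cons {a b c : V} (e : E b c) (p : Word E a b) {i m n : ℤ} (hi : Word.deg δ p = i)
    (h : Word.deg δ (.cons e p) + 1 = n) (hm : Word.deg δ p + 1 = m)
    (h1 : δ _ _ e + 1 + i = n) (h2 : δ _ _ e + m = n) :
    dWord k dgen (.cons e p) h = freeComp k δ h1 (dgen _ _ e) (word k δ p hi) +
      sgn k (δ _ _ e) • freeComp k δ h2
        (word k δ (.cons e (.nil : Word E b b)) (by simp [Word.deg])) (dWord k dgen p hm) := by
  subst hi hm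
  rfl

theorem dWord_comp {a b c : V} (q : Word E b c) (p : Word E a b) {i j n l' m' : ℤ}
    (hi : Word.deg δ q = i) (hj : Word.deg δ p = j)
    (hn : Word.deg δ (p.comp q) + 1 = n)
    (hl : Word.deg δ q + 1 = l') (hm : Word.deg δ p + 1 = m')
    (h1 : l' + j = n) (h2 : i + m' = n) :
    dWord k dgen (p.comp q) hn =
      freeComp k δ h1 (dWord k dgen q hl) (word k δ p hj) +
      sgn k i • freeComp k δ h2 (word k δ q hi) (dWord k dgen p hm) := by
  induction q generalizing n i l' with
  | nil =>
    obtain rfl : i = 0 := hi.symm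
    rw [dWord_nil, map_zero, LinearMap.zero_apply, zero_add, sgn_zero, one_smul]
    obtain rfl : n = m' := by omega
    exact (freeComp_nil hi h2 _).symm
  | cons e q ih =>
    have hc := Word.deg_comp δ p q
    have hd : δ _ _ e + Word.deg δ q = i := hi
    obtain rfl : δ _ _ e + Word.deg δ (p.comp q) + 1 = n := hn
    refine (dWord_cons dgen e (p.comp q) rfl _ rfl (by ring) (by ring)).trans ?_
    rw [dWord_cons dgen e q rfl hl rfl (by omega) (by omega),
      ih rfl rfl rfl (by omega) (by omega)]
    simp only [map_add, map_smul, LinearMap.add_apply, LinearMap.smul_apply, smul_add, smul_smul,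
      add_assoc]
    congr 1
    · rw [freeComp_assoc (hqr := (by omega : Word.deg δ q + j = Word.deg δ (p.comp q)))
        (ht := by omega), freeComp_word]
    congr 1
    · rw [freeComp_assoc (hqr := (by omega : Word.deg δ q + 1 + j = Word.deg δ (p.comp q) + 1))
        (ht := by omega)]
    · rw [← sgn_add]
      congr 1
      · rw [hd]
      · rw [← freeComp_assoc (hpq := hd) (hs := h2), freeComp_word]
        rfl

theorem freeD_leibniz {a b c : V} {p q n p' q' n' : ℤ} (h : p + q = n) (hn : n + 1 = n')
    (hp : p + 1 = p') (hq : q + 1 = q') (hl : p' + q = n') (hr : p + q' = n')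
    (y : FreeHom k δ b c p) (x : FreeHom k δ a b q) :
    freeD k dgen hn (freeComp k δ h y x) =
      freeComp k δ hl (freeD k dgen hp y) x +
        sgn k p • freeComp k δ hr y (freeD k dgen hq x) := by
  induction x using FreeHom.induction with
  | zero => simp
  | add x x' hx hx' => simp only [map_add, hx, hx', smul_add]; abel
  | smul s x hx =>
    induction y using FreeHom.induction with
    | zero => simp
    | add y y' hy hy' =>
      simp only [map_add, LinearMap.add_apply, hy, hy', smul_add]; abel
    | smul t y hy =>
      simp only [map_smul, LinearMap.smul_apply, freeComp_word, freeD_word]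
      rw [dWord_comp dgen y x hy hx _ (hy ▸ hp) (hx ▸ hq) hl hr]
      simp only [smul_add, smul_smul]
      congr 2
      ring

theorem freeD_dWord (hd : ∀ (a b : V) (e : E a b), freeD k dgen rfl (dgen a b e) = 0)
    {a b : V} (p : Word E a b) {n n' : ℤ} (h : Word.deg δ p + 1 = n) (h' : n + 1 = n') :
    freeD k dgen h' (dWord k dgen p h) = 0 := by
  induction p generalizing n n' with
  | nil => simp [dWord]
  | cons e p ih =>
    subst h' h
    simp only [dWord, map_add, map_smul]
    rw [freeD_leibniz (hp := rfl) (hq := rfl) (hl := by rw [Word.deg]; ring)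
        (hr := by rw [Word.deg]; ring),
      freeD_leibniz (hp := rfl) (hq := rfl) (hl := by rw [Word.deg]; ring)
        (hr := by rw [Word.deg]; ring), hd, ih, freeD_word, freeD_word]
    simp only [dWord, map_zero, LinearMap.zero_apply, zero_add, smul_zero, add_zero, sgn_succ,
      neg_smul]
    rw [freeComp_nil_right rfl (by simp [Word.deg])]
    simp

theorem freeD_freeD (hd : ∀ (a b : V) (e : E a b), freeD k dgen rfl (dgen a b e) = 0)
    {a b : V} {l m n : ℤ} (h : l + 1 = m) (h' : m + 1 = n) (x : FreeHom k δ a b l) :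
    freeD k dgen h' (freeD k dgen h x) = 0 := by
  induction x using FreeHom.induction with
  | zero => simp
  | add x y hx hy => simp [hx, hy]
  | smul c p hp => rw [map_smul, map_smul, freeD_word, freeD_dWord dgen hd, smul_zero]

/-- The DG category freely generated by a family `E` of arrows of degrees `δ` with prescribed
differentials `dgen`. -/
def DGCat.free (hd : ∀ (a b : V) (e : E a b), freeD k dgen rfl (dgen a b e) = 0) :
    DGCat.{u, max u g w, w} k where
  toGrCat := GrCat.free k δ
  d h := freeD k dgen h
  d_d := freeD_freeD dgen hd
  leibniz := freeD_leibniz dgen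

end free

/-! ### Semi-free DG categories -/

section semifree
variable {k : Type w} [CommRing k] (A : DGCat.{u, v, w} k) {E : A.Obj → A.Obj → Type g}
  (δ : ∀ X Y, E X Y → ℤ)

/-- The value of a word in a family of morphisms of `A`. -/
def DGCat.evalWord (gen : ∀ X Y (e : E X Y), A.Hom X Y (δ X Y e)) {X : A.Obj} :
    ∀ {Y : A.Obj} (p : Word E X Y) {n : ℤ} (_ : Word.deg δ p = n), A.Hom X Y n
  | _, .nil, _, h => A.castDeg h (A.id X)
  | _, .cons e p, _, h => A.comp h (gen _ _ e) (evalWord gen p rfl)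

/-- `A` is semi-free: it is freely generated as a graded `k`-category by a family of homogeneous
morphisms (that is, the words in this family form a basis of the morphisms), and this family has
an exhaustive filtration by levels such that the differential of a generator is a combination of
words in generators of smaller levels. -/
def DGCat.IsSemiFree : Prop :=
  ∃ (E : A.Obj → A.Obj → Type g) (δ : ∀ X Y, E X Y → ℤ)
    (gen : ∀ X Y (e : E X Y), A.Hom X Y (δ X Y e)) (lev : ∀ X Y, E X Y → ℕ),
    (∀ (X Y : A.Obj) (n : ℤ), Function.Bijective
      (Finsupp.linearCombination k fun p : {p : Word E X Y // Word.deg δ p = n} =>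
        A.evalWord δ gen p.1 p.2)) ∧
    ∀ (X Y : A.Obj) (e : E X Y), A.d rfl (gen X Y e) ∈ Submodule.span k
      {x | ∃ (p : Word E X Y) (h : Word.deg δ p = δ X Y e + 1),
        p.LevelLT lev (lev X Y e) ∧ A.evalWord δ gen p h = x}

end semifree

section resolution
variable {k : Type w} [CommRing k] {A : DGCat.{u, v, w} k} {B : DGCat.{u', v', w} k}
  {φ : A.Obj → B.Obj}

/-- A resolution: a quasi-equivalence, bijective on objects, from a semi-free DG category. -/
structure DGFunctor.IsResolution (F : DGFunctor A B φ) : Prop where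
  semiFree : DGCat.IsSemiFree.{u, v, w, g} A
  bijective_obj : Function.Bijective φ
  quasiEquivalence : F.IsQuasiEquivalence

end resolution

/-! ### One-sided twisted complexes -/

section pretr
variable {k : Type w} [CommRing k]

/-- A one-sided twisted complex `(⨁ C i [r i], q)` over `A`. A morphism of degree `l` from
`C [r]` to `C' [r']` is a morphism `C → C'` of degree `l + r' - r`; these are composed as in `A`
and `(-1)^r' d` is the differential. -/
structure Tw (A : DGCat.{u, v, w} k) where
  n : ℕ
  C : Fin n → A.Obj
  r : Fin n → ℤ
  q : ∀ i j, A.Hom (C j) (C i) (1 + r i - r j)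
  upper : ∀ i j, j ≤ i → q i j = 0
  maurerCartan : ∀ i j, sgn k (r i) • A.d (by ring : _ = 2 + r i - r j) (q i j) +
    ∑ a, A.comp (by ring : _ = 2 + r i - r j) (q i a) (q a j) = 0

variable {A : DGCat.{u, v, w} k}

/-- Morphisms of degree `l` of twisted complexes: matrices. -/
abbrev TwHom (T T' : Tw A) (l : ℤ) : Type v :=
  ∀ (i : Fin T'.n) (j : Fin T.n), A.Hom (T.C j) (T'.C i) (l + T'.r i - T.r j)

/-- The identity matrix. -/
def twId (T : Tw A) : TwHom T T 0 := fun i j =>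
  if h : j = i then h ▸ A.castDeg (by ring) (A.id (T.C j)) else 0

/-- Matrix multiplication. -/
def twComp {T T' T'' : Tw A} {p q n : ℤ} (h : p + q = n) :
    TwHom T' T'' p →ₗ[k] TwHom T T' q →ₗ[k] TwHom T T'' n :=
  LinearMap.mk₂ k (fun b a i j => ∑ x, A.comp (by rw [← h]; ring) (b i x) (a x j))
    (by intros; ext; simp [Finset.sum_add_distrib])
    (by intros; ext; simp [Finset.smul_sum])
    (by intros; ext; simp [Finset.sum_add_distrib])
    (by intros; ext; simp [Finset.smul_sum])

/-- The naive differential: `(-1)^r' d` on each entry of a matrix. -/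
def twNaive {T T' : Tw A} {l n : ℤ} (h : l + 1 = n) : TwHom T T' l →ₗ[k] TwHom T T' n where
  toFun f i j := sgn k (T'.r i) • A.d (by rw [← h]; ring) (f i j)
  map_add' f g := by
    ext i j
    simp only [Pi.add_apply, map_add, smul_add]
  map_smul' c f := by
    ext i j
    simp only [Pi.smul_apply, map_smul, RingHom.id_apply, smul_comm c]

/-- The differential `f ↦ d_naive f + q' f - (-1)^l f q` for `f` of degree `l`. -/
def twD {T T' : Tw A} {l n : ℤ} (h : l + 1 = n) : TwHom T T' l →ₗ[k] TwHom T T' n :=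
  twNaive h + twComp (by rw [← h, add_comm] : 1 + l = n) T'.q -
    sgn k l • (twComp h).flip T.q

theorem twD_apply {T T' : Tw A} {l n : ℤ} (h : l + 1 = n) (f : TwHom T T' l) :
    twD h f = twNaive h f + twComp (by rw [← h, add_comm] : 1 + l = n) T'.q f -
      sgn k l • twComp h f T.q := rfl

theorem twComp_apply {T T' T'' : Tw A} {p q n : ℤ} (h : p + q = n) (b : TwHom T' T'' p)
    (a : TwHom T T' q) (i j) :
    twComp h b a i j = ∑ x, A.comp (by rw [← h]; ring) (b i x) (a x j) := rfl

theorem twNaive_apply {T T' : Tw A} {l n : ℤ} (h : l + 1 = n) (f : TwHom T T' l) (i j) :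
    twNaive h f i j = sgn k (T'.r i) • A.d (by rw [← h]; ring) (f i j) := rfl

theorem twComp_assoc {T₀ T₁ T₂ T₃ : Tw A} {p q r s t n : ℤ} (hpq : p + q = s) (hqr : q + r = t)
    (hs : s + r = n) (ht : p + t = n) (c : TwHom T₂ T₃ p) (b : TwHom T₁ T₂ q)
    (a : TwHom T₀ T₁ r) : twComp hs (twComp hpq c b) a = twComp ht c (twComp hqr b a) := by
  ext i j
  simp only [twComp_apply, map_sum, LinearMap.sum_apply]
  rw [Finset.sum_comm]
  refine Finset.sum_congr rfl fun x _ => Finset.sum_congr rfl fun y _ => ?_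
  exact A.assoc _ _ _ _ _ _ _

theorem twNaive_twNaive {T T' : Tw A} {l m n : ℤ} (h : l + 1 = m) (h' : m + 1 = n)
    (f : TwHom T T' l) : twNaive h' (twNaive h f) = 0 := by
  ext i j
  simp only [twNaive_apply, map_smul, A.d_d, smul_zero, Pi.zero_apply]

theorem twNaive_twComp {T T' T'' : Tw A} {p q n p' q' n' : ℤ} (h : p + q = n) (hn : n + 1 = n')
    (hp : p + 1 = p') (hq : q + 1 = q') (hl : p' + q = n') (hr : p + q' = n')
    (b : TwHom T' T'' p) (a : TwHom T T' q) :
    twNaive hn (twComp h b a) =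
      twComp hl (twNaive hp b) a + sgn k p • twComp hr b (twNaive hq a) := by
  ext i j
  simp only [twNaive_apply, twComp_apply, Pi.add_apply, Pi.smul_apply, map_sum, Finset.smul_sum,
    ← Finset.sum_add_distrib, map_smul, LinearMap.smul_apply]
  refine Finset.sum_congr rfl fun x _ => ?_
  rw [A.leibniz _ _ (by omega : p + T''.r i - T'.r x + 1 = p' + T''.r i - T'.r x)
    (by omega : q + T'.r x - T.r j + 1 = q' + T'.r x - T.r j) (by omega) (by omega), smul_add,
    smul_smul, smul_smul]
  congr 2
  rw [sgn_sub, sgn_add]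
  linear_combination (sgn k p * sgn k (T'.r x)) * sgn_mul_self k (T''.r i)

theorem Tw.maurerCartan' (T : Tw A) :
    twNaive (by norm_num : (1 : ℤ) + 1 = 2) T.q + twComp (by norm_num : (1 : ℤ) + 1 = 2) T.q T.q =
      (0 : TwHom T T 2) := by
  ext i j
  exact T.maurerCartan i j

theorem castId_comp (A : DGCat.{u, v, w} k) {X Y : A.Obj} {z n : ℤ} (hz : 0 = z) (h : z + n = n)
    (f : A.Hom X Y n) : A.comp h (A.castDeg hz (A.id Y)) f = f := by
  subst hz
  exact A.id_comp h f

theorem comp_castId (A : DGCat.{u, v, w} k) {X Y : A.Obj} {z n : ℤ} (hz : 0 = z) (h : n + z = n)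
    (f : A.Hom X Y n) : A.comp h f (A.castDeg hz (A.id X)) = f := by
  subst hz
  exact A.comp_id h f

theorem twId_self (T : Tw A) (i) : twId T i i = A.castDeg (by ring) (A.id (T.C i)) := by
  simp [twId]

theorem twId_ne (T : Tw A) {i j} (h : i ≠ j) : twId T i j = 0 := by
  simp [twId, h.symm]

/-- The graded category underlying the DG category of twisted complexes. -/
def GrCat.pretr (A : DGCat.{u, v, w} k) : GrCat.{max u v, v, w} k where
  Obj := Tw A
  Hom := TwHom
  id := twId
  comp := twComp
  id_comp {T T' n} h f := by
    ext i j
    rw [twComp_apply, Finset.sum_eq_single i, twId_self, castId_comp]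
    · intro b _ hb
      rw [twId_ne _ hb.symm, map_zero, LinearMap.zero_apply]
    · simp
  comp_id {T T' n} h f := by
    ext i j
    rw [twComp_apply, Finset.sum_eq_single j, twId_self, comp_castId]
    · intro b _ hb
      rw [twId_ne _ hb, map_zero]
    · simp
  assoc := twComp_assoc

theorem twD_twD {T T' : Tw A} {l m n : ℤ} (h : l + 1 = m) (h' : m + 1 = n) (f : TwHom T T' l) :
    twD h' (twD h f) = 0 := by
  have e1 := congrArg (fun z => twComp (by omega : 2 + l = n) z f) T'.maurerCartan'
  have e2 := congrArg (fun z => twComp (by omega : l + 2 = n) f z) T.maurerCartan'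
  simp only [map_add, LinearMap.add_apply, map_zero, LinearMap.zero_apply] at e1 e2
  simp only [twD_apply, map_add, map_sub, map_smul, twNaive_twNaive]
  rw [twNaive_twComp (hp := (by norm_num : (1 : ℤ) + 1 = 2)) (hq := h) (hl := by omega)
      (hr := by omega),
    twNaive_twComp (hp := h) (hq := (by norm_num : (1 : ℤ) + 1 = 2)) (hl := by omega)
      (hr := by omega)]
  rw [twComp_assoc (hpq := (by norm_num : (1 : ℤ) + 1 = 2)) (hqr := (by omega : 1 + l = m))
    (hs := by omega) (ht := by omega)] at e1
  rw [← twComp_assoc (hpq := (by omega : l + 1 = m)) (hqr := (by norm_num : (1 : ℤ) + 1 = 2))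
    (hs := by omega) (ht := by omega)] at e2
  rw [twComp_assoc (hpq := (by omega : 1 + l = m)) (hqr := (by omega : l + 1 = m))
    (hs := by omega) (ht := by omega)]
  obtain rfl := h
  simp only [sgn_succ]
  have hs1 : sgn k 1 = -1 := by simpa using sgn_succ k 0
  have hs := sgn_mul_self k l
  rw [hs1]
  simp only [smul_add, smul_sub, smul_neg, smul_smul, neg_smul, one_smul, hs]
  refine Eq.trans ?_ ((congrArg₂ (fun x y => x - y) e1 e2).trans (sub_zero _))
  abel

theorem twD_leibniz {T T' T'' : Tw A} {p q n p' q' n' : ℤ} (h : p + q = n) (hn : n + 1 = n')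
    (hp : p + 1 = p') (hq : q + 1 = q') (hl : p' + q = n') (hr : p + q' = n')
    (b : TwHom T' T'' p) (a : TwHom T T' q) :
    twD hn (twComp h b a) = twComp hl (twD hp b) a + sgn k p • twComp hr b (twD hq a) := by
  simp only [twD_apply, map_add, map_sub, map_smul, LinearMap.add_apply,
    LinearMap.sub_apply, LinearMap.smul_apply]
  rw [twNaive_twComp h hn hp hq hl hr,
    twComp_assoc (hpq := (by omega : 1 + p = p')) (hqr := h) (hs := hl) (ht := by omega),
    twComp_assoc (hpq := hp) (hqr := (by omega : 1 + q = q')) (hs := hl) (ht := hr),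
    twComp_assoc (hpq := h) (hqr := hq) (hs := hn) (ht := hr)]
  subst h
  simp only [sgn_add, smul_add, smul_sub, smul_smul]
  abel

/-- The DG category `A^pretr` of one-sided twisted complexes over `A`. -/
def DGCat.pretr (A : DGCat.{u, v, w} k) : DGCat.{max u v, v, w} k where
  toGrCat := GrCat.pretr A
  d := twD
  d_d := twD_twD
  leibniz := twD_leibniz

/-- An object of `A` as a twisted complex. -/
def Tw.of (X : A.Obj) : Tw A where
  n := 1
  C _ := X
  r _ := 0
  q _ _ := 0
  upper _ _ _ := rfl
  maurerCartan _ _ := by simp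

/-- A morphism of `A` as a morphism of twisted complexes. -/
def Tw.ofHom {X Y : A.Obj} {n : ℤ} (f : A.Hom X Y n) : TwHom (Tw.of X) (Tw.of Y) n :=
  fun _ _ => A.castDeg (by simp [Tw.of]) f

/-- The matrix with the only entry `f` in position `(0, 1)`. -/
def Tw.coneMatrix {X Y : A.Obj} (f : A.Hom X Y 0) (i j : Fin 2) :
    A.Hom ((![Y, X] : Fin 2 → A.Obj) j) ((![Y, X] : Fin 2 → A.Obj) i)
      (1 + (![0, 1] : Fin 2 → ℤ) i - (![0, 1] : Fin 2 → ℤ) j) :=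
  match i, j with
  | 0, 1 => A.castDeg (by simp) f
  | 0, 0 => 0
  | 1, 0 => 0
  | 1, 1 => 0

theorem Tw.coneMatrix_left {X Y : A.Obj} (f : A.Hom X Y 0) (i : Fin 2) :
    Tw.coneMatrix f i 0 = 0 := by
  fin_cases i <;> rfl

theorem Tw.coneMatrix_right {X Y : A.Obj} (f : A.Hom X Y 0) (j : Fin 2) :
    Tw.coneMatrix f 1 j = 0 := by
  fin_cases j <;> rfl

theorem d_castDeg (A : DGCat.{u, v, w} k) {X Y : A.Obj} {l m n : ℤ} (e : l = m) (h : m + 1 = n)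
    (f : A.Hom X Y l) : A.d h (A.castDeg e f) = A.d (by rw [e, h]) f := by
  subst e
  rfl

theorem Tw.d_coneMatrix {X Y : A.Obj} (f : A.Hom X Y 0) (hf : f ∈ A.cocycles X Y 0) :
    ∀ (i j : Fin 2) {n : ℤ}
      (h : 1 + (![0, 1] : Fin 2 → ℤ) i - (![0, 1] : Fin 2 → ℤ) j + 1 = n),
      A.d h (Tw.coneMatrix f i j) = 0
  | 0, 1, n, h => by
    obtain rfl : n = 0 + 1 := by rw [← h]; rfl
    exact (d_castDeg A _ _ f).trans hf
  | 0, 0, _, _ => map_zero _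
  | 1, 0, _, _ => map_zero _
  | 1, 1, _, _ => map_zero _

/-- The cone `(Y ⊕ X[1], q)`, with `q 0 1 = f`, of a closed morphism of degree `0`. -/
def Tw.cone {X Y : A.Obj} (f : A.Hom X Y 0) (hf : f ∈ A.cocycles X Y 0) : Tw A where
  n := 2
  C := ![Y, X]
  r := ![0, 1]
  q := Tw.coneMatrix f
  upper i j h := by
    fin_cases i <;> fin_cases j <;> first | rfl | (exfalso; revert h; decide)
  maurerCartan i j := by
    rw [Fin.sum_univ_two, Tw.coneMatrix_left, Tw.coneMatrix_right, map_zero, map_zero,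
      LinearMap.zero_apply]
    simp only [add_zero]
    rw [Tw.d_coneMatrix f hf, smul_zero]

end pretr

/-! ### The DG quotient -/

section quotient
variable {k : Type w} [CommRing k]

/-- Expressions in the morphisms of `A` and new morphisms `ε_U : U → U` of degree `-1`, for the
objects `U` in `S`. -/
inductive Expr (A : DGCat.{u, v, w} k) (S : Set A.Obj) :
    A.Obj → A.Obj → ℤ → Type (max u v w)
  | of {X Y : A.Obj} {n : ℤ} (f : A.Hom X Y n) : Expr A S X Y n
  | eps (U : A.Obj) (hU : U ∈ S) : Expr A S U U (-1)
  | comp {X Y Z : A.Obj} {p q n : ℤ} (h : p + q = n) (b : Expr A S Y Z p) (a : Expr A S X Y q) :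
      Expr A S X Z n
  | add {X Y : A.Obj} {n : ℤ} (a b : Expr A S X Y n) : Expr A S X Y n
  | smul {X Y : A.Obj} {n : ℤ} (c : k) (a : Expr A S X Y n) : Expr A S X Y n

variable {A : DGCat.{u, v, w} k} {S : Set A.Obj}

/-- The congruence on expressions generated by the axioms of a graded `k`-category and the
relations between the morphisms of `A`. -/
inductive Expr.Rel : ∀ {X Y : A.Obj} {n : ℤ}, Expr A S X Y n → Expr A S X Y n → Prop
  | refl {X Y n} (a : Expr A S X Y n) : Rel a a
  | symm {X Y n} {a b : Expr A S X Y n} : Rel a b → Rel b a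
  | trans {X Y n} {a b c : Expr A S X Y n} : Rel a b → Rel b c → Rel a c
  | comp_congr {X Y Z p q n} (h : p + q = n) {b b' : Expr A S Y Z p} {a a' : Expr A S X Y q} :
      Rel b b' → Rel a a' → Rel (.comp h b a) (.comp h b' a')
  | add_congr {X Y n} {a a' b b' : Expr A S X Y n} :
      Rel a a' → Rel b b' → Rel (.add a b) (.add a' b')
  | smul_congr {X Y n} (c : k) {a a' : Expr A S X Y n} :
      Rel a a' → Rel (.smul c a) (.smul c a')
  | add_assoc {X Y n} (a b c : Expr A S X Y n) : Rel (.add (.add a b) c) (.add a (.add b c))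
  | add_comm {X Y n} (a b : Expr A S X Y n) : Rel (.add a b) (.add b a)
  | zero_add {X Y n} (a : Expr A S X Y n) : Rel (.add (.of 0) a) a
  | zero_smul {X Y n} (a : Expr A S X Y n) : Rel (.smul 0 a) (.of 0)
  | one_smul {X Y n} (a : Expr A S X Y n) : Rel (.smul 1 a) a
  | mul_smul {X Y n} (c c' : k) (a : Expr A S X Y n) :
      Rel (.smul (c * c') a) (.smul c (.smul c' a))
  | smul_add {X Y n} (c : k) (a b : Expr A S X Y n) :
      Rel (.smul c (.add a b)) (.add (.smul c a) (.smul c b))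
  | add_smul {X Y n} (c c' : k) (a : Expr A S X Y n) :
      Rel (.smul (c + c') a) (.add (.smul c a) (.smul c' a))
  | of_add {X Y n} (f g : A.Hom X Y n) : Rel (.of (f + g)) (.add (.of f) (.of g))
  | of_smul {X Y n} (c : k) (f : A.Hom X Y n) : Rel (.of (c • f)) (.smul c (.of f))
  | of_comp {X Y Z p q n} (h : p + q = n) (b : A.Hom Y Z p) (a : A.Hom X Y q) :
      Rel (.of (A.comp h b a)) (.comp h (.of b) (.of a))
  | id_comp {X Y n} (h : 0 + n = n) (a : Expr A S X Y n) : Rel (.comp h (.of (A.id Y)) a) a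
  | comp_id {X Y n} (h : n + 0 = n) (a : Expr A S X Y n) : Rel (.comp h a (.of (A.id X))) a
  | assoc {W X Y Z p q r s t n} (hpq : p + q = s) (hqr : q + r = t) (hs : s + r = n)
      (ht : p + t = n) (c : Expr A S Y Z p) (b : Expr A S X Y q) (a : Expr A S W X r) :
      Rel (.comp hs (.comp hpq c b) a) (.comp ht c (.comp hqr b a))
  | add_comp {X Y Z p q n} (h : p + q = n) (b b' : Expr A S Y Z p) (a : Expr A S X Y q) :
      Rel (.comp h (.add b b') a) (.add (.comp h b a) (.comp h b' a))
  | comp_add {X Y Z p q n} (h : p + q = n) (b : Expr A S Y Z p) (a a' : Expr A S X Y q) :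
      Rel (.comp h b (.add a a')) (.add (.comp h b a) (.comp h b a'))
  | smul_comp {X Y Z p q n} (h : p + q = n) (c : k) (b : Expr A S Y Z p) (a : Expr A S X Y q) :
      Rel (.comp h (.smul c b) a) (.smul c (.comp h b a))
  | comp_smul {X Y Z p q n} (h : p + q = n) (c : k) (b : Expr A S Y Z p) (a : Expr A S X Y q) :
      Rel (.comp h b (.smul c a)) (.smul c (.comp h b a))

/-- Equality of expressions modulo the relations. -/
instance Expr.setoid (X Y : A.Obj) (n : ℤ) : Setoid (Expr A S X Y n) where
  r := Expr.Rel
  iseqv := ⟨.refl, .symm, .trans⟩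

variable (A S) in
/-- The morphisms of degree `n` of the DG quotient. -/
def QHom (X Y : A.Obj) (n : ℤ) : Type (max u v w) := Quotient (Expr.setoid (S := S) X Y n)

/-- The morphism represented by an expression. -/
def QHom.mk {X Y : A.Obj} {n : ℤ} (a : Expr A S X Y n) : QHom A S X Y n := Quotient.mk _ a

theorem QHom.sound {X Y : A.Obj} {n : ℤ} {a b : Expr A S X Y n} (h : Expr.Rel a b) :
    QHom.mk a = QHom.mk b := Quotient.sound h

theorem QHom.exists_mk {X Y : A.Obj} {n : ℤ} (x : QHom A S X Y n) : ∃ a, QHom.mk a = x :=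
  Quotient.exists_rep x

instance (X Y : A.Obj) (n : ℤ) : Zero (QHom A S X Y n) := ⟨QHom.mk (.of 0)⟩
instance (X Y : A.Obj) (n : ℤ) : Add (QHom A S X Y n) :=
  ⟨Quotient.map₂ .add fun _ _ h _ _ h' => .add_congr h h'⟩
instance (X Y : A.Obj) (n : ℤ) : SMul k (QHom A S X Y n) :=
  ⟨fun c => Quotient.map (.smul c) fun _ _ h => .smul_congr c h⟩
instance (X Y : A.Obj) (n : ℤ) : Neg (QHom A S X Y n) := ⟨fun x => (-1 : k) • x⟩

theorem QHom.mk_zero {X Y : A.Obj} {n : ℤ} : (QHom.mk (.of 0) : QHom A S X Y n) = 0 := rfl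
theorem QHom.mk_add {X Y : A.Obj} {n : ℤ} (a b : Expr A S X Y n) :
    QHom.mk (.add a b) = QHom.mk a + QHom.mk b := rfl
theorem QHom.mk_smul {X Y : A.Obj} {n : ℤ} (c : k) (a : Expr A S X Y n) :
    QHom.mk (.smul c a) = c • QHom.mk a := rfl

theorem QHom.one_smul' {X Y : A.Obj} {n : ℤ} (x : QHom A S X Y n) : (1 : k) • x = x := by
  obtain ⟨x, rfl⟩ := QHom.exists_mk x
  exact QHom.sound (.one_smul x)
theorem QHom.add_smul' {X Y : A.Obj} {n : ℤ} (c c' : k) (x : QHom A S X Y n) :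
    (c + c') • x = c • x + c' • x := by
  obtain ⟨x, rfl⟩ := QHom.exists_mk x
  exact QHom.sound (.add_smul c c' x)
theorem QHom.zero_smul' {X Y : A.Obj} {n : ℤ} (x : QHom A S X Y n) : (0 : k) • x = 0 := by
  obtain ⟨x, rfl⟩ := QHom.exists_mk x
  exact QHom.sound (.zero_smul x)
theorem QHom.zero_add' {X Y : A.Obj} {n : ℤ} (x : QHom A S X Y n) : 0 + x = x := by
  obtain ⟨x, rfl⟩ := QHom.exists_mk x
  exact QHom.sound (.zero_add x)
theorem QHom.add_comm' {X Y : A.Obj} {n : ℤ} (x y : QHom A S X Y n) : x + y = y + x := by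
  obtain ⟨x, rfl⟩ := QHom.exists_mk x
  obtain ⟨y, rfl⟩ := QHom.exists_mk y
  exact QHom.sound (.add_comm x y)
theorem QHom.add_assoc' {X Y : A.Obj} {n : ℤ} (x y z : QHom A S X Y n) :
    x + y + z = x + (y + z) := by
  obtain ⟨x, rfl⟩ := QHom.exists_mk x
  obtain ⟨y, rfl⟩ := QHom.exists_mk y
  obtain ⟨z, rfl⟩ := QHom.exists_mk z
  exact QHom.sound (.add_assoc x y z)

instance (X Y : A.Obj) (n : ℤ) : AddCommGroup (QHom A S X Y n) where
  add_assoc := QHom.add_assoc'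
  zero_add := QHom.zero_add'
  add_zero x := by rw [QHom.add_comm', QHom.zero_add']
  nsmul := nsmulRec
  zsmul := zsmulRec
  neg_add_cancel x := by
    have h := QHom.add_smul' (-1 : k) 1 x
    rw [neg_add_cancel, QHom.zero_smul', QHom.one_smul'] at h
    exact h.symm
  add_comm := QHom.add_comm'

instance (X Y : A.Obj) (n : ℤ) : Module k (QHom A S X Y n) where
  one_smul := QHom.one_smul'
  mul_smul c c' x := by
    obtain ⟨x, rfl⟩ := QHom.exists_mk x
    exact QHom.sound (.mul_smul c c' x)
  smul_zero c := by
    refine QHom.sound (.trans (.smul_congr c (.symm (.zero_smul (.of 0)))) ?_)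
    refine .trans (.symm (.mul_smul c 0 _)) ?_
    rw [mul_zero]
    exact .zero_smul _
  smul_add c x y := by
    obtain ⟨x, rfl⟩ := QHom.exists_mk x
    obtain ⟨y, rfl⟩ := QHom.exists_mk y
    exact QHom.sound (.smul_add c x y)
  add_smul := QHom.add_smul'
  zero_smul := QHom.zero_smul'

/-- Composition in the DG quotient. -/
def QHom.comp {X Y Z : A.Obj} {p q n : ℤ} (h : p + q = n) :
    QHom A S Y Z p →ₗ[k] QHom A S X Y q →ₗ[k] QHom A S X Z n :=
  LinearMap.mk₂ k (Quotient.map₂ (.comp h) fun _ _ hb _ _ ha => .comp_congr h hb ha)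
    (fun b b' a => by
      obtain ⟨a, rfl⟩ := QHom.exists_mk a
      obtain ⟨b, rfl⟩ := QHom.exists_mk b
      obtain ⟨b', rfl⟩ := QHom.exists_mk b'
      exact QHom.sound (.add_comp h b b' a))
    (fun c b a => by
      obtain ⟨a, rfl⟩ := QHom.exists_mk a
      obtain ⟨b, rfl⟩ := QHom.exists_mk b
      exact QHom.sound (.smul_comp h c b a))
    (fun b a a' => by
      obtain ⟨a, rfl⟩ := QHom.exists_mk a
      obtain ⟨a', rfl⟩ := QHom.exists_mk a'
      obtain ⟨b, rfl⟩ := QHom.exists_mk b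
      exact QHom.sound (.comp_add h b a a'))
    (fun c b a => by
      obtain ⟨a, rfl⟩ := QHom.exists_mk a
      obtain ⟨b, rfl⟩ := QHom.exists_mk b
      exact QHom.sound (.comp_smul h c b a))

theorem QHom.comp_mk {X Y Z : A.Obj} {p q n : ℤ} (h : p + q = n) (b : Expr A S Y Z p)
    (a : Expr A S X Y q) : QHom.comp h (.mk b) (.mk a) = .mk (.comp h b a) := rfl

variable (S) in
/-- A morphism of `A` as a morphism of the DG quotient. -/
def QHom.of {X Y : A.Obj} {n : ℤ} : A.Hom X Y n →ₗ[k] QHom A S X Y n where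
  toFun f := .mk (.of f)
  map_add' f g := QHom.sound (.of_add f g)
  map_smul' c f := QHom.sound (.of_smul c f)

theorem QHom.of_comp {X Y Z : A.Obj} {p q n : ℤ} (h : p + q = n) (b : A.Hom Y Z p)
    (a : A.Hom X Y q) : QHom.of S (A.comp h b a) = QHom.comp h (QHom.of S b) (QHom.of S a) :=
  QHom.sound (.of_comp h b a)

theorem QHom.id_comp {X Y : A.Obj} {n : ℤ} (h : 0 + n = n) (x : QHom A S X Y n) :
    QHom.comp h (QHom.of S (A.id Y)) x = x := by
  obtain ⟨x, rfl⟩ := QHom.exists_mk x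
  exact QHom.sound (.id_comp h x)

theorem QHom.comp_id {X Y : A.Obj} {n : ℤ} (h : n + 0 = n) (x : QHom A S X Y n) :
    QHom.comp h x (QHom.of S (A.id X)) = x := by
  obtain ⟨x, rfl⟩ := QHom.exists_mk x
  exact QHom.sound (.comp_id h x)

theorem QHom.assoc {W X Y Z : A.Obj} {p q r s t n : ℤ} (hpq : p + q = s) (hqr : q + r = t)
    (hs : s + r = n) (ht : p + t = n) (c : QHom A S Y Z p) (b : QHom A S X Y q)
    (a : QHom A S W X r) :
    QHom.comp hs (QHom.comp hpq c b) a = QHom.comp ht c (QHom.comp hqr b a) := by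
  obtain ⟨a, rfl⟩ := QHom.exists_mk a
  obtain ⟨b, rfl⟩ := QHom.exists_mk b
  obtain ⟨c, rfl⟩ := QHom.exists_mk c
  exact QHom.sound (.assoc hpq hqr hs ht c b a)

/-- The differential of an expression: it is the one of `A` on the morphisms of `A`, and
`d ε_U = id_U`. -/
def Expr.d : ∀ {X Y : A.Obj} {m : ℤ} (_ : Expr A S X Y m) {n : ℤ} (_ : m + 1 = n), QHom A S X Y n
  | _, _, _, .of f, _, h => QHom.of S (A.d h f)
  | _, _, _, .eps U _, _, h => QHom.of S (A.castDeg (by rw [← h]; rfl) (A.id U))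
  | _, _, _, .comp (p := p) h' b a, _, h =>
      QHom.comp (by rw [← h, ← h']; ring) (b.d rfl) (.mk a) +
        sgn k p • QHom.comp (by rw [← h, ← h']; ring) (.mk b) (a.d rfl)
  | _, _, _, .add a b, _, h => a.d h + b.d h
  | _, _, _, .smul c a, _, h => c • a.d h

theorem Expr.d_comp {X Y Z : A.Obj} {p q n p' q' n' : ℤ} (h : p + q = n) (hn : n + 1 = n')
    (hp : p + 1 = p') (hq : q + 1 = q') (hl : p' + q = n') (hr : p + q' = n')
    (b : Expr A S Y Z p) (a : Expr A S X Y q) :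
    (Expr.comp h b a).d hn = QHom.comp hl (b.d hp) (.mk a) +
      sgn k p • QHom.comp hr (.mk b) (a.d hq) := by
  subst hp hq
  rfl

theorem DGCat.d_id (A : DGCat.{u, v, w} k) (X : A.Obj) {n : ℤ} (h : 0 + 1 = n) :
    A.d h (A.id X) = 0 := by
  have := A.leibniz (add_zero 0) h h h (by rw [add_zero]) (by rw [zero_add]) (A.id X) (A.id X)
  rw [A.comp_id, A.comp_id, sgn_zero, one_smul, A.id_comp] at this
  simpa using this

theorem Expr.Rel.d {X Y : A.Obj} {m n : ℤ} (h : m + 1 = n) {a b : Expr A S X Y m}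
    (hab : Expr.Rel a b) : a.d h = b.d h := by
  induction hab generalizing n with
  | refl a => rfl
  | symm _ ih => exact (ih h).symm
  | trans _ _ ih ih' => exact (ih h).trans (ih' h)
  | comp_congr h' hb ha ihb iha =>
    rw [d_comp h' h rfl rfl (by omega) (by omega), d_comp h' h rfl rfl (by omega) (by omega),
      ihb, iha, QHom.sound hb, QHom.sound ha]
  | add_congr _ _ ih ih' => simp only [Expr.d, ih h, ih' h]
  | smul_congr c _ ih => simp only [Expr.d, ih h]
  | add_assoc a b c => simp only [Expr.d, _root_.add_assoc]
  | add_comm a b => simp only [Expr.d]; rw [_root_.add_comm]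
  | zero_add a => simp only [Expr.d, map_zero, _root_.zero_add]
  | zero_smul a => simp only [Expr.d, map_zero, _root_.zero_smul]
  | one_smul a => simp only [Expr.d, _root_.one_smul]
  | mul_smul c c' a => simp only [Expr.d, SemigroupAction.mul_smul]
  | smul_add c a b => simp only [Expr.d, _root_.smul_add]
  | add_smul c c' a => simp only [Expr.d, _root_.add_smul]
  | of_add f g => simp only [Expr.d, map_add]
  | of_smul c f => simp only [Expr.d, map_smul]
  | of_comp h' b a =>
    rw [d_comp h' h rfl rfl (by omega) (by omega)]
    simp only [Expr.d]
    rw [A.leibniz h' h rfl rfl (by omega) (by omega), map_add, map_smul, QHom.of_comp,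
      QHom.of_comp]
    rfl
  | id_comp h' a =>
    rw [d_comp h' h rfl h (by omega) (by omega)]
    simp only [Expr.d]
    rw [A.d_id, map_zero, map_zero, LinearMap.zero_apply, _root_.zero_add, sgn_zero,
      _root_.one_smul]
    exact QHom.id_comp _ _
  | comp_id h' a =>
    rw [d_comp h' h h rfl (by omega) (by omega)]
    simp only [Expr.d]
    rw [A.d_id, map_zero, map_zero, _root_.smul_zero, _root_.add_zero]
    exact QHom.comp_id _ _
  | @assoc _ _ _ _ p q r s t _ hpq hqr hs ht c b a =>
    rw [d_comp hs h rfl rfl (by omega) (by omega), d_comp hpq rfl rfl rfl (by omega) (by omega),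
      d_comp ht h rfl rfl (by omega) (by omega), d_comp hqr rfl rfl rfl (by omega) (by omega),
      ← QHom.comp_mk, ← QHom.comp_mk]
    simp only [map_add, map_smul, LinearMap.add_apply, LinearMap.smul_apply, _root_.smul_add,
      smul_smul]
    rw [QHom.assoc (hqr := hqr) (ht := by omega),
      QHom.assoc (hqr := (by omega : q + 1 + r = t + 1)) (ht := by omega),
      QHom.assoc (hqr := (by omega : q + (r + 1) = t + 1)) (ht := by omega), _root_.add_assoc,
      (by rw [← hpq, sgn_add] : sgn k s = sgn k p * sgn k q)]
  | add_comp h' b b' a =>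
    simp only [Expr.d, QHom.mk_add, map_add, LinearMap.add_apply, _root_.smul_add]
    abel
  | comp_add h' b a a' =>
    simp only [Expr.d, QHom.mk_add, map_add, _root_.smul_add]
    abel
  | smul_comp h' c b a =>
    simp only [Expr.d, QHom.mk_smul, map_smul, LinearMap.smul_apply, _root_.smul_add]
    rw [smul_comm c]
  | comp_smul h' c b a =>
    simp only [Expr.d, QHom.mk_smul, map_smul, _root_.smul_add]
    rw [smul_comm c]

/-- The differential of the DG quotient. -/
def QHom.d {X Y : A.Obj} {m n : ℤ} (h : m + 1 = n) : QHom A S X Y m →ₗ[k] QHom A S X Y n where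
  toFun := Quotient.lift (fun a => a.d h) fun _ _ hab => Expr.Rel.d h hab
  map_add' x y := by
    obtain ⟨x, rfl⟩ := QHom.exists_mk x
    obtain ⟨y, rfl⟩ := QHom.exists_mk y
    rfl
  map_smul' c x := by
    obtain ⟨x, rfl⟩ := QHom.exists_mk x
    rfl

theorem QHom.d_mk {X Y : A.Obj} {m n : ℤ} (h : m + 1 = n) (a : Expr A S X Y m) :
    QHom.d h (.mk a) = a.d h := rfl

theorem QHom.leibniz {X Y Z : A.Obj} {p q n p' q' n' : ℤ} (h : p + q = n) (hn : n + 1 = n')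
    (hp : p + 1 = p') (hq : q + 1 = q') (hl : p' + q = n') (hr : p + q' = n')
    (b : QHom A S Y Z p) (a : QHom A S X Y q) :
    QHom.d hn (QHom.comp h b a) = QHom.comp hl (QHom.d hp b) a +
      sgn k p • QHom.comp hr b (QHom.d hq a) := by
  obtain ⟨a, rfl⟩ := QHom.exists_mk a
  obtain ⟨b, rfl⟩ := QHom.exists_mk b
  exact Expr.d_comp h hn hp hq hl hr b a

theorem QHom.d_d {X Y : A.Obj} {l m n : ℤ} (h : l + 1 = m) (h' : m + 1 = n)
    (x : QHom A S X Y l) : QHom.d h' (QHom.d h x) = 0 := by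
  obtain ⟨a, rfl⟩ := QHom.exists_mk x
  rw [QHom.d_mk]
  induction a generalizing m n with
  | of f =>
    change QHom.of S (A.d h' (A.d h f)) = 0
    rw [A.d_d, map_zero]
  | eps U hU =>
    obtain rfl : m = 0 := by omega
    change QHom.of S (A.d h' (A.id U)) = 0
    rw [A.d_id, map_zero]
  | @comp X Y Z p q r hpq b a ihb iha =>
    rw [Expr.d_comp hpq h rfl rfl (by omega) (by omega), map_add, map_smul,
      QHom.leibniz _ h' rfl rfl (by omega) (by omega),
      QHom.leibniz _ h' rfl rfl (by omega) (by omega), ihb, iha, sgn_succ,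
      QHom.d_mk, QHom.d_mk]
    simp
  | add a b iha ihb =>
    simp only [Expr.d, map_add]
    rw [iha, ihb, add_zero]
  | smul c a iha =>
    simp only [Expr.d, map_smul]
    rw [iha, smul_zero]

variable (A S) in
/-- The DG quotient `A/B`, for the full DG subcategory `B` of `A` with the set of objects `S`: it
is obtained from `A` by freely adding, for each object `U` of `B`, a morphism `ε_U : U → U` of
degree `-1` with `d ε_U = id_U`. -/
def DGCat.quotient : DGCat.{u, max u v w, w} k where
  Obj := A.Obj
  Hom := QHom A S
  id X := QHom.of S (A.id X)
  comp := QHom.comp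
  id_comp := QHom.id_comp
  comp_id := QHom.comp_id
  assoc := QHom.assoc
  d := QHom.d
  d_d := QHom.d_d
  leibniz := QHom.leibniz

end quotient

/-! ### The categories `I₂`, `K` and `A/B` -/

/-- The two objects `X₁` and `X₂`. -/
inductive Two : Type
  | x₁ : Two
  | x₂ : Two

open Two

/-- The category with two objects and precisely one morphism with any given source and target. -/
abbrev J₂ : CategoryTheory.Category.{0} Two where
  Hom _ _ := Unit
  id _ := ()
  comp _ _ := ()
  id_comp _ := rfl
  comp_id _ := rfl
  assoc _ _ _ := rfl

/-- The arrow of `A₀`. -/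
inductive ArrowGen : Two → Two → Type
  | f : ArrowGen x₁ x₂

/-- The arrows of `K`. -/
inductive KGen : Two → Two → Type
  | f : KGen x₁ x₂
  | g : KGen x₂ x₁
  | α₁ : KGen x₁ x₁
  | α₂ : KGen x₂ x₂
  | u : KGen x₁ x₂

/-- The degrees of the arrows of `K`. -/
def KGen.deg : ∀ a b : Two, KGen a b → ℤ
  | _, _, .f => 0
  | _, _, .g => 0
  | _, _, .α₁ => -1
  | _, _, .α₂ => -1
  | _, _, .u => -2

section main
variable (k : Type w) [CommRing k]

/-- The `k`-category `I₂` generated by `J₂`. -/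
def I₂ : DGCat.{0, w, w} k := DGCat.lin k J₂

/-- The morphism of degree `0` of `I₂` given by the morphism `a → b` of `J₂`. -/
def I₂.arrow (a b : Two) : (I₂ k).Hom a b 0 := Finsupp.single ⟨(), rfl⟩ (1 : k)

/-- The DG category `A₀` freely generated by `f : X₁ → X₂` of degree `0` with `df = 0`. -/
def A₀ : DGCat.{0, w, w} k :=
  DGCat.free (k := k) (E := ArrowGen) (δ := fun _ _ _ => 0) (fun _ _ _ => 0)
    (fun _ _ _ => map_zero _)

/-- The generator `f` of `A₀`. -/
def A₀.f : (A₀ k).Hom x₁ x₂ 0 := word k (fun _ _ _ => 0) (.cons ArrowGen.f .nil) rfl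

theorem A₀.f_closed : A₀.f k ∈ (A₀ k).cocycles x₁ x₂ 0 := by
  refine (freeD_word _ _ _ (rfl : (0 : ℤ) + 1 = 0 + 1)).trans ?_
  rw [dWord_cons _ _ _ rfl _ rfl (by rfl) (by rfl), dWord_nil, map_zero, LinearMap.zero_apply,
    map_zero, smul_zero, add_zero]
  rfl

/-- The differentials of the generators of `K`: `df = dg = 0`, `dα₁ = gf - 1`, `dα₂ = fg - 1`,
`du = fα₁ - α₂f`. -/
def KGen.d : ∀ (a b : Two) (e : KGen a b), FreeHom k KGen.deg a b (KGen.deg a b e + 1)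
  | _, _, .f => 0
  | _, _, .g => 0
  | _, _, .α₁ => word k KGen.deg (.cons .g (.cons .f .nil)) (by decide) -
      word k KGen.deg .nil (by decide)
  | _, _, .α₂ => word k KGen.deg (.cons .f (.cons .g .nil)) (by decide) -
      word k KGen.deg .nil (by decide)
  | _, _, .u => word k KGen.deg (.cons .f (.cons .α₁ .nil)) (by decide) -
      word k KGen.deg (.cons .α₂ (.cons .f .nil)) (by decide)

theorem KGen.dWord_cons_zero {a b c : Two} (e : KGen b c) {z : ℤ} (he : KGen.deg _ _ e = z) (hz : z = 0)
    (hd : KGen.d k _ _ e = 0) (p : Word KGen a b) {i m n : ℤ} (hi : Word.deg KGen.deg p = i)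
    (hm : i + 1 = m) (h : Word.deg KGen.deg (.cons e p) + 1 = n) (h2 : z + m = n) :
    dWord k (KGen.d k) (.cons e p) h =
      freeComp k KGen.deg h2 (word k KGen.deg (.cons e .nil) (by simp [Word.deg, he]))
        (dWord k (KGen.d k) p (by rw [hi, hm])) := by
  rw [dWord_cons (i := i) (m := m) _ _ _ hi _ (by rw [hi, hm]) (by omega) (by omega), hd, map_zero,
    LinearMap.zero_apply, zero_add, (by rw [he, hz, sgn_zero] : sgn k (KGen.deg _ _ e) = 1),
    one_smul]
  subst he
  rfl

theorem KGen.dWord_f {n : ℤ} (h : Word.deg KGen.deg (.cons KGen.f .nil) + 1 = n) :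
    dWord k (KGen.d k) (.cons KGen.f .nil) h = 0 := by
  rw [KGen.dWord_cons_zero k _ rfl rfl rfl _ rfl rfl h h, dWord_nil, map_zero]

theorem KGen.dWord_g {n : ℤ} (h : Word.deg KGen.deg (.cons KGen.g .nil) + 1 = n) :
    dWord k (KGen.d k) (.cons KGen.g .nil) h = 0 := by
  rw [KGen.dWord_cons_zero k _ rfl rfl rfl _ rfl rfl h h, dWord_nil, map_zero]

theorem KGen.dWord_gf {n : ℤ}
    (h : Word.deg KGen.deg (.cons KGen.g (.cons KGen.f .nil)) + 1 = n) :
    dWord k (KGen.d k) (.cons KGen.g (.cons KGen.f .nil)) h = 0 := by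
  rw [KGen.dWord_cons_zero k _ rfl rfl rfl _ rfl rfl h h, dWord_f, map_zero]

theorem KGen.dWord_fg {n : ℤ}
    (h : Word.deg KGen.deg (.cons KGen.f (.cons KGen.g .nil)) + 1 = n) :
    dWord k (KGen.d k) (.cons KGen.f (.cons KGen.g .nil)) h = 0 := by
  rw [KGen.dWord_cons_zero k _ rfl rfl rfl _ rfl rfl h h, dWord_g, map_zero]

theorem KGen.dWord_α₁ {n : ℤ} (h : Word.deg KGen.deg (.cons KGen.α₁ .nil) + 1 = n) (h' : n = 0)
    (h₁ : Word.deg KGen.deg (.cons KGen.g (.cons KGen.f .nil)) = n)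
    (h₂ : Word.deg KGen.deg (.nil : Word KGen x₁ x₁) = n) :
    dWord k (KGen.d k) (.cons KGen.α₁ .nil) h =
      word k KGen.deg (.cons .g (.cons .f .nil)) h₁ - word k KGen.deg .nil h₂ := by
  subst h'
  rw [dWord_cons (i := 0) (m := 1) (n := 0) _ _ _ (by decide) _ (by decide)
    (by decide) (by decide), dWord_nil, map_zero,
    smul_zero, add_zero]
  exact freeComp_nil_right (n := 0) rfl (add_zero 0) _

theorem KGen.dWord_fα₁ {n : ℤ}
    (h : Word.deg KGen.deg (.cons KGen.f (.cons KGen.α₁ .nil)) + 1 = n) (h' : n = 0)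
    (h₁ : Word.deg KGen.deg (.cons KGen.f (.cons KGen.g (.cons KGen.f .nil))) = n)
    (h₂ : Word.deg KGen.deg (.cons KGen.f .nil) = n) :
    dWord k (KGen.d k) (.cons KGen.f (.cons KGen.α₁ .nil)) h =
      word k KGen.deg (.cons KGen.f (.cons KGen.g (.cons KGen.f .nil))) h₁ -
        word k KGen.deg (.cons KGen.f .nil) h₂ := by
  rw [KGen.dWord_cons_zero (m := n) (z := 0) k _ rfl rfl rfl _ rfl (by rw [← h]; rfl) h (zero_add n),
    dWord_α₁ k _ h' (by rw [h']; rfl) (by rw [h']; rfl), map_sub, freeComp_word, freeComp_word]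
  rfl

theorem KGen.dWord_α₂f {n : ℤ}
    (h : Word.deg KGen.deg (.cons KGen.α₂ (.cons KGen.f .nil)) + 1 = n) (h' : n = 0)
    (h₁ : Word.deg KGen.deg (.cons KGen.f (.cons KGen.g (.cons KGen.f .nil))) = n)
    (h₂ : Word.deg KGen.deg (.cons KGen.f .nil) = n) :
    dWord k (KGen.d k) (.cons KGen.α₂ (.cons KGen.f .nil)) h =
      word k KGen.deg (.cons KGen.f (.cons KGen.g (.cons KGen.f .nil))) h₁ -
        word k KGen.deg (.cons KGen.f .nil) h₂ := by
  subst h'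
  rw [dWord_cons (i := 0) (m := 1) (n := 0) _ _ _ (by decide) _ (by decide)
    (by decide) (by decide), dWord_f, map_zero,
    smul_zero, add_zero]
  have e : KGen.d k _ _ KGen.α₂ = word k KGen.deg (.cons .f (.cons .g .nil)) (by decide) -
    word k KGen.deg .nil (by decide) := rfl
  rw [e, map_sub, LinearMap.sub_apply, freeComp_word, freeComp_word]
  rfl

theorem KGen.d_d (a b : Two) (e : KGen a b) :
    freeD k (KGen.d k) rfl (KGen.d k a b e) = 0 := by
  cases e
  · exact map_zero _
  · exact map_zero _
  · refine (map_sub _ _ _).trans ?_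
    rw [freeD_word, freeD_word, dWord_nil, dWord_gf, sub_zero]
  · refine (map_sub _ _ _).trans ?_
    rw [freeD_word, freeD_word, dWord_nil, dWord_fg, sub_zero]
  · refine (map_sub _ _ _).trans ?_
    rw [freeD_word, freeD_word, dWord_fα₁ k (n := KGen.deg _ _ KGen.u + 1 + 1) _ (by decide) (by decide)
      (by decide), dWord_α₂f k (n := KGen.deg _ _ KGen.u + 1 + 1) _ (by decide) (by decide)
      (by decide), sub_self]

/-- The DG category `K`. -/
def K : DGCat.{0, w, w} k := DGCat.free (KGen.d k) (KGen.d_d k)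

/-- The generators of `K` as morphisms of `K`. -/
def K.gen {a b : Two} (e : KGen a b) : (K k).Hom a b (KGen.deg a b e) :=
  word k KGen.deg (.cons e .nil) (add_zero _)

/-- `A = A₀^pretr`. -/
def A : DGCat.{w, w, w} k := (A₀ k).pretr

/-- The object `Cone(f)` of `A`. -/
def A.cone : (A k).Obj := Tw.cone (A₀.f k) (A₀.f_closed k)

/-- The DG quotient `A/B`, where `B` is the full DG subcategory of `A` with the single object
`Cone(f)`. -/
def AmodB : DGCat.{w, w, w} k := (A k).quotient {A.cone k}

/-- The objects `X₁` and `X₂` of `A/B`. -/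
def AmodB.X (a : Two) : (AmodB k).Obj := Tw.of (A := A₀ k) a

/-- The morphism `f : X₁ → X₂` of `A/B`. -/
def AmodB.f : (AmodB k).Hom (AmodB.X k x₁) (AmodB.X k x₂) 0 :=
  QHom.of (A := A k) {A.cone k} (Tw.ofHom (A₀.f k))

end main

theorem DGCat.id_mem_cocycles {k : Type w} [CommRing k] (C : DGCat.{u, v, w} k) (X : C.Obj) :
    C.id X ∈ C.cocycles X X 0 :=
  C.d_id X rfl

end DG

end

/-!
A DG functor out of the semi-free `K` is a homotopy equivalence `f` together with a homotopy
inverse, two homotopies and the coherence `u`. The functor to `I₂` has a section, and it is a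
quasi-isomorphism because `K` is contracted onto it by a homotopy which is explicit on the words in
the generators. On the other hand, the cone of `f` is `X₂ ⊕ X₁[1]` as a graded object, and the four
entries of the contraction `ε` of the cone in `A/B` are, up to sign, the morphisms `g`, `α₁`, `α₂`,
`u`; this defines `K → A/B`. It is surjective on morphisms since every twisted complex is a sum of
shifts of `X₁` and `X₂`, so that every expression in `ε` and morphisms of `A` is a matrix of values
of the functor. It is injective since sending `ε` to the matrix formed by `g`, `α₁`, `α₂`, `u`
gives a graded functor from `A/B` to the twisted complexes over `K` which is a retraction.
-/

noncomputable section

namespace DG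
open Two

/-! ### Transport along equalities of degrees -/

section castDeg
variable {k : Type w} [CommRing k] (A : GrCat.{u, v, w} k)

theorem GrCat.castDeg_castDeg {X Y : A.Obj} {l m n : ℤ} (h : l = m) (h' : m = n)
    (f : A.Hom X Y l) : A.castDeg h' (A.castDeg h f) = A.castDeg (h.trans h') f := by
  subst h h'
  rfl

theorem GrCat.castDeg_comp {X Y Z : A.Obj} {p q m n : ℤ} (e : m = n) (h : p + q = m)
    (b : A.Hom Y Z p) (a : A.Hom X Y q) :
    A.castDeg e (A.comp h b a) = A.comp (h.trans e) b a := by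
  subst e
  rfl

theorem GrCat.comp_castDeg_left {X Y Z : A.Obj} {p p' q n : ℤ} (e : p = p') (h : p' + q = n)
    (b : A.Hom Y Z p) (a : A.Hom X Y q) :
    A.comp h (A.castDeg e b) a = A.comp (by rw [e, h]) b a := by
  subst e
  rfl

theorem GrCat.comp_castDeg_right {X Y Z : A.Obj} {p q q' n : ℤ} (e : q = q') (h : p + q' = n)
    (b : A.Hom Y Z p) (a : A.Hom X Y q) :
    A.comp h b (A.castDeg e a) = A.comp (by rw [e, h]) b a := by
  subst e
  rfl

theorem GrCat.castDeg_bijective {X Y : A.Obj} {m n : ℤ} (e : m = n) :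
    Function.Bijective (A.castDeg (X := X) (Y := Y) e) := by
  subst e
  exact Function.bijective_id

end castDeg

/-! ### Graded functors -/

/-- A graded functor from `A` to `B` with the map `φ` on objects: a DG functor without the
compatibility with the differentials. -/
structure GrFunctor {k : Type w} [CommRing k] (A : GrCat.{u, v, w} k) (B : GrCat.{u', v', w} k)
    (φ : A.Obj → B.Obj) where
  map : ∀ {X Y : A.Obj} (n : ℤ), A.Hom X Y n →ₗ[k] B.Hom (φ X) (φ Y) n
  map_id : ∀ X : A.Obj, map 0 (A.id X) = B.id (φ X)
  map_comp : ∀ {X Y Z : A.Obj} {p q n : ℤ} (h : p + q = n) (b : A.Hom Y Z p) (a : A.Hom X Y q),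
    map n (A.comp h b a) = B.comp h (map p b) (map q a)

section GrFunctor
variable {k : Type w} [CommRing k]

theorem GrFunctor.map_castDeg {A : GrCat.{u, v, w} k} {B : GrCat.{u', v', w} k}
    {φ : A.Obj → B.Obj} (F : GrFunctor A B φ) {X Y : A.Obj} {m n : ℤ} (e : m = n)
    (f : A.Hom X Y m) : F.map n (A.castDeg e f) = B.castDeg e (F.map m f) := by
  subst e
  rfl

/-- The composition of graded functors. -/
def GrFunctor.comp {A : GrCat.{u, v, w} k} {B : GrCat.{u', v', w} k} {C : GrCat k}
    {φ : A.Obj → B.Obj} {ψ : B.Obj → C.Obj} (G : GrFunctor B C ψ) (F : GrFunctor A B φ) :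
    GrFunctor A C (ψ ∘ φ) where
  map n := (G.map n).comp (F.map n)
  map_id X := (congrArg (G.map 0) (F.map_id X)).trans (G.map_id _)
  map_comp h b a := (congrArg (G.map _) (F.map_comp h b a)).trans (G.map_comp h _ _)

/-- The graded functor underlying a DG functor. -/
def DGFunctor.toGrFunctor {A : DGCat.{u, v, w} k} {B : DGCat.{u', v', w} k} {φ : A.Obj → B.Obj}
    (F : DGFunctor A B φ) : GrFunctor A.toGrCat B.toGrCat φ where
  map := F.map
  map_id := F.map_id
  map_comp := F.map_comp

end GrFunctor

/-! ### Functors out of free categories -/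

section freeEval
variable {k : Type w} [CommRing k] {V : Type u} {E : V → V → Type g} {δ : ∀ a b : V, E a b → ℤ}

theorem FreeHom.linearMap_ext {a b : V} {n : ℤ} {M : Type*} [AddCommGroup M] [Module k M]
    {F G : FreeHom k δ a b n →ₗ[k] M}
    (h : ∀ (p : Word E a b) (hp : Word.deg δ p = n), F (word k δ p hp) = G (word k δ p hp)) :
    F = G :=
  Finsupp.lhom_ext' fun p => LinearMap.ext_ring (h p.1 p.2)

theorem word_cons {a b c : V} (e : E b c) (p : Word E a b) {m n : ℤ} (hp : Word.deg δ p = m)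
    (h : Word.deg δ (.cons e p) = n) (he : Word.deg δ (.cons e .nil) = δ b c e)
    (h' : δ b c e + m = n) :
    word k δ (.cons e p) h = freeComp k δ h' (word k δ (.cons e .nil) he) (word k δ p hp) := by
  rw [freeComp_word]
  rfl

theorem freeD_gen (dgen : ∀ (a b : V) (e : E a b), FreeHom k δ a b (δ a b e + 1)) {a b : V}
    (e : E a b) (h : Word.deg δ (.cons e .nil) = δ a b e) :
    freeD k dgen rfl (word k δ (.cons e .nil) h) = dgen a b e := by
  rw [freeD_word, dWord_cons dgen e .nil rfl _ rfl (add_zero _)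
      (by rw [Word.deg, zero_add]), dWord_nil, map_zero, smul_zero, add_zero]
  exact freeComp_nil_right rfl _ _

section
variable (B : GrCat.{u', v', w} k) {φ : V → B.Obj}
  (gen : ∀ a b (e : E a b), B.Hom (φ a) (φ b) (δ a b e))

/-- The value of a word, given the values of the arrows. -/
def Word.eval {a : V} :
    ∀ {b : V} (p : Word E a b) {n : ℤ} (_ : Word.deg δ p = n), B.Hom (φ a) (φ b) n
  | _, .nil, _, h => B.castDeg h (B.id (φ a))
  | _, .cons e p, _, h => B.comp h (gen _ _ e) (Word.eval p rfl)

theorem Word.eval_cons {a b c : V} (e : E b c) (p : Word E a b) {m n : ℤ}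
    (hp : Word.deg δ p = m) (h : Word.deg δ (.cons e p) = n) (h' : δ _ _ e + m = n) :
    Word.eval B gen (.cons e p) h = B.comp h' (gen _ _ e) (Word.eval B gen p hp) := by
  subst hp
  rfl

theorem Word.eval_comp {a b c : V} (p : Word E a b) (q : Word E b c) {l m n : ℤ}
    (hp : Word.deg δ p = l) (hq : Word.deg δ q = m) (h : Word.deg δ (p.comp q) = n)
    (h' : m + l = n) :
    Word.eval B gen (p.comp q) h = B.comp h' (Word.eval B gen q hq) (Word.eval B gen p hp) := by
  induction q generalizing m n with
  | nil =>
    obtain rfl : 0 = m := hq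
    obtain rfl : l = n := by omega
    exact (B.id_comp h' _).symm
  | cons e q ih =>
    have hc : δ _ _ e + Word.deg δ q = m := hq
    have hl : Word.deg δ (p.comp q) = Word.deg δ q + l := by rw [Word.deg_comp, hp, add_comm]
    refine (Word.eval_cons B gen e (p.comp q) hl h (by omega)).trans ?_
    rw [ih rfl hl rfl, Word.eval_cons B gen e q rfl hq hc, B.assoc]

/-- The linear extension of the evaluation of words. -/
def freeEval {a b : V} (n : ℤ) : FreeHom k δ a b n →ₗ[k] B.Hom (φ a) (φ b) n :=
  Finsupp.linearCombination k
    fun p : {p : Word E a b // Word.deg δ p = n} => Word.eval B gen p.1 p.2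

theorem freeEval_word {a b : V} (p : Word E a b) {n : ℤ} (h : Word.deg δ p = n) :
    freeEval B gen n (word k δ p h) = Word.eval B gen p h :=
  (Finsupp.linearCombination_single k _ _).trans (one_smul k _)

theorem freeEval_gen {a b : V} (e : E a b) (h : Word.deg δ (.cons e .nil) = δ a b e) :
    freeEval B gen _ (word k δ (.cons e .nil) h) = gen a b e := by
  rw [freeEval_word, Word.eval_cons B gen e .nil rfl h (add_zero _)]
  exact B.comp_id _ _

theorem freeEval_comp {a b c : V} {p q n : ℤ} (h : p + q = n) (y : FreeHom k δ b c p)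
    (x : FreeHom k δ a b q) :
    freeEval B gen n (freeComp k δ h y x) =
      B.comp h (freeEval B gen p y) (freeEval B gen q x) := by
  induction x using FreeHom.induction with
  | zero => simp
  | add x x' hx hx' => simp only [map_add, hx, hx']
  | smul s x hx =>
    induction y using FreeHom.induction with
    | zero => simp
    | add y y' hy hy' => simp only [map_add, LinearMap.add_apply, hy, hy']
    | smul t y hy =>
      simp only [map_smul, LinearMap.smul_apply, freeComp_word, freeEval_word]
      rw [Word.eval_comp B gen x y hx hy _ h]

/-- The graded functor from a free graded category with prescribed values on the arrows. -/
def GrFunctor.ofFree : GrFunctor (GrCat.free k δ) B φ where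
  map n := freeEval B gen n
  map_id _ := freeEval_word B gen .nil rfl
  map_comp h y x := freeEval_comp B gen h y x

end

theorem GrFunctor.ext_free {B : GrCat.{u', v', w} k} {φ : V → B.Obj}
    (F G : GrFunctor (GrCat.free k δ) B φ)
    (h : ∀ (a b : V) (e : E a b) (he : Word.deg δ (.cons e .nil) = δ a b e),
      F.map _ (word k δ (.cons e .nil) he) = G.map _ (word k δ (.cons e .nil) he))
    {a b : V} {n : ℤ} (x : FreeHom k δ a b n) : F.map n x = G.map n x := by
  suffices h' : ∀ {b : V} (p : Word E a b) {n : ℤ} (hp : Word.deg δ p = n),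
      F.map n (word k δ p hp) = G.map n (word k δ p hp) from
    LinearMap.congr_fun (FreeHom.linearMap_ext fun p hp => h' p hp) x
  intro b p n hp
  induction p generalizing n with
  | nil =>
    subst hp
    exact (F.map_id a).trans (G.map_id a).symm
  | cons e p ih =>
    have he : Word.deg δ (.cons e .nil) = δ _ _ e := add_zero _
    have hn : δ _ _ e + Word.deg δ p = n := hp
    rw [word_cons e p rfl hp he hn]
    calc F.map n _ = B.comp hn (F.map _ (word k δ (.cons e .nil) he))
          (F.map _ (word k δ p rfl)) := F.map_comp hn _ _
      _ = B.comp hn (G.map _ (word k δ (.cons e .nil) he)) (G.map _ (word k δ p rfl)) :=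
        congrArg₂ (fun y z => B.comp hn y z) (h _ _ e he) (ih rfl)
      _ = _ := (G.map_comp hn _ _).symm

section
variable {dgen : ∀ (a b : V) (e : E a b), FreeHom k δ a b (δ a b e + 1)}
  (B : DGCat.{u', v', w} k) {φ : V → B.Obj} (gen : ∀ a b (e : E a b), B.Hom (φ a) (φ b) (δ a b e))
  (hgen : ∀ a b (e : E a b), freeEval B.toGrCat gen _ (dgen a b e) = B.d rfl (gen a b e))
include hgen

theorem freeEval_dWord {a b : V} (p : Word E a b) {m n : ℤ} (hm : Word.deg δ p = m)
    (h : m + 1 = n) :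
    freeEval B.toGrCat gen n (dWord k dgen p (by rw [hm, h])) =
      B.d h (Word.eval B.toGrCat gen p hm) := by
  induction p generalizing m n with
  | nil =>
    obtain rfl : 0 = m := hm
    rw [dWord_nil, map_zero]
    exact (B.d_id _ h).symm
  | cons e p ih =>
    have hm' : δ _ _ e + Word.deg δ p = m := hm
    rw [dWord_cons dgen e p rfl _ rfl (by omega) (by omega),
      Word.eval_cons B.toGrCat gen e p rfl hm hm',
      B.leibniz hm' h rfl rfl (by omega) (by omega), map_add, map_smul, freeEval_comp,
      freeEval_comp, hgen, freeEval_word, freeEval_gen, ih rfl rfl]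

theorem freeEval_freeD {a b : V} {m n : ℤ} (h : m + 1 = n) (x : FreeHom k δ a b m) :
    freeEval B.toGrCat gen n (freeD k dgen h x) = B.d h (freeEval B.toGrCat gen m x) := by
  refine LinearMap.congr_fun (f := freeEval B.toGrCat gen n ∘ₗ freeD k dgen h)
    (g := B.d h ∘ₗ freeEval B.toGrCat gen m) (FreeHom.linearMap_ext fun p hp => ?_) x
  rw [LinearMap.comp_apply, LinearMap.comp_apply, freeD_word, freeEval_word,
    freeEval_dWord B gen hgen p hp h]

end

/-- The DG functor from a free DG category with prescribed values on the arrows, compatible with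
the differentials. -/
def DGFunctor.ofFree {dgen : ∀ (a b : V) (e : E a b), FreeHom k δ a b (δ a b e + 1)}
    (hd : ∀ (a b : V) (e : E a b), freeD k dgen rfl (dgen a b e) = 0)
    (B : DGCat.{u', v', w} k) {φ : V → B.Obj}
    (gen : ∀ a b (e : E a b), B.Hom (φ a) (φ b) (δ a b e))
    (hgen : ∀ a b (e : E a b), freeEval B.toGrCat gen _ (dgen a b e) = B.d rfl (gen a b e)) :
    DGFunctor (DGCat.free dgen hd) B φ where
  map n := freeEval B.toGrCat gen n
  map_id _ := freeEval_word B.toGrCat gen .nil rfl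
  map_comp h y x := freeEval_comp B.toGrCat gen h y x
  map_d h x := freeEval_freeD B gen hgen h x

end freeEval

/-! ### Cohomology and functors -/

section ext
variable {k : Type w} [CommRing k]

theorem isFreeGenerator_map_iff {M : Type v} {N : Type v'} [AddCommGroup M] [Module k M]
    [AddCommGroup N] [Module k N] {F : M →ₗ[k] N} (hF : Function.Bijective F) {x : M} :
    IsFreeGenerator k (F x) ↔ IsFreeGenerator k x := by
  have h : (fun c : k => c • F x) = F ∘ fun c : k => c • x := funext fun c => (map_smul F c x).symm
  rw [IsFreeGenerator, h]
  exact hF.of_comp_iff' _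

variable {A : DGCat.{u, v, w} k} {B : DGCat.{u', v', w} k} {φ : A.Obj → B.Obj}

theorem DGCat.exists_cls {X Y : A.Obj} {n : ℤ} (x : A.Ext X Y n) :
    ∃ z : A.cocycles X Y n, A.cls z = x :=
  Submodule.Quotient.mk_surjective _ x

theorem DGCat.cls_eq_zero {X Y : A.Obj} {n : ℤ} {z : A.cocycles X Y n} :
    A.cls z = 0 ↔ z.1 ∈ A.coboundaries X Y n :=
  Submodule.Quotient.mk_eq_zero _

theorem DGCat.mem_cocycles {X Y : A.Obj} {m n : ℤ} (h : m + 1 = n) {x : A.Hom X Y m} :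
    x ∈ A.cocycles X Y m ↔ A.d h x = 0 := by
  subst h
  rfl

theorem DGFunctor.mapExt_cls (F : DGFunctor A B φ) {X Y : A.Obj} {n : ℤ}
    (z : A.cocycles X Y n) : F.mapExt X Y n (A.cls z) = B.cls (F.mapCocycles X Y n z) := rfl

theorem DGFunctor.FullyFaithful.mapExt_bijective {F : DGFunctor A B φ} (hF : F.FullyFaithful)
    (X Y : A.Obj) (n : ℤ) : Function.Bijective (F.mapExt X Y n) := by
  constructor
  · rw [injective_iff_map_eq_zero]
    intro x hx
    obtain ⟨z, rfl⟩ := DGCat.exists_cls x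
    rw [F.mapExt_cls, DGCat.cls_eq_zero] at hx
    obtain ⟨y, hy⟩ := hx
    obtain ⟨y, rfl⟩ := (hF X Y (n - 1)).2 y
    rw [← F.map_d] at hy
    exact DGCat.cls_eq_zero.2 ⟨y, (hF X Y n).1 hy⟩
  · intro x
    obtain ⟨⟨z, hz⟩, rfl⟩ := DGCat.exists_cls x
    obtain ⟨y, rfl⟩ := (hF X Y n).2 z
    refine ⟨A.cls ⟨y, ?_⟩, rfl⟩
    rw [DGCat.mem_cocycles rfl, ← F.map_d] at hz
    exact (hF X Y (n + 1)).1 (hz.trans (map_zero _).symm)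

theorem DGFunctor.mapExt_bijective_of_homotopy (F : DGFunctor A B φ) {X Y : A.Obj}
    (s : ∀ n : ℤ, B.Hom (φ X) (φ Y) n →ₗ[k] A.Hom X Y n)
    (H : ∀ {m n : ℤ}, n + 1 = m → (A.Hom X Y m →ₗ[k] A.Hom X Y n))
    (hs : ∀ {m n : ℤ} (h : m + 1 = n) (y : B.Hom (φ X) (φ Y) m), A.d h (s m y) = s n (B.d h y))
    (hFs : ∀ (n : ℤ) (y : B.Hom (φ X) (φ Y) n), F.map n (s n y) = y)
    (hH : ∀ {l m n : ℤ} (h : l + 1 = m) (h' : m + 1 = n) (x : A.Hom X Y m),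
      x - s m (F.map m x) = A.d h (H h x) + H h' (A.d h' x)) (n : ℤ) :
    Function.Bijective (F.mapExt X Y n) := by
  constructor
  · rw [injective_iff_map_eq_zero]
    intro x hx
    obtain ⟨⟨z, hz⟩, rfl⟩ := DGCat.exists_cls x
    rw [F.mapExt_cls, DGCat.cls_eq_zero] at hx
    obtain ⟨y, hy : B.d _ y = F.map n z⟩ := hx
    have hsub := hH (sub_add_cancel n 1) rfl z
    rw [(DGCat.mem_cocycles rfl).1 hz, map_zero, add_zero, ← hy, ← hs] at hsub
    exact DGCat.cls_eq_zero.2 ⟨H _ z + s _ y, by rw [map_add, ← hsub, sub_add_cancel]⟩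
  · intro x
    obtain ⟨⟨z, hz⟩, rfl⟩ := DGCat.exists_cls x
    refine ⟨A.cls ⟨s n z, ?_⟩, congrArg B.cls (Subtype.ext (hFs n z))⟩
    rw [DGCat.mem_cocycles rfl, hs, (DGCat.mem_cocycles rfl).1 hz, map_zero]

theorem DGCat.isHoInverse_id (X : A.Obj) : A.IsHoInverse (A.id X) (A.id X) where
  closed_left := A.id_mem_cocycles X
  closed_right := A.id_mem_cocycles X
  left := by
    rw [A.id_comp, sub_self]
    exact zero_mem _
  right := by
    rw [A.id_comp, sub_self]
    exact zero_mem _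

end ext

/-! ### Homotopy equivalences with a coherence -/

section HoEquiv
variable {k : Type w} [CommRing k]

/-- A homotopy equivalence `f : X₁ → X₂` with quasi-inverse `g`, contractions `α₁` of `gf - 1` and
`α₂` of `fg - 1`, and a coherence `u` between the two resulting homotopies `f α₁` and `α₂ f`: the
data of a DG functor from `K` to `B`. -/
structure HoEquiv (B : DGCat.{u, v, w} k) (X₁ X₂ : B.Obj) where
  f : B.Hom X₁ X₂ 0
  g : B.Hom X₂ X₁ 0
  α₁ : B.Hom X₁ X₁ (-1)
  α₂ : B.Hom X₂ X₂ (-1)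
  u : B.Hom X₁ X₂ (-2)
  d_f : B.d (zero_add 1) f = 0
  d_g : B.d (zero_add 1) g = 0
  d_α₁ : B.d (neg_add_cancel 1) α₁ = B.comp (add_zero 0) g f - B.id X₁
  d_α₂ : B.d (neg_add_cancel 1) α₂ = B.comp (add_zero 0) f g - B.id X₂
  d_u : B.d (by norm_num) u = B.comp (zero_add (-1)) f α₁ - B.comp (add_zero (-1)) α₂ f

namespace HoEquiv
variable {B : DGCat.{u, v, w} k} {X₁ X₂ : B.Obj} (S : HoEquiv B X₁ X₂)

theorem isHoInverse : B.IsHoInverse S.f S.g where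
  closed_left := (DGCat.mem_cocycles _).2 S.d_f
  closed_right := (DGCat.mem_cocycles _).2 S.d_g
  left := ⟨S.α₁, S.d_α₁⟩
  right := ⟨S.α₂, S.d_α₂⟩

/-- The homotopy equivalence given by mutually inverse closed morphisms. -/
def ofIso (f : B.Hom X₁ X₂ 0) (g : B.Hom X₂ X₁ 0) (d_f : B.d (zero_add 1) f = 0)
    (d_g : B.d (zero_add 1) g = 0) (hgf : B.comp (add_zero 0) g f = B.id X₁)
    (hfg : B.comp (add_zero 0) f g = B.id X₂) : HoEquiv B X₁ X₂ where
  f := f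
  g := g
  α₁ := 0
  α₂ := 0
  u := 0
  d_f := d_f
  d_g := d_g
  d_α₁ := by rw [map_zero, hgf, sub_self]
  d_α₂ := by rw [map_zero, hfg, sub_self]
  d_u := by simp only [map_zero, LinearMap.zero_apply, sub_self]

variable {W : B.Obj} {l m n : ℤ}

theorem d_f_comp (h : m + 1 = n) (x : B.Hom W X₁ m) :
    B.d h (B.comp (zero_add m) S.f x) = B.comp (zero_add n) S.f (B.d h x) := by
  rw [B.leibniz _ h (zero_add 1) h (by omega) (zero_add n), S.d_f, map_zero, LinearMap.zero_apply,
    zero_add, sgn_zero, one_smul]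

theorem d_g_comp (h : m + 1 = n) (x : B.Hom W X₂ m) :
    B.d h (B.comp (zero_add m) S.g x) = B.comp (zero_add n) S.g (B.d h x) := by
  rw [B.leibniz _ h (zero_add 1) h (by omega) (zero_add n), S.d_g, map_zero, LinearMap.zero_apply,
    zero_add, sgn_zero, one_smul]

theorem d_α₁_comp (hl : -1 + m = l) (h : l + 1 = m) (h' : m + 1 = n) (hn : -1 + n = m)
    (x : B.Hom W X₁ m) :
    B.d h (B.comp hl S.α₁ x) = B.comp (zero_add m) S.g (B.comp (zero_add m) S.f x) - x -
      B.comp hn S.α₁ (B.d h' x) := by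
  rw [B.leibniz hl h (neg_add_cancel 1) h' (zero_add m) hn, S.d_α₁, map_sub, LinearMap.sub_apply,
    B.id_comp, B.assoc _ (zero_add m) _ (zero_add m), sgn_neg_one, neg_one_smul, ← sub_eq_add_neg]

theorem d_α₂_comp (hl : -1 + m = l) (h : l + 1 = m) (h' : m + 1 = n) (hn : -1 + n = m)
    (x : B.Hom W X₂ m) :
    B.d h (B.comp hl S.α₂ x) = B.comp (zero_add m) S.f (B.comp (zero_add m) S.g x) - x -
      B.comp hn S.α₂ (B.d h' x) := by
  rw [B.leibniz hl h (neg_add_cancel 1) h' (zero_add m) hn, S.d_α₂, map_sub, LinearMap.sub_apply,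
    B.id_comp, B.assoc _ (zero_add m) _ (zero_add m), sgn_neg_one, neg_one_smul, ← sub_eq_add_neg]

theorem d_u_comp {l' : ℤ} (hl : -2 + m = l) (h : l + 1 = l') (hα : -1 + m = l') (h' : m + 1 = n)
    (hn : -2 + n = l') (x : B.Hom W X₁ m) :
    B.d h (B.comp hl S.u x) = B.comp (zero_add l') S.f (B.comp hα S.α₁ x) -
      B.comp hα S.α₂ (B.comp (zero_add m) S.f x) + B.comp hn S.u (B.d h' x) := by
  have hsgn : sgn k (-2) = 1 := by rw [(by norm_num : (-2 : ℤ) = -1 + -1), sgn_add]; simp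
  rw [B.leibniz hl h (by norm_num) h' hα hn, S.d_u, map_sub, LinearMap.sub_apply,
    B.assoc _ hα _ (zero_add l'), B.assoc _ (zero_add m) _ hα, hsgn, one_smul]

end HoEquiv

end HoEquiv

/-! ### The universal property of `K` -/

/-- The morphisms of a homotopy equivalence, indexed by the generators of `K`. -/
def HoEquiv.ofGen {k : Type w} [CommRing k] {B : DGCat.{u, v, w} k} {X : Two → B.Obj}
    (S : HoEquiv B (X x₁) (X x₂)) : ∀ (a b : Two) (e : KGen a b), B.Hom (X a) (X b) (KGen.deg a b e)
  | _, _, .f => S.f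
  | _, _, .g => S.g
  | _, _, .α₁ => S.α₁
  | _, _, .α₂ => S.α₂
  | _, _, .u => S.u

/-- The levels of the generators of `K` in the filtration that makes it semi-free. -/
def KGen.level : ∀ a b : Two, KGen a b → ℕ
  | _, _, .f => 0
  | _, _, .g => 0
  | _, _, .α₁ => 1
  | _, _, .α₂ => 1
  | _, _, .u => 2

section K
variable (k : Type w) [CommRing k]

-- Instance search does not unfold `(K k).Obj` and `(I₂ k).Obj` to `Two`.
instance K.addCommGroupHom (a b : Two) (n : ℤ) : AddCommGroup ((K k).Hom a b n) :=
  (K k).addCommGroup a b n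

instance K.moduleHom (a b : Two) (n : ℤ) : Module k ((K k).Hom a b n) :=
  (K k).module a b n

instance I₂.addCommGroupHom (a b : Two) (n : ℤ) : AddCommGroup ((I₂ k).Hom a b n) :=
  (I₂ k).addCommGroup a b n

instance I₂.moduleHom (a b : Two) (n : ℤ) : Module k ((I₂ k).Hom a b n) :=
  (I₂ k).module a b n

/-- A word in the generators as a morphism of `K`. -/
def K.word {a b : Two} (p : Word KGen a b) {n : ℤ} (hp : Word.deg KGen.deg p = n) :
    (K k).Hom a b n :=
  DG.word k KGen.deg p hp

theorem K.gen_comp_word {a b c : Two} (e : KGen b c) (p : Word KGen a b) {m n : ℤ}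
    (hp : Word.deg KGen.deg p = m) (h : KGen.deg b c e + m = n) :
    (K k).comp h (K.gen k e) (K.word k p hp) =
      K.word k (.cons e p) (by rw [← h, ← hp, Word.deg]) :=
  (word_cons e p hp _ _ h).symm

theorem K.d_gen {a b : Two} (e : KGen a b) : (K k).d rfl (K.gen k e) = KGen.d k a b e :=
  freeD_gen (KGen.d k) e _

/-- The homotopy equivalence formed by the generators of `K`. -/
def K.hoEquiv : HoEquiv (K k) x₁ x₂ where
  f := K.gen k .f
  g := K.gen k .g
  α₁ := K.gen k .α₁
  α₂ := K.gen k .α₂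
  u := K.gen k .u
  d_f := K.d_gen k .f
  d_g := K.d_gen k .g
  d_α₁ := (K.d_gen k .α₁).trans
    (congrArg (fun x : (K k).Hom _ _ _ => x - _)
      (K.gen_comp_word k .g (.cons .f .nil) rfl (add_zero 0)).symm)
  d_α₂ := (K.d_gen k .α₂).trans
    (congrArg (fun x : (K k).Hom _ _ _ => x - _)
      (K.gen_comp_word k .f (.cons .g .nil) rfl (add_zero 0)).symm)
  d_u := (K.d_gen k .u).trans
    (congrArg₂ (· - ·) (K.gen_comp_word k .f (.cons .α₁ .nil) rfl (zero_add (-1))).symm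
      (K.gen_comp_word k .α₂ (.cons .f .nil) rfl (add_zero (-1))).symm)

variable {k}

theorem HoEquiv.freeEval_ofGen {B : DGCat.{u, v, w} k} {X : Two → B.Obj}
    (S : HoEquiv B (X x₁) (X x₂)) (a b : Two) (e : KGen a b) :
    freeEval B.toGrCat S.ofGen _ (KGen.d k a b e) = B.d rfl (S.ofGen a b e) := by
  cases e with
  | f => exact (map_zero _).trans S.d_f.symm
  | g => exact (map_zero _).trans S.d_g.symm
  | α₁ =>
    refine ((map_sub _ _ _).trans (congrArg₂ _ (freeEval_word _ _ _ _)
      (freeEval_word _ _ _ _))).trans (Eq.trans ?_ S.d_α₁.symm)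
    exact congrArg (fun z => B.comp (add_zero 0) S.g z - B.id _) (B.comp_id (add_zero 0) S.f)
  | α₂ =>
    refine ((map_sub _ _ _).trans (congrArg₂ _ (freeEval_word _ _ _ _)
      (freeEval_word _ _ _ _))).trans (Eq.trans ?_ S.d_α₂.symm)
    exact congrArg (fun z => B.comp (add_zero 0) S.f z - B.id _) (B.comp_id (add_zero 0) S.g)
  | u =>
    refine ((map_sub _ _ _).trans (congrArg₂ _ (freeEval_word _ _ _ _)
      (freeEval_word _ _ _ _))).trans (Eq.trans ?_ S.d_u.symm)
    exact congrArg₂ (fun y z => B.comp (zero_add (-1)) S.f y - B.comp (add_zero (-1)) S.α₂ z)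
      (B.comp_id (add_zero (-1)) S.α₁) (B.comp_id (add_zero 0) S.f)

/-- The DG functor from `K` given by a homotopy equivalence. -/
def K.lift {B : DGCat.{u, v, w} k} {X : Two → B.Obj} (S : HoEquiv B (X x₁) (X x₂)) :
    DGFunctor (K k) B X :=
  DGFunctor.ofFree (KGen.d_d k) B S.ofGen S.freeEval_ofGen

theorem K.lift_f {B : DGCat.{u, v, w} k} {X : Two → B.Obj} (S : HoEquiv B (X x₁) (X x₂)) :
    (K.lift S).map 0 (K.gen k .f) = S.f :=
  freeEval_gen _ _ KGen.f _

theorem K.lift_g {B : DGCat.{u, v, w} k} {X : Two → B.Obj} (S : HoEquiv B (X x₁) (X x₂)) :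
    (K.lift S).map 0 (K.gen k .g) = S.g :=
  freeEval_gen _ _ KGen.g _

variable (k)

theorem K.evalWord {a b : Two} (p : Word KGen a b) {n : ℤ} (h : Word.deg KGen.deg p = n) :
    (K k).evalWord (E := KGen) KGen.deg (fun _ _ e => K.gen k e) p h = K.word k p h := by
  induction p generalizing n with
  | nil =>
    subst h
    rfl
  | cons e p ih =>
    exact (congrArg ((K k).comp h (K.gen k e)) (ih rfl)).trans (K.gen_comp_word k e p rfl h)

theorem bijective_linearCombination_of_eq_single {ι : Type v} {x : ι → ι →₀ k}
    (hx : ∀ i, x i = Finsupp.single i 1) : Function.Bijective (Finsupp.linearCombination k x) := by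
  have h : Finsupp.linearCombination k x = LinearMap.id := by
    ext i
    simp [hx]
  rw [h]
  exact Function.bijective_id

theorem K.isSemiFree : DGCat.IsSemiFree.{0, w, w, 0} (K k) := by
  refine ⟨KGen, KGen.deg, fun _ _ e => K.gen k e, KGen.level, fun X Y n => ?_, fun X Y e => ?_⟩
  · exact bijective_linearCombination_of_eq_single k fun p => K.evalWord k p.1 p.2
  · have word_mem (p : Word KGen X Y) (h : Word.deg KGen.deg p = KGen.deg X Y e + 1)
        (hp : p.LevelLT KGen.level (KGen.level X Y e)) : K.word k p h ∈ Submodule.span k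
          {x | ∃ (p : Word KGen X Y) (h : Word.deg KGen.deg p = KGen.deg X Y e + 1),
            p.LevelLT KGen.level (KGen.level X Y e) ∧
            (K k).evalWord (E := KGen) KGen.deg (fun _ _ e => K.gen k e) p h = x} :=
      Submodule.subset_span ⟨p, h, hp, K.evalWord k p h⟩
    refine Set.mem_of_eq_of_mem (K.d_gen k e) ?_
    cases e with
    | f => exact zero_mem _
    | g => exact zero_mem _
    | α₁ => exact sub_mem (word_mem _ _ (by simp [Word.LevelLT, KGen.level])) (word_mem _ _ trivial)
    | α₂ => exact sub_mem (word_mem _ _ (by simp [Word.LevelLT, KGen.level])) (word_mem _ _ trivial)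
    | u =>
      exact sub_mem (word_mem _ _ (by simp [Word.LevelLT, KGen.level]))
        (word_mem _ _ (by simp [Word.LevelLT, KGen.level]))

/-! ### The DG functor from `K` to `I₂` -/

theorem I₂.arrow_comp_arrow (a b c : (I₂ k).Obj) (h : (0 : ℤ) + 0 = 0) :
    (I₂ k).comp h (I₂.arrow k b c) (I₂.arrow k a b) = I₂.arrow k a c :=
  (linComp_single k J₂ (fun _ _ _ => 0) (fun _ _ _ _ _ => rfl) h _ _ 1 1).trans
    (by rw [mul_one]; rfl)

theorem I₂.arrow_comp_arrow_comp {a : (I₂ k).Obj} (b c : (I₂ k).Obj) {n : ℤ}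
    (x : (I₂ k).Hom a b n) :
    (I₂ k).comp (zero_add n) (I₂.arrow k c b) ((I₂ k).comp (zero_add n) (I₂.arrow k b c) x) =
      x := by
  rw [← (I₂ k).assoc (add_zero 0) (zero_add n) (zero_add n), I₂.arrow_comp_arrow]
  exact (I₂ k).id_comp _ x

theorem I₂.subsingleton_hom (a b : (I₂ k).Obj) {n : ℤ} (hn : n ≠ 0) :
    Subsingleton ((I₂ k).Hom a b n) := by
  have : IsEmpty {_f : Unit // (0 : ℤ) = n} := ⟨fun x => hn x.2.symm⟩
  exact inferInstanceAs (Subsingleton ({_f : Unit // (0 : ℤ) = n} →₀ k))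

theorem I₂.linearMap_ext {a b : (I₂ k).Obj} {n : ℤ} {M : Type*} [AddCommGroup M] [Module k M]
    {F G : (I₂ k).Hom a b n →ₗ[k] M}
    (h : ∀ hn : 0 = n, F ((I₂ k).castDeg hn (I₂.arrow k a b)) =
      G ((I₂ k).castDeg hn (I₂.arrow k a b))) : F = G := by
  refine Finsupp.lhom_ext' (α := {_f : Unit // (0 : ℤ) = n}) fun p => LinearMap.ext_ring ?_
  obtain ⟨⟨⟩, rfl⟩ := p
  exact h rfl

theorem I₂.subsingleton_ext (a b : (I₂ k).Obj) {n : ℤ} (hn : n ≠ 0) :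
    Subsingleton ((I₂ k).Ext a b n) := by
  have := I₂.subsingleton_hom k a b hn
  infer_instance

theorem I₂.coboundaries (a b : (I₂ k).Obj) (n : ℤ) : (I₂ k).coboundaries a b n = ⊥ :=
  LinearMap.range_zero

theorem I₂.isFreeGenerator_arrow (a b : (I₂ k).Obj) : IsFreeGenerator k (I₂.arrow k a b) := by
  let e : ({_f : Unit // (0 : ℤ) = 0} →₀ k) ≃ₗ[k] k := Finsupp.uniqueLinearEquiv k k ⟨(), rfl⟩
  have he : e (I₂.arrow k a b) = 1 := Finsupp.single_eq_same (α := {_f : Unit // (0 : ℤ) = 0})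
  refine (isFreeGenerator_map_iff (F := e.toLinearMap) e.bijective).1 ?_
  rw [LinearEquiv.coe_coe, he]
  simp only [IsFreeGenerator, smul_eq_mul, mul_one]
  exact Function.bijective_id

theorem I₂.isFreeGenerator_cls_arrow (a b : (I₂ k).Obj)
    (h : I₂.arrow k a b ∈ (I₂ k).cocycles a b 0) :
    IsFreeGenerator k ((I₂ k).cls ⟨I₂.arrow k a b, h⟩) := by
  have hsub : Function.Bijective ((I₂ k).cocycles a b 0).subtype :=
    ⟨Subtype.val_injective, fun x => ⟨⟨x, rfl⟩, rfl⟩⟩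
  have hmk : Function.Bijective (((I₂ k).coboundaries a b 0).submoduleOf
      ((I₂ k).cocycles a b 0)).mkQ := by
    refine ⟨LinearMap.ker_eq_bot.1 ?_, Submodule.mkQ_surjective _⟩
    rw [Submodule.ker_mkQ, I₂.coboundaries, Submodule.submoduleOf, Submodule.comap_bot,
      Submodule.ker_subtype]
  exact (isFreeGenerator_map_iff hmk).2 ((isFreeGenerator_map_iff hsub).1
    (I₂.isFreeGenerator_arrow k a b))

/-- The homotopy equivalence of `I₂` between its two isomorphic objects. -/
def I₂.hoEquiv : HoEquiv (I₂ k) x₁ x₂ :=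
  HoEquiv.ofIso (I₂.arrow k x₁ x₂) (I₂.arrow k x₂ x₁) rfl rfl
    (I₂.arrow_comp_arrow k x₁ x₂ x₁ _) (I₂.arrow_comp_arrow k x₂ x₁ x₂ _)

/-- The resolution `K → I₂`. -/
def K.toI₂ : DGFunctor (K k) (I₂ k) id := K.lift (B := I₂ k) (X := id) (I₂.hoEquiv k)

theorem K.toI₂_f : (K.toI₂ k).map 0 (K.gen k .f) = I₂.arrow k x₁ x₂ :=
  K.lift_f (B := I₂ k) (X := id) (I₂.hoEquiv k)

theorem K.toI₂_g : (K.toI₂ k).map 0 (K.gen k .g) = I₂.arrow k x₂ x₁ :=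
  K.lift_g (B := I₂ k) (X := id) (I₂.hoEquiv k)

end K

/-! ### Contractions on the morphisms into the target of a homotopy equivalence -/

namespace HoEquiv
variable {k : Type w} [CommRing k] {B : DGCat.{u, v, w} k} {X₁ X₂ : B.Obj} {S : HoEquiv B X₁ X₂}
  {W : B.Obj}

/-- A candidate `H` for a homotopy from an endomorphism `P` of the complex `Hom W X₂` to the
identity, described by its values on the composites with the morphisms of `S`. -/
structure Contraction (S : HoEquiv B X₁ X₂) (W : B.Obj) where
  P : ∀ n : ℤ, B.Hom W X₂ n →ₗ[k] B.Hom W X₂ n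
  H : ∀ {m n : ℤ}, n + 1 = m → (B.Hom W X₂ m →ₗ[k] B.Hom W X₂ n)
  P_f_g : ∀ {n : ℤ} (x : B.Hom W X₂ n),
    P n (B.comp (zero_add n) S.f (B.comp (zero_add n) S.g x)) = P n x
  P_f_α₁ : ∀ {m n : ℤ} (hα : -1 + m = n) (x : B.Hom W X₁ m),
    P n (B.comp (zero_add n) S.f (B.comp hα S.α₁ x)) = 0
  P_α₂ : ∀ {m n : ℤ} (hα : -1 + m = n) (x : B.Hom W X₂ m), P n (B.comp hα S.α₂ x) = 0
  P_u : ∀ {m n : ℤ} (hu : -2 + m = n) (x : B.Hom W X₁ m), P n (B.comp hu S.u x) = 0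
  H_f_g : ∀ {m n : ℤ} (h : n + 1 = m) (hα : -1 + m = n) (x : B.Hom W X₂ m),
    H h (B.comp (zero_add m) S.f (B.comp (zero_add m) S.g x)) = B.comp hα S.α₂ x + H h x
  H_f_α₁ : ∀ {l m n : ℤ} (h : n + 1 = m) (hα : -1 + l = m) (hu : -2 + l = n) (x : B.Hom W X₁ l),
    H h (B.comp (zero_add m) S.f (B.comp hα S.α₁ x)) = B.comp hu S.u x
  H_α₂ : ∀ {l m n : ℤ} (h : n + 1 = m) (hα : -1 + l = m) (x : B.Hom W X₂ l),
    H h (B.comp hα S.α₂ x) = 0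
  H_u : ∀ {l m n : ℤ} (h : n + 1 = m) (hu : -2 + l = m) (x : B.Hom W X₁ l),
    H h (B.comp hu S.u x) = 0

namespace Contraction
variable (T : S.Contraction W)

/-- The homotopy formula `1 - P = dH + Hd` holds at `x`. -/
def HomotopyAt {m : ℤ} (x : B.Hom W X₂ m) : Prop :=
  ∀ {l n : ℤ} (h : l + 1 = m) (h' : m + 1 = n), x - T.P m x = B.d h (T.H h x) + T.H h' (B.d h' x)

variable {T}

theorem HomotopyAt.f_comp_g_comp {m : ℤ} {x : B.Hom W X₂ m} (hx : T.HomotopyAt x) :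
    T.HomotopyAt (B.comp (zero_add m) S.f (B.comp (zero_add m) S.g x)) := by
  intro l n h h'
  have hα : -1 + m = l := by omega
  have hα' : -1 + n = m := by omega
  rw [T.P_f_g, S.d_f_comp, S.d_g_comp, T.H_f_g h hα, T.H_f_g h' hα', map_add,
    S.d_α₂_comp hα h h' hα', ← sub_add_sub_cancel _ x, hx h h']
  abel

variable (T)

theorem homotopyAt_f_comp_α₁_comp {l m : ℤ} (hα : -1 + l = m) (x : B.Hom W X₁ l) :
    T.HomotopyAt (B.comp (zero_add m) S.f (B.comp hα S.α₁ x)) := by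
  intro i n h h'
  obtain rfl : l = n := by omega
  have hu : -2 + l = i := by omega
  have hu' : -2 + (l + 1) = m := by omega
  have hα' : -1 + (l + 1) = l := by omega
  rw [T.P_f_α₁, sub_zero, S.d_f_comp h', S.d_α₁_comp hα h' rfl hα', map_sub, map_sub, map_sub,
    map_sub, T.H_f_g h' hα, T.H_f_α₁ h hα hu, T.H_f_α₁ h' hα' hu', S.d_u_comp hu h hα rfl hu']
  abel

theorem homotopyAt_α₂_comp {l m : ℤ} (hα : -1 + l = m) (x : B.Hom W X₂ l) :
    T.HomotopyAt (B.comp hα S.α₂ x) := by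
  intro i n h h'
  obtain rfl : l = n := by omega
  have hα' : -1 + (l + 1) = l := by omega
  rw [T.P_α₂, sub_zero, T.H_α₂, S.d_α₂_comp hα h' rfl hα', map_sub, map_sub, T.H_f_g h' hα,
    T.H_α₂, map_zero]
  abel

theorem homotopyAt_u_comp {l m : ℤ} (hu : -2 + l = m) (x : B.Hom W X₁ l) :
    T.HomotopyAt (B.comp hu S.u x) := by
  intro i n h h'
  have hα : -1 + l = n := by omega
  have hu' : -2 + (l + 1) = n := by omega
  rw [T.P_u, sub_zero, T.H_u, S.d_u_comp hu h' hα rfl hu', map_add, map_sub, T.H_f_α₁ h' hα hu,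
    T.H_α₂, T.H_u, map_zero]
  abel

/-- The candidate homotopy on the complex `Hom W X₁`, transported from `Hom W X₂`. -/
def source {m n : ℤ} (h : n + 1 = m) : B.Hom W X₁ m →ₗ[k] B.Hom W X₁ n :=
  B.comp (zero_add n) S.g ∘ₗ T.H h ∘ₗ B.comp (zero_add m) S.f - B.comp (by omega) S.α₁

theorem sub_eq_d_source_add_source_d (hT : ∀ {m : ℤ} (x : B.Hom W X₂ m), T.HomotopyAt x)
    {l m n : ℤ} (h : l + 1 = m) (h' : m + 1 = n) (x : B.Hom W X₁ m) :
    x - B.comp (zero_add m) S.g (T.P m (B.comp (zero_add m) S.f x)) =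
      B.d h (T.source h x) + T.source h' (B.d h' x) := by
  have hα : -1 + m = l := by omega
  have hα' : -1 + n = m := by omega
  have hg := congrArg (B.comp (zero_add m) S.g) (hT (B.comp (zero_add m) S.f x) h h')
  rw [map_sub, map_add, ← S.d_g_comp h, S.d_f_comp h', sub_eq_iff_eq_add'] at hg
  simp only [source, LinearMap.sub_apply, LinearMap.comp_apply, map_sub]
  rw [S.d_α₁_comp hα h h' hα', hg]
  abel

end Contraction

end HoEquiv

/-! ### The contraction of `K` onto `I₂` -/

section contraction
variable (k : Type w) [CommRing k] {a : Two}

/-- The contraction on words: it replaces a leading `fg` by `α₂`, continuing behind it, and a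
leading `fα₁` by `u`, and kills all the other words. Only words with target `x₂` matter. -/
def K.contrWord : ∀ {b : Two} (p : Word KGen a b) {m n : ℤ}, n + 1 = m →
    Word.deg KGen.deg p = m → (K k).Hom a b n
  | _, .cons .f (.cons .g p), _, _, h, hp =>
    K.word k (.cons .α₂ p) (by simp only [Word.deg, KGen.deg] at hp ⊢; omega) +
      K.contrWord p h (by simp only [Word.deg, KGen.deg] at hp; omega)
  | _, .cons .f (.cons .α₁ p), _, _, h, hp =>
    K.word k (.cons .u p) (by simp only [Word.deg, KGen.deg] at hp ⊢; omega)
  | _, _, _, _, _, _ => 0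

/-- The linear extension of the contraction on words. -/
def K.contr {b : Two} {m n : ℤ} (h : n + 1 = m) : (K k).Hom a b m →ₗ[k] (K k).Hom a b n :=
  Finsupp.linearCombination k fun p : {p : Word KGen a b // Word.deg KGen.deg p = m} =>
    K.contrWord k p.1 h p.2

variable {k} in
theorem K.linearMap_ext {a b : Two} {n : ℤ} {M : Type*} [AddCommGroup M] [Module k M]
    {F G : (K k).Hom a b n →ₗ[k] M}
    (h : ∀ (p : Word KGen a b) (hp : Word.deg KGen.deg p = n),
      F (K.word k p hp) = G (K.word k p hp)) : F = G :=
  FreeHom.linearMap_ext h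

theorem K.contr_word {b : Two} {m n : ℤ} (h : n + 1 = m) (p : Word KGen a b)
    (hp : Word.deg KGen.deg p = m) :
    K.contr k h (K.word k p hp) = K.contrWord k p h hp :=
  (Finsupp.linearCombination_single k _ _).trans (one_smul k _)

theorem K.f_comp_g_comp_word {n : ℤ} (p : Word KGen a x₂) (hp : Word.deg KGen.deg p = n) :
    (K k).comp (zero_add n) (K.hoEquiv k).f
      ((K k).comp (zero_add n) (K.hoEquiv k).g (K.word k p hp)) =
      K.word k (.cons .f (.cons .g p)) (by simpa only [Word.deg, KGen.deg, zero_add] using hp) :=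
  (congrArg ((K k).comp (zero_add n) (K.hoEquiv k).f)
    (K.gen_comp_word k .g p hp (zero_add n))).trans (K.gen_comp_word k .f _ _ (zero_add n))

theorem K.f_comp_α₁_comp_word {m n : ℤ} (p : Word KGen a x₁) (hp : Word.deg KGen.deg p = m)
    (hα : -1 + m = n) :
    (K k).comp (zero_add n) (K.hoEquiv k).f
      ((K k).comp hα (K.hoEquiv k).α₁ (K.word k p hp)) =
      K.word k (.cons .f (.cons .α₁ p)) (by simp only [Word.deg, KGen.deg]; omega) :=
  (congrArg ((K k).comp (zero_add n) (K.hoEquiv k).f)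
    (K.gen_comp_word k .α₁ p hp hα)).trans (K.gen_comp_word k .f _ _ (zero_add n))

theorem K.contr_f_comp_g_comp {m n : ℤ} (h : n + 1 = m) (hα : -1 + m = n)
    (x : (K k).Hom a x₂ m) :
    K.contr k h ((K k).comp (zero_add m) (K.hoEquiv k).f
      ((K k).comp (zero_add m) (K.hoEquiv k).g x)) =
      (K k).comp hα (K.hoEquiv k).α₂ x + K.contr k h x := by
  have key : K.contr k h ∘ₗ (K k).comp (zero_add m) (K.hoEquiv k).f ∘ₗ
      (K k).comp (X := a) (zero_add m) (K.hoEquiv k).g =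
      (K k).comp hα (K.hoEquiv k).α₂ + K.contr (a := a) k h := by
    refine K.linearMap_ext fun p hp => ?_
    refine (congrArg (K.contr k h) (K.f_comp_g_comp_word k p hp)).trans
      ((K.contr_word k h _ _).trans ?_)
    exact congrArg₂ _ (K.gen_comp_word k .α₂ p hp hα).symm (K.contr_word k h p hp).symm
  exact LinearMap.congr_fun key x

theorem K.contr_f_comp_α₁_comp {l m n : ℤ} (h : n + 1 = m) (hα : -1 + l = m) (hu : -2 + l = n)
    (x : (K k).Hom a x₁ l) :
    K.contr k h ((K k).comp (zero_add m) (K.hoEquiv k).f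
      ((K k).comp hα (K.hoEquiv k).α₁ x)) = (K k).comp hu (K.hoEquiv k).u x := by
  have key : K.contr k h ∘ₗ (K k).comp (zero_add m) (K.hoEquiv k).f ∘ₗ
      (K k).comp (X := a) hα (K.hoEquiv k).α₁ = (K k).comp hu (K.hoEquiv k).u := by
    refine K.linearMap_ext fun p hp => ?_
    refine (congrArg (K.contr k h) (K.f_comp_α₁_comp_word k p hp hα)).trans
      ((K.contr_word k h _ _).trans ?_)
    exact (K.gen_comp_word k .u p hp hu).symm
  exact LinearMap.congr_fun key x

theorem K.contr_α₂_comp {l m n : ℤ} (h : n + 1 = m) (hα : -1 + l = m) (x : (K k).Hom a x₂ l) :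
    K.contr k h ((K k).comp hα (K.hoEquiv k).α₂ x) = 0 := by
  have key : K.contr k h ∘ₗ (K k).comp (X := a) hα (K.hoEquiv k).α₂ = 0 :=
    K.linearMap_ext fun p hp => (congrArg (K.contr k h) (K.gen_comp_word k .α₂ p hp hα)).trans
      (K.contr_word k h _ _)
  exact LinearMap.congr_fun key x

theorem K.contr_u_comp {l m n : ℤ} (h : n + 1 = m) (hu : -2 + l = m) (x : (K k).Hom a x₁ l) :
    K.contr k h ((K k).comp hu (K.hoEquiv k).u x) = 0 := by
  have key : K.contr k h ∘ₗ (K k).comp (X := a) hu (K.hoEquiv k).u = 0 :=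
    K.linearMap_ext fun p hp => (congrArg (K.contr k h) (K.gen_comp_word k .u p hp hu)).trans
      (K.contr_word k h _ _)
  exact LinearMap.congr_fun key x

/-- A lift to `K` of the morphism `a → b` of `J₂`. The two choices `gf` and `id` for the identities
make the lifts compatible with composition with `g`. -/
def K.arrow : ∀ a b : Two, (K k).Hom a b 0
  | x₁, x₁ => (K k).comp (add_zero 0) (K.hoEquiv k).g (K.hoEquiv k).f
  | x₁, x₂ => (K.hoEquiv k).f
  | x₂, x₁ => (K.hoEquiv k).g
  | x₂, x₂ => (K k).id x₂

theorem K.g_comp_arrow (a : Two) :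
    (K k).comp (add_zero 0) (K.hoEquiv k).g (K.arrow k a x₂) = K.arrow k a x₁ := by
  cases a with
  | x₁ => rfl
  | x₂ => exact (K k).comp_id _ _

theorem K.d_arrow (a b : Two) : (K k).d (zero_add 1) (K.arrow k a b) = 0 := by
  have d_arrow_x₂ (a : Two) : (K k).d (zero_add 1) (K.arrow k a x₂) = 0 := by
    cases a with
    | x₁ => exact (K.hoEquiv k).d_f
    | x₂ => exact (K k).d_id x₂ (zero_add 1)
  cases b with
  | x₁ =>
    rw [← K.g_comp_arrow]
    exact ((K.hoEquiv k).d_g_comp (zero_add 1) _).trans (by rw [d_arrow_x₂, map_zero])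
  | x₂ => exact d_arrow_x₂ a

/-- The action of `K → I₂` on morphisms. -/
def K.mapI₂ {a b : Two} (n : ℤ) : (K k).Hom a b n →ₗ[k] (I₂ k).Hom a b n := (K.toI₂ k).map n

theorem K.mapI₂_comp {a b c : Two} {p q n : ℤ} (h : p + q = n) (z : (K k).Hom b c p)
    (y : (K k).Hom a b q) :
    K.mapI₂ k n ((K k).comp h z y) = (I₂ k).comp h (K.mapI₂ k p z) (K.mapI₂ k q y) :=
  (K.toI₂ k).map_comp h z y

theorem K.mapI₂_arrow (a b : Two) : K.mapI₂ k 0 (K.arrow k a b) = I₂.arrow k a b := by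
  have mapI₂_arrow_x₂ (a : Two) : K.mapI₂ k 0 (K.arrow k a x₂) = I₂.arrow k a x₂ := by
    cases a with
    | x₁ => exact K.toI₂_f k
    | x₂ => exact (K.toI₂ k).map_id x₂
  cases b with
  | x₁ =>
    rw [← K.g_comp_arrow, K.mapI₂_comp, mapI₂_arrow_x₂]
    exact (congrArg ((I₂ k).comp _ · _) (K.toI₂_g k)).trans (I₂.arrow_comp_arrow k a x₂ x₁ _)
  | x₂ => exact mapI₂_arrow_x₂ a

/-- The section of `K → I₂` given by the lifts of the morphisms of `J₂`. -/
def K.ofI₂ (a b : Two) (n : ℤ) : (I₂ k).Hom a b n →ₗ[k] (K k).Hom a b n :=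
  Finsupp.linearCombination k fun h : {_f : Unit // (0 : ℤ) = n} =>
    (K k).castDeg h.2 (K.arrow k a b)

theorem K.ofI₂_arrow (a b : Two) : K.ofI₂ k a b 0 (I₂.arrow k a b) = K.arrow k a b :=
  (Finsupp.linearCombination_single k _ _).trans (one_smul k _)

theorem K.d_ofI₂ {b : Two} {m n : ℤ} (h : m + 1 = n) (y : (I₂ k).Hom a b m) :
    (K k).d h (K.ofI₂ k a b m y) = 0 := by
  refine LinearMap.congr_fun (I₂.linearMap_ext k (F := (K k).d h ∘ₗ K.ofI₂ k a b m) (G := 0)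
    fun hm => ?_) y
  subst hm h
  exact (congrArg ((K k).d _) (K.ofI₂_arrow k a b)).trans (K.d_arrow k a b)

theorem K.mapI₂_ofI₂ {b : Two} (n : ℤ) (y : (I₂ k).Hom a b n) :
    K.mapI₂ k n (K.ofI₂ k a b n y) = y := by
  refine LinearMap.congr_fun (I₂.linearMap_ext k (F := K.mapI₂ k n ∘ₗ K.ofI₂ k a b n)
    (G := LinearMap.id) fun hn => ?_) y
  subst hn
  exact (congrArg (K.mapI₂ k 0) (K.ofI₂_arrow k a b)).trans (K.mapI₂_arrow k a b)

theorem K.g_comp_ofI₂ {n : ℤ} (y : (I₂ k).Hom a x₂ n) :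
    (K k).comp (zero_add n) (K.hoEquiv k).g (K.ofI₂ k a x₂ n y) =
      K.ofI₂ k a x₁ n ((I₂ k).comp (zero_add n) (I₂.arrow k x₂ x₁) y) := by
  refine LinearMap.congr_fun (I₂.linearMap_ext k
    (F := (K k).comp (zero_add n) (K.hoEquiv k).g ∘ₗ K.ofI₂ k a x₂ n)
    (G := K.ofI₂ k a x₁ n ∘ₗ (I₂ k).comp (zero_add n) (I₂.arrow k x₂ x₁)) fun hn => ?_) y
  subst hn
  refine (congrArg ((K k).comp _ _) (K.ofI₂_arrow k a x₂)).trans ((K.g_comp_arrow k a).trans ?_)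
  exact ((congrArg _ (I₂.arrow_comp_arrow k a x₂ x₁ _)).trans (K.ofI₂_arrow k a x₁)).symm

theorem K.mapI₂_comp_eq_zero {b c : Two} {p q n : ℤ} (hp : p ≠ 0) (h : p + q = n)
    (z : (K k).Hom b c p) (y : (K k).Hom a b q) : K.mapI₂ k n ((K k).comp h z y) = 0 := by
  have hz : K.mapI₂ k p z = 0 := (I₂.subsingleton_hom k b c hp).elim _ _
  rw [K.mapI₂_comp, hz, map_zero, LinearMap.zero_apply]

theorem K.mapI₂_f_comp {n : ℤ} (y : (K k).Hom a x₁ n) :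
    K.mapI₂ k n ((K k).comp (zero_add n) (K.hoEquiv k).f y) =
      (I₂ k).comp (zero_add n) (I₂.arrow k x₁ x₂) (K.mapI₂ k n y) :=
  (K.mapI₂_comp k (zero_add n) _ y).trans (congrArg ((I₂ k).comp (zero_add n) · _) (K.toI₂_f k))

theorem K.mapI₂_g_comp {n : ℤ} (y : (K k).Hom a x₂ n) :
    K.mapI₂ k n ((K k).comp (zero_add n) (K.hoEquiv k).g y) =
      (I₂ k).comp (zero_add n) (I₂.arrow k x₂ x₁) (K.mapI₂ k n y) :=
  (K.mapI₂_comp k (zero_add n) _ y).trans (congrArg ((I₂ k).comp (zero_add n) · _) (K.toI₂_g k))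

theorem K.mapI₂_f_comp_eq_zero {n : ℤ} {y : (K k).Hom a x₁ n} (hy : K.mapI₂ k n y = 0) :
    K.mapI₂ k n ((K k).comp (zero_add n) (K.hoEquiv k).f y) = 0 := by
  rw [K.mapI₂_f_comp, hy, map_zero]

theorem K.mapI₂_f_comp_g_comp {n : ℤ} (y : (K k).Hom a x₂ n) :
    K.mapI₂ k n ((K k).comp (zero_add n) (K.hoEquiv k).f
      ((K k).comp (zero_add n) (K.hoEquiv k).g y)) = K.mapI₂ k n y :=
  ((K.mapI₂_f_comp k _).trans (congrArg _ (K.mapI₂_g_comp k y))).trans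
    (I₂.arrow_comp_arrow_comp k (a := a) x₁ x₂ _)

theorem K.g_comp_ofI₂_mapI₂_f_comp {n : ℤ} (y : (K k).Hom a x₁ n) :
    (K k).comp (zero_add n) (K.hoEquiv k).g
      (K.ofI₂ k a x₂ n (K.mapI₂ k n ((K k).comp (zero_add n) (K.hoEquiv k).f y))) =
      K.ofI₂ k a x₁ n (K.mapI₂ k n y) :=
  (K.g_comp_ofI₂ k _).trans (congrArg (K.ofI₂ k a x₁ n)
    ((congrArg _ (K.mapI₂_f_comp k y)).trans (I₂.arrow_comp_arrow_comp k (a := a) x₂ x₁ _)))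

/-- The contraction of `K` onto `I₂` on the morphisms from `a` to `x₂`. -/
def K.contraction (a : Two) : (K.hoEquiv k).Contraction a where
  P n := K.ofI₂ k a x₂ n ∘ₗ K.mapI₂ k n
  H := K.contr k
  P_f_g x := congrArg (K.ofI₂ k a x₂ _) (K.mapI₂_f_comp_g_comp k x)
  P_f_α₁ hα x := (congrArg (K.ofI₂ k a x₂ _) (K.mapI₂_f_comp_eq_zero k
    (K.mapI₂_comp_eq_zero k (by decide) hα _ x))).trans (map_zero _)
  P_α₂ hα x :=
    (congrArg (K.ofI₂ k a x₂ _) (K.mapI₂_comp_eq_zero k (by decide) hα _ x)).trans (map_zero _)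
  P_u hu x :=
    (congrArg (K.ofI₂ k a x₂ _) (K.mapI₂_comp_eq_zero k (by decide) hu _ x)).trans (map_zero _)
  H_f_g := K.contr_f_comp_g_comp k
  H_f_α₁ := K.contr_f_comp_α₁_comp k
  H_α₂ := K.contr_α₂_comp k
  H_u := K.contr_u_comp k

theorem K.homotopyAt_arrow (a : Two)
    (ha : ∀ {n : ℤ} (h : n + 1 = 0), K.contr k h (K.arrow k a x₂) = 0) :
    (K.contraction k a).HomotopyAt (K.arrow k a x₂) := by
  intro l n h h'
  subst h'
  have hP : (K.contraction k a).P 0 (K.arrow k a x₂) = K.arrow k a x₂ :=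
    (congrArg (K.ofI₂ k a x₂ 0) (K.mapI₂_arrow k a x₂)).trans (K.ofI₂_arrow k a x₂)
  have hH : (K.contraction k a).H h (K.arrow k a x₂) = 0 := ha h
  have hd : (K k).d (zero_add 1) (K.arrow k a x₂) = 0 := K.d_arrow k a x₂
  rw [hP, hH, hd, sub_self, map_zero, map_zero, zero_add]

theorem K.homotopyAt_word : ∀ {a : Two} (p : Word KGen a x₂) {m : ℤ}
    (hp : Word.deg KGen.deg p = m), (K.contraction k a).HomotopyAt (K.word k p hp)
  | _, .nil, _, rfl => K.homotopyAt_arrow k x₂ fun h => K.contr_word k h .nil rfl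
  | _, .cons .f .nil, _, rfl =>
    K.homotopyAt_arrow k x₁ fun h => K.contr_word k h (.cons .f .nil) rfl
  | _, .cons .f (.cons .g p), m, hp => by
    have hp' : Word.deg KGen.deg p = m := by simpa only [Word.deg, KGen.deg, zero_add] using hp
    rw [← K.f_comp_g_comp_word k p hp']
    exact HoEquiv.Contraction.HomotopyAt.f_comp_g_comp (K.homotopyAt_word p hp')
  | _, .cons .f (.cons .α₁ p), m, hp => by
    have hα : -1 + Word.deg KGen.deg p = m := by
      simpa only [Word.deg, KGen.deg, zero_add] using hp
    rw [← K.f_comp_α₁_comp_word k p rfl hα]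
    exact (K.contraction k _).homotopyAt_f_comp_α₁_comp hα _
  | _, .cons .α₂ p, _, hp => by
    rw [← K.gen_comp_word k .α₂ p rfl hp]
    exact (K.contraction k _).homotopyAt_α₂_comp hp _
  | _, .cons .u p, _, hp => by
    rw [← K.gen_comp_word k .u p rfl hp]
    exact (K.contraction k _).homotopyAt_u_comp hp _

theorem K.homotopyAt {m : ℤ} (x : (K k).Hom a x₂ m) : (K.contraction k a).HomotopyAt x := by
  intro l n h h'
  exact LinearMap.congr_fun (K.linearMap_ext (F := LinearMap.id - (K.contraction k a).P m)
    (G := (K k).d h ∘ₗ K.contr k h + K.contr k h' ∘ₗ (K k).d h')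
    fun p hp => K.homotopyAt_word k p hp h h') x

variable (a)

/-- The homotopy from `K → I₂ → K` to the identity on the morphisms with target `b`. -/
def K.homotopy : ∀ (b : Two) {m n : ℤ}, n + 1 = m → ((K k).Hom a b m →ₗ[k] (K k).Hom a b n)
  | x₁, _, _, h => (K.contraction k a).source h
  | x₂, _, _, h => (K.contraction k a).H h

theorem K.sub_ofI₂_mapI₂ (b : Two) {l m n : ℤ} (h : l + 1 = m) (h' : m + 1 = n)
    (x : (K k).Hom a b m) :
    x - K.ofI₂ k a b m (K.mapI₂ k m x) =
      (K k).d h (K.homotopy k a b h x) + K.homotopy k a b h' ((K k).d h' x) := by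
  cases b with
  | x₂ => exact K.homotopyAt k x h h'
  | x₁ =>
    exact (congrArg (x - ·) (K.g_comp_ofI₂_mapI₂_f_comp k x).symm).trans
      ((K.contraction k a).sub_eq_d_source_add_source_d (K.homotopyAt k) h h' x)

/-! ### The cohomology of `K` -/

theorem K.mapExt_toI₂_bijective (b : Two) (n : ℤ) :
    Function.Bijective ((K.toI₂ k).mapExt a b n) :=
  (K.toI₂ k).mapExt_bijective_of_homotopy (K.ofI₂ k a b) (K.homotopy k a b)
    (fun h y => (K.d_ofI₂ k h y).trans (map_zero (K.ofI₂ k a b _)).symm)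
    (K.mapI₂_ofI₂ k) (K.sub_ofI₂_mapI₂ k a b) n

theorem K.isResolution : DGFunctor.IsResolution.{0, w, w, 0, w, 0} (K.toI₂ k) where
  semiFree := K.isSemiFree k
  bijective_obj := Function.bijective_id
  quasiEquivalence :=
    { fullyFaithful := K.mapExt_toI₂_bijective k
      essSurj := fun Z => ⟨Z, _, _, (I₂ k).isHoInverse_id Z⟩ }

theorem K.subsingleton_ext (b : Two) {n : ℤ} (hn : n ≠ 0) : Subsingleton ((K k).Ext a b n) :=
  ⟨fun _ _ => (K.mapExt_toI₂_bijective k a b n).injective ((I₂.subsingleton_ext k a b hn).elim _ _)⟩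

variable {a}

theorem K.isFreeGenerator_cls {b : Two} (z : (K k).cocycles a b 0)
    (hz : (K.toI₂ k).map 0 z.1 = I₂.arrow k a b) : IsFreeGenerator k ((K k).cls z) := by
  refine (isFreeGenerator_map_iff (K.mapExt_toI₂_bijective k a b 0)).1 ?_
  have hF : (K.toI₂ k).mapCocycles a b 0 z = ⟨I₂.arrow k a b, rfl⟩ := Subtype.ext hz
  exact (congrArg (IsFreeGenerator k) (((K.toI₂ k).mapExt_cls z).trans
    (congrArg (I₂ k).cls hF))).mpr (I₂.isFreeGenerator_cls_arrow k a b rfl)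

end contraction

/-! ### The components of a twisted complex -/

section components
variable {k : Type w} [CommRing k] {A : DGCat.{u, v, w} k}

/-- The inclusion of a component of a twisted complex. -/
def Tw.inj (T : Tw A) (j : Fin T.n) {l : ℤ} (h : l + T.r j = 0) : TwHom (Tw.of (T.C j)) T l :=
  fun i _ => A.castDeg (by simp only [Tw.of]; omega) (twId T i j)

/-- The projection to a component of a twisted complex. -/
def Tw.proj (T : Tw A) (i : Fin T.n) {l : ℤ} (h : l = T.r i) : TwHom T (Tw.of (T.C i)) l :=
  fun _ j => A.castDeg (by simp only [Tw.of]; omega) (twId T i j)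

theorem twComp_twId {T T' : Tw A} {l : ℤ} (f : TwHom T T' l) : twComp (add_zero l) f (twId T) = f :=
  (GrCat.pretr A).comp_id (add_zero l) f

theorem twId_twComp {T T' : Tw A} {l : ℤ} (f : TwHom T T' l) :
    twComp (zero_add l) (twId T') f = f :=
  (GrCat.pretr A).id_comp (zero_add l) f

theorem twComp_inj {T T' : Tw A} {l m n : ℤ} (f : TwHom T T' l) (j : Fin T.n)
    (hm : m + T.r j = 0) (h : l + m = n) (i x) :
    twComp h f (T.inj j hm) i x = A.castDeg (by simp only [Tw.of]; omega) (f i j) := by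
  conv_rhs => rw [← twComp_twId f]
  rw [twComp_apply, twComp_apply, map_sum]
  refine Finset.sum_congr rfl fun y _ => ?_
  rw [GrCat.castDeg_comp]
  exact A.comp_castDeg_right _ _ _ _

theorem proj_twComp {T T' : Tw A} {l m n : ℤ} (f : TwHom T T' l) (i : Fin T'.n)
    (hm : m = T'.r i) (h : m + l = n) (x j) :
    twComp h (T'.proj i hm) f x j = A.castDeg (by simp only [Tw.of]; omega) (f i j) := by
  conv_rhs => rw [← twId_twComp f]
  rw [twComp_apply, twComp_apply, map_sum]
  refine Finset.sum_congr rfl fun y _ => ?_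
  rw [GrCat.castDeg_comp]
  exact A.comp_castDeg_left _ _ _ _

theorem proj_twComp_inj {T T' : Tw A} {l m m' l' n : ℤ} (f : TwHom T T' l) (i : Fin T'.n)
    (j : Fin T.n) (hm : m = T'.r i) (hm' : m' + T.r j = 0) (hl' : m + l = l') (h : l' + m' = n)
    (x y) :
    twComp h (twComp hl' (T'.proj i hm) f) (T.inj j hm') x y =
      A.castDeg (by simp only [Tw.of]; omega) (f i j) := by
  rw [twComp_inj, proj_twComp]
  exact GrCat.castDeg_castDeg _ _ _ _

theorem sum_inj_proj (T : Tw A) {s : Fin T.n → ℤ} (hs : ∀ x, s x + T.r x = 0) :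
    ∑ x, twComp (hs x) (T.inj x (hs x)) (T.proj x rfl) = twId T := by
  conv_rhs => rw [← twComp_twId (twId T)]
  ext i j
  rw [Finset.sum_apply, Finset.sum_apply, twComp_apply]
  refine Finset.sum_congr rfl fun x _ => ?_
  refine (Fin.sum_univ_one fun z : Fin 1 =>
    A.comp _ (T.inj x (hs x) i z) (T.proj x rfl z j)).trans ?_
  exact (A.comp_castDeg_left _ _ _ _).trans (A.comp_castDeg_right _ _ _ _)

end components

/-! ### Components of a cone -/

section coneData
variable {k : Type w} [CommRing k]

/-- The data exhibiting `C` as the cone of a closed morphism `f : X₁ → X₂` of degree `0`: a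
decomposition `C = X₂ ⊕ X₁[1]` as a graded object, with the differentials of the components. -/
structure ConeData (B : DGCat.{u, v, w} k) {X₁ X₂ : B.Obj} (f : B.Hom X₁ X₂ 0) (C : B.Obj) where
  d_f : B.d (zero_add 1) f = 0
  i₁ : B.Hom X₁ C (-1)
  i₂ : B.Hom X₂ C 0
  p₁ : B.Hom C X₁ 1
  p₂ : B.Hom C X₂ 0
  d_i₁ : B.d (neg_add_cancel 1) i₁ = B.comp (add_zero 0) i₂ f
  d_i₂ : B.d (zero_add 1) i₂ = 0
  d_p₁ : B.d (one_add_one_eq_two) p₁ = 0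
  d_p₂ : B.d (zero_add 1) p₂ = -B.comp (zero_add 1) f p₁
  p₁_i₁ : B.comp (add_neg_cancel 1) p₁ i₁ = B.id X₁
  p₁_i₂ : B.comp (add_zero 1) p₁ i₂ = 0
  p₂_i₁ : B.comp (zero_add (-1)) p₂ i₁ = 0
  p₂_i₂ : B.comp (add_zero 0) p₂ i₂ = B.id X₂

/-- The image of cone data under a DG functor. -/
def ConeData.map {A : DGCat.{u, v, w} k} {B : DGCat.{u', v', w} k} {φ : A.Obj → B.Obj}
    {X₁ X₂ C : A.Obj} {f : A.Hom X₁ X₂ 0} (D : ConeData A f C) (F : DGFunctor A B φ) :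
    ConeData B (F.map 0 f) (φ C) where
  d_f := by rw [← F.map_d, D.d_f, map_zero]
  i₁ := F.map _ D.i₁
  i₂ := F.map _ D.i₂
  p₁ := F.map _ D.p₁
  p₂ := F.map _ D.p₂
  d_i₁ := by rw [← F.map_d, D.d_i₁, F.map_comp]
  d_i₂ := by rw [← F.map_d, D.d_i₂, map_zero]
  d_p₁ := by rw [← F.map_d, D.d_p₁, map_zero]
  d_p₂ := by rw [← F.map_d, D.d_p₂, map_neg, F.map_comp]
  p₁_i₁ := by rw [← F.map_comp, D.p₁_i₁, F.map_id]
  p₁_i₂ := by rw [← F.map_comp, D.p₁_i₂, map_zero]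
  p₂_i₁ := by rw [← F.map_comp, D.p₂_i₁, map_zero]
  p₂_i₂ := by rw [← F.map_comp, D.p₂_i₂, F.map_id]

section
variable {B : DGCat.{u, v, w} k} {X₁ X₂ C : B.Obj} {f : B.Hom X₁ X₂ 0} (D : ConeData B f C)
  (ε : B.Hom C C (-1))

theorem ConeData.d_p₁_comp (hε : B.d (neg_add_cancel 1) ε = B.id C) :
    B.d (zero_add 1) (B.comp (add_neg_cancel 1) D.p₁ ε) = -D.p₁ := by
  rw [B.leibniz (n' := 1) _ _ one_add_one_eq_two (neg_add_cancel 1) (by norm_num) (add_zero 1),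
    D.d_p₁, hε, B.comp_id, map_zero, LinearMap.zero_apply, zero_add,
    (by simpa using sgn_succ k 0 : sgn k 1 = -1), neg_one_smul]

theorem ConeData.d_p₂_comp (hε : B.d (neg_add_cancel 1) ε = B.id C) :
    B.d (neg_add_cancel 1) (B.comp (zero_add (-1)) D.p₂ ε) =
      D.p₂ - B.comp (add_zero 0) f (B.comp (add_neg_cancel 1) D.p₁ ε) := by
  rw [B.leibniz (n' := 0) _ _ (zero_add 1) (neg_add_cancel 1) (by norm_num) (add_zero 0),
    D.d_p₂, hε, B.comp_id, map_neg, LinearMap.neg_apply, sgn_zero, one_smul,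
    B.assoc (hqr := add_neg_cancel 1) (ht := add_zero 0)]
  abel

/-- The homotopy equivalence formed by `f` and the components of a contraction `ε` of the cone
of `f`: the matrix of `ε` on `X₂ ⊕ X₁[1]` has the rows `-α₂, -u` and `g, α₁`. -/
def ConeData.hoEquiv (hε : B.d (neg_add_cancel 1) ε = B.id C) : HoEquiv B X₁ X₂ where
  f := f
  g := B.comp (add_zero 0) (B.comp (add_neg_cancel 1) D.p₁ ε) D.i₂
  α₁ := B.comp (zero_add (-1)) (B.comp (add_neg_cancel 1) D.p₁ ε) D.i₁
  α₂ := -B.comp (add_zero (-1)) (B.comp (zero_add (-1)) D.p₂ ε) D.i₂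
  u := -B.comp (by norm_num) (B.comp (zero_add (-1)) D.p₂ ε) D.i₁
  d_f := D.d_f
  d_g := by
    rw [B.leibniz (n' := 1) _ _ (zero_add 1) (zero_add 1) (by norm_num) (zero_add 1),
      D.d_p₁_comp ε hε, D.d_i₂, map_zero, smul_zero, add_zero, map_neg, LinearMap.neg_apply,
      D.p₁_i₂, neg_zero]
  d_α₁ := by
    rw [B.leibniz (n' := 0) _ _ (zero_add 1) (neg_add_cancel 1) (by norm_num) (add_zero 0),
      D.d_p₁_comp ε hε, D.d_i₁, map_neg, LinearMap.neg_apply, D.p₁_i₁, sgn_zero, one_smul,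
      B.assoc (hqr := add_zero 0) (ht := add_zero 0)]
    abel
  d_α₂ := by
    rw [map_neg, B.leibniz (n' := 0) _ _ (neg_add_cancel 1) (zero_add 1) (add_zero 0)
        (by norm_num), D.d_p₂_comp ε hε, D.d_i₂, map_zero, smul_zero, add_zero, map_sub,
      LinearMap.sub_apply, D.p₂_i₂, B.assoc (hqr := add_zero 0) (ht := add_zero 0)]
    abel
  d_u := by
    rw [map_neg, B.leibniz (n' := -1) _ _ (neg_add_cancel 1) (neg_add_cancel 1)
        (zero_add (-1)) (add_zero (-1)), D.d_p₂_comp ε hε, D.d_i₁, map_sub,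
      LinearMap.sub_apply, D.p₂_i₁, B.assoc (hqr := zero_add (-1)) (ht := zero_add (-1)),
      map_neg, LinearMap.neg_apply, B.assoc (hqr := add_zero 0) (ht := add_zero (-1)),
      sgn_neg_one, neg_one_smul]
    abel

end

end coneData

/-! ### The cone in the DG category of twisted complexes -/

section twCone
variable {k : Type w} [CommRing k] {A : DGCat.{u, v, w} k}

variable (A) in
theorem castDeg_d {X Y : A.Obj} {l m n : ℤ} (h : l + 1 = m) (e : m = n) (f : A.Hom X Y l) :
    A.castDeg e (A.d h f) = A.d (h.trans e) f := by
  subst e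
  rfl

theorem d_castDeg_twId (T : Tw A) (i j : Fin T.n) {m n : ℤ} (h : 0 + T.r i - T.r j = m)
    (h' : m + 1 = n) : A.d h' (A.castDeg h (twId T i j)) = 0 := by
  by_cases hij : i = j
  · subst hij
    rw [twId_self, GrCat.castDeg_castDeg, d_castDeg, A.d_id]
  · rw [twId_ne T hij, map_zero, map_zero]

theorem twD_inj (T : Tw A) (j : Fin T.n) {l m : ℤ} (hl : l + T.r j = 0) (h : l + 1 = m) (x y) :
    twD h (T.inj j hl) x y = A.castDeg (by simp only [Tw.of]; omega) (T.q x j) := by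
  have h₁ : twNaive h (T.inj j hl) = 0 := by
    funext x y
    refine (twNaive_apply h _ x y).trans (Eq.trans ?_ (smul_zero (sgn k (T.r x))))
    exact congrArg _ (d_castDeg_twId T x j _ _)
  have h₂ : twComp h (T.inj j hl) (Tw.of (T.C j)).q = 0 := by
    funext x y
    exact (twComp_apply _ _ _ _ _).trans (Finset.sum_eq_zero fun z _ => map_zero _)
  rw [twD_apply, h₁, h₂, smul_zero, sub_zero, zero_add]
  exact twComp_inj _ _ _ _ _ _

theorem twD_proj (T : Tw A) (i : Fin T.n) {l m : ℤ} (hl : l = T.r i) (h : l + 1 = m) (x y) :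
    twD h (T.proj i hl) x y =
      -(sgn k l • A.castDeg (by simp only [Tw.of]; omega) (T.q i y)) := by
  have h₁ : twNaive h (T.proj i hl) = 0 := by
    funext x y
    refine (twNaive_apply h _ x y).trans (Eq.trans ?_ (smul_zero (sgn k 0)))
    exact congrArg _ (d_castDeg_twId T i y _ _)
  have h₂ : twComp (by rw [← h, add_comm] : 1 + l = m) (Tw.of (T.C i)).q (T.proj i hl) = 0 := by
    funext x y
    exact (twComp_apply _ _ _ _ _).trans (Finset.sum_eq_zero fun z _ =>
      LinearMap.congr_fun (map_zero (A.comp _)) (T.proj i hl z y))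
  rw [twD_apply, h₁, h₂, zero_add, zero_sub]
  exact congrArg (fun z => -(sgn k l • z)) (proj_twComp T.q i hl h x y)

theorem twD_proj_eq_zero (T : Tw A) (i : Fin T.n) {l m : ℤ} (hl : l = T.r i) (h : l + 1 = m)
    (hq : ∀ y, T.q i y = 0) : twD h (T.proj i hl) = 0 := by
  funext x y
  rw [twD_proj, hq, map_zero, smul_zero, neg_zero]
  rfl

theorem inj_twComp_ofHom (T : Tw A) (j : Fin T.n) {Z : A.Obj} {l m n : ℤ} (f : A.Hom Z (T.C j) m)
    (hl : l + T.r j = 0) (h : l + m = n) (x y) :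
    twComp h (T.inj j hl) (Tw.ofHom f) x y =
      A.comp (by simp only [Tw.of]; omega) (twId T x j) f := by
  refine (Fin.sum_univ_one fun z : Fin 1 =>
    A.comp _ (T.inj j hl x z) (Tw.ofHom f z y)).trans ?_
  exact (A.comp_castDeg_left _ _ _ _).trans (A.comp_castDeg_right _ _ _ _)

theorem ofHom_twComp_proj (T : Tw A) (i : Fin T.n) {Z : A.Obj} {l m n : ℤ}
    (f : A.Hom (T.C i) Z m) (hl : l = T.r i) (h : m + l = n) (x y) :
    twComp h (Tw.ofHom f) (T.proj i hl) x y =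
      A.comp (by simp only [Tw.of]; omega) f (twId T i y) := by
  refine (Fin.sum_univ_one fun z : Fin 1 =>
    A.comp _ (Tw.ofHom f x z) (T.proj i hl z y)).trans ?_
  exact (A.comp_castDeg_left _ _ _ _).trans (A.comp_castDeg_right _ _ _ _)

theorem proj_twComp_inj_self (T : Tw A) (i : Fin T.n) {l m : ℤ} (hl : l = T.r i)
    (hm : m + T.r i = 0) (h : l + m = 0) :
    twComp h (T.proj i hl) (T.inj i hm) = twId (Tw.of (T.C i)) := by
  ext x y
  refine (proj_twComp _ _ _ _ _ _).trans ?_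
  obtain rfl : x = y := Subsingleton.elim (α := Fin 1) x y
  refine ((GrCat.castDeg_castDeg _ _ _ _).trans ?_).trans (twId_self _ _).symm
  rw [twId_self]
  exact GrCat.castDeg_castDeg _ _ _ _

theorem proj_twComp_inj_of_ne (T : Tw A) {i j : Fin T.n} (hij : i ≠ j) {l m n : ℤ}
    (hl : l = T.r i) (hm : m + T.r j = 0) (h : l + m = n) :
    twComp h (T.proj i hl) (T.inj j hm) = 0 := by
  ext x y
  refine (proj_twComp _ _ _ _ _ _).trans ((GrCat.castDeg_castDeg _ _ _ _).trans ?_)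
  rw [twId_ne T hij]
  exact map_zero _

theorem twD_ofHom {X Y : A.Obj} {m n : ℤ} (h : m + 1 = n) (f : A.Hom X Y m) :
    twD h (Tw.ofHom f) = Tw.ofHom (A.d h f) := by
  subst h
  have h₁ : twComp (add_comm 1 m) (Tw.of Y).q (Tw.ofHom f) = 0 := by
    funext x y
    exact (twComp_apply _ _ _ _ _).trans (Finset.sum_eq_zero fun z _ =>
      LinearMap.congr_fun (map_zero (A.comp _)) (Tw.ofHom f z y))
  have h₂ : twComp rfl (Tw.ofHom f) (Tw.of X).q = 0 := by
    funext x y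
    exact (twComp_apply _ _ _ _ _).trans (Finset.sum_eq_zero fun z _ => map_zero _)
  rw [twD_apply, h₁, h₂, smul_zero, sub_zero, add_zero]
  funext x y
  refine (twNaive_apply rfl _ x y).trans ?_
  have e : sgn k ((Tw.of Y).r x) = 1 := sgn_zero k
  rw [e, one_smul]
  refine (d_castDeg A _ _ f).trans ?_
  exact (castDeg_d A rfl _ f).symm

theorem castDeg_id_comp {X Y : A.Obj} {z m n : ℤ} (hz : 0 = z) (h : z + m = n)
    (f : A.Hom X Y m) :
    A.comp h (A.castDeg hz (A.id Y)) f = A.castDeg (by omega) f := by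
  subst hz
  obtain rfl : m = n := by omega
  exact A.id_comp h f

theorem comp_castDeg_id {X Y : A.Obj} {z m n : ℤ} (hz : 0 = z) (h : m + z = n)
    (f : A.Hom X Y m) :
    A.comp h f (A.castDeg hz (A.id X)) = A.castDeg (by omega) f := by
  subst hz
  obtain rfl : m = n := by omega
  exact A.comp_id h f

section
variable {X Y : A.Obj} (f : A.Hom X Y 0) (hf : f ∈ A.cocycles X Y 0)

theorem Tw.castDeg_coneMatrix_right (x : Fin 2) {n : ℤ}
    (h : 1 + (![0, 1] : Fin 2 → ℤ) x - (![0, 1] : Fin 2 → ℤ) 1 = n)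
    (h' : 0 + (![0, 1] : Fin 2 → ℤ) x - (![0, 1] : Fin 2 → ℤ) 0 + 0 = n) :
    A.castDeg h (Tw.coneMatrix f x 1) = A.comp h' (twId (Tw.cone f hf) x (0 : Fin 2)) f := by
  match x with
  | 0 =>
    refine (GrCat.castDeg_castDeg _ _ _ f).trans (Eq.symm ?_)
    refine (congrArg (fun z => A.comp h' z f) (twId_self (Tw.cone f hf) (0 : Fin 2))).trans ?_
    exact castDeg_id_comp _ _ f
  | 1 =>
    refine (map_zero _).trans (Eq.symm ?_)
    refine (congrArg (fun z => A.comp h' z f) (twId_ne (Tw.cone f hf) (i := (1 : Fin 2))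
      (j := (0 : Fin 2)) (Fin.zero_ne_one.symm))).trans ?_
    exact LinearMap.congr_fun (map_zero (A.comp _)) f

theorem Tw.castDeg_coneMatrix_left (y : Fin 2) {n : ℤ}
    (h : 1 + (![0, 1] : Fin 2 → ℤ) 0 - (![0, 1] : Fin 2 → ℤ) y = n)
    (h' : 0 + (0 + (![0, 1] : Fin 2 → ℤ) 1 - (![0, 1] : Fin 2 → ℤ) y) = n) :
    A.castDeg h (Tw.coneMatrix f 0 y) = A.comp h' f (twId (Tw.cone f hf) (1 : Fin 2) y) := by
  match y with
  | 0 =>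
    refine (map_zero _).trans (Eq.symm ?_)
    refine (congrArg (fun z => A.comp h' f z) (twId_ne (Tw.cone f hf) (i := (1 : Fin 2))
      (j := (0 : Fin 2)) (Fin.zero_ne_one.symm))).trans ?_
    exact map_zero _
  | 1 =>
    refine (GrCat.castDeg_castDeg _ _ _ f).trans (Eq.symm ?_)
    refine (congrArg (fun z => A.comp h' f z) (twId_self (Tw.cone f hf) (1 : Fin 2))).trans ?_
    exact comp_castDeg_id _ _ f

theorem Tw.d_cone_inj_one :
    twD (neg_add_cancel 1) ((Tw.cone f hf).inj (1 : Fin 2) (neg_add_cancel (1 : ℤ))) =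
      twComp (add_zero 0) ((Tw.cone f hf).inj (0 : Fin 2) (zero_add (0 : ℤ))) (Tw.ofHom f) := by
  funext x y
  have e₁ := twD_inj (Tw.cone f hf) (1 : Fin 2) (neg_add_cancel (1 : ℤ)) (neg_add_cancel 1) x y
  have e₂ := inj_twComp_ofHom (Tw.cone f hf) (0 : Fin 2) f (zero_add (0 : ℤ)) (add_zero 0) x y
  exact e₁.trans ((Tw.castDeg_coneMatrix_right f hf x _ _).trans e₂.symm)

theorem Tw.d_cone_inj_zero :
    twD (zero_add 1) ((Tw.cone f hf).inj (0 : Fin 2) (zero_add (0 : ℤ))) = 0 := by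
  funext x y
  refine (twD_inj (Tw.cone f hf) (0 : Fin 2) _ _ _ _).trans ?_
  exact (congrArg _ (Tw.coneMatrix_left f x)).trans (map_zero _)

theorem Tw.d_cone_proj_zero :
    twD (zero_add 1) ((Tw.cone f hf).proj (0 : Fin 2) (l := 0) rfl) =
      -twComp (zero_add 1) (Tw.ofHom f) ((Tw.cone f hf).proj (1 : Fin 2) (l := 1) rfl) := by
  funext x y
  have e₁ := twD_proj (Tw.cone f hf) (0 : Fin 2) (l := 0) rfl (zero_add 1) x y
  have e₂ := ofHom_twComp_proj (Tw.cone f hf) (1 : Fin 2) f (l := 1) rfl (zero_add 1) x y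
  rw [sgn_zero, one_smul] at e₁
  exact e₁.trans (congrArg Neg.neg ((Tw.castDeg_coneMatrix_left f hf y _ _).trans e₂.symm))

/-- The decomposition of the twisted complex `Cone(f)` as `Y ⊕ X[1]`. -/
def Tw.coneData :
    ConeData A.pretr (X₁ := Tw.of X) (X₂ := Tw.of Y) (Tw.ofHom f) (Tw.cone f hf) where
  d_f := by
    refine (twD_ofHom (zero_add 1) f).trans ?_
    rw [(show A.d (zero_add 1) f = 0 from hf)]
    funext x y
    exact map_zero _
  i₁ := (Tw.cone f hf).inj (1 : Fin 2) (neg_add_cancel (1 : ℤ))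
  i₂ := (Tw.cone f hf).inj (0 : Fin 2) (zero_add (0 : ℤ))
  p₁ := (Tw.cone f hf).proj (1 : Fin 2) rfl
  p₂ := (Tw.cone f hf).proj (0 : Fin 2) rfl
  d_i₁ := Tw.d_cone_inj_one f hf
  d_i₂ := Tw.d_cone_inj_zero f hf
  d_p₁ := twD_proj_eq_zero (Tw.cone f hf) (1 : Fin 2) _ _ (Tw.coneMatrix_right f)
  d_p₂ := Tw.d_cone_proj_zero f hf
  p₁_i₁ := proj_twComp_inj_self (Tw.cone f hf) (1 : Fin 2) _ _ (add_neg_cancel 1)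
  p₁_i₂ := proj_twComp_inj_of_ne (Tw.cone f hf) (i := (1 : Fin 2)) (j := (0 : Fin 2))
    Fin.zero_ne_one.symm _ _ (add_zero 1)
  p₂_i₁ := proj_twComp_inj_of_ne (Tw.cone f hf) (i := (0 : Fin 2)) (j := (1 : Fin 2))
    Fin.zero_ne_one _ _ (zero_add (-1))
  p₂_i₂ := proj_twComp_inj_self (Tw.cone f hf) (0 : Fin 2) _ _ (add_zero 0)

end

end twCone

/-! ### Functoriality of twisted complexes -/

section pretrFunctor
variable {k : Type w} [CommRing k] {A : DGCat.{u, v, w} k} {B : DGCat.{u', v', w} k}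
  {φ : A.Obj → B.Obj}

/-- `Tw.ofHom` as a linear map. -/
def Tw.ofHomLinear (X Y : A.Obj) (n : ℤ) : A.Hom X Y n →ₗ[k] TwHom (Tw.of X) (Tw.of Y) n where
  toFun := Tw.ofHom
  map_add' f g := by
    funext x y
    exact map_add _ _ _
  map_smul' c f := by
    funext x y
    exact map_smul _ _ _

/-- The embedding of `A` into its twisted complexes. -/
def GrFunctor.toPretr (A : DGCat.{u, v, w} k) : GrFunctor A.toGrCat A.pretr.toGrCat Tw.of where
  map {X Y} n := Tw.ofHomLinear X Y n
  map_id X := by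
    funext x y
    obtain rfl : x = y := Subsingleton.elim (α := Fin 1) x y
    change Tw.ofHom (A.id X) x x = twId (Tw.of X) x x
    exact (twId_self (Tw.of X) x).symm
  map_comp {X Y Z p q n} h b a := by
    funext x y
    refine (GrCat.castDeg_comp _ _ _ _ _).trans (Eq.symm ?_)
    refine (Fin.sum_univ_one fun z : Fin 1 => A.comp _ (Tw.ofHom b x z) (Tw.ofHom a z y)).trans ?_
    exact (A.comp_castDeg_left _ _ _ _).trans (A.comp_castDeg_right _ _ _ _)

theorem Tw.ofHom_bijective {X Y : A.Obj} {n : ℤ} :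
    Function.Bijective (Tw.ofHom : A.Hom X Y n → _) where
  left _ _ h := (GrCat.castDeg_bijective _ _).1 (congrFun (congrFun h (0 : Fin 1)) (0 : Fin 1))
  right q := by
    obtain ⟨f, hf⟩ := (GrCat.castDeg_bijective _ _).2 (q (0 : Fin 1) (0 : Fin 1))
    refine ⟨f, ?_⟩
    funext x y
    obtain rfl : x = (0 : Fin 1) := Subsingleton.elim (α := Fin 1) _ _
    obtain rfl : y = (0 : Fin 1) := Subsingleton.elim (α := Fin 1) _ _
    exact hf

/-- The image of the graded object underlying a twisted complex. -/
def Tw.graded (φ : A.Obj → B.Obj) (T : Tw A) : Tw B where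
  n := T.n
  C := φ ∘ T.C
  r := T.r
  q _ _ := 0
  upper _ _ _ := rfl
  maurerCartan _ _ := by simp

theorem GrFunctor.map_twId (F : GrFunctor A.toGrCat B.toGrCat φ) (T : Tw A) (i j : Fin T.n) :
    F.map _ (twId T i j) = twId (T.graded φ) i j := by
  by_cases hij : i = j
  · subst hij
    refine (congrArg _ (twId_self T i)).trans (Eq.trans ?_ (twId_self (T.graded φ) i).symm)
    exact (F.map_castDeg _ _).trans (congrArg _ (F.map_id _))
  · refine (congrArg _ (twId_ne T hij)).trans (Eq.trans ?_ (twId_ne (T.graded φ) hij).symm)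
    exact map_zero _

/-- The action of a graded functor on the entries of a morphism of twisted complexes. -/
def GrFunctor.mapMatrix (F : GrFunctor A.toGrCat B.toGrCat φ) (T T' : Tw A) (n : ℤ) :
    TwHom T T' n →ₗ[k] TwHom (T.graded φ) (T'.graded φ) n where
  toFun f i j := F.map _ (f i j)
  map_add' f g := by
    funext i j
    exact map_add _ _ _
  map_smul' c f := by
    funext i j
    exact map_smul _ _ _

/-- The extension of a graded functor to graded objects underlying twisted complexes. -/
def GrFunctor.pretr (F : GrFunctor A.toGrCat B.toGrCat φ) :
    GrFunctor A.pretr.toGrCat B.pretr.toGrCat (Tw.graded φ) where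
  map {T T'} n := F.mapMatrix T T' n
  map_id T := by
    funext i j
    exact F.map_twId T i j
  map_comp h b a := by
    funext i j
    refine (congrArg (F.map _) (twComp_apply h b a i j)).trans ((map_sum (F.map _) _ _).trans ?_)
    refine (Finset.sum_congr rfl fun x _ => F.map_comp _ _ _).trans ?_
    exact (twComp_apply h (F.mapMatrix _ _ _ b) (F.mapMatrix _ _ _ a) i j).symm

theorem GrFunctor.pretr_inj (F : GrFunctor A.toGrCat B.toGrCat φ) (T : Tw A) (j : Fin T.n) {l : ℤ}
    (h : l + T.r j = 0) : F.pretr.map l (T.inj j h) = (T.graded φ).inj j h := by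
  funext x y
  exact (F.map_castDeg _ _).trans (congrArg _ (F.map_twId T x j))

theorem GrFunctor.pretr_proj (F : GrFunctor A.toGrCat B.toGrCat φ) (T : Tw A) (i : Fin T.n) {l : ℤ}
    (h : l = T.r i) : F.pretr.map l (T.proj i h) = (T.graded φ).proj i h := by
  funext x y
  exact (F.map_castDeg _ _).trans (congrArg _ (F.map_twId T i y))

theorem GrFunctor.pretr_ofHom (F : GrFunctor A.toGrCat B.toGrCat φ) {X Y : A.Obj} {n : ℤ}
    (f : A.Hom X Y n) : F.pretr.map n (Tw.ofHom f) = Tw.ofHom (F.map n f) := by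
  funext x y
  exact F.map_castDeg _ _

end pretrFunctor

/-! ### Functors from a DG quotient -/

/-- The canonical DG functor from `A` to its DG quotient. -/
def DGFunctor.toQuotient {k : Type w} [CommRing k] (A : DGCat.{u, v, w} k) (S : Set A.Obj) :
    DGFunctor A (A.quotient S) id where
  map _ := QHom.of S
  map_id _ := rfl
  map_comp := QHom.of_comp
  map_d _ _ := rfl

/-- The morphism `ε_U` of the DG quotient. -/
def QHom.eps {k : Type w} [CommRing k] {A : DGCat.{u, v, w} k} {S : Set A.Obj} (U : A.Obj)
    (hU : U ∈ S) : QHom A S U U (-1) :=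
  .mk (.eps U hU)

section quotientLift
variable {k : Type w} [CommRing k] {A : DGCat.{u, v, w} k} {S : Set A.Obj}
  {B : GrCat.{u', v', w} k} {φ : A.Obj → B.Obj}

/-- The value of an expression under a graded functor `F` on `A`, with `e` for the values of the
`ε_U`. -/
def Expr.eval (F : GrFunctor A.toGrCat B φ) (e : ∀ U ∈ S, B.Hom (φ U) (φ U) (-1)) :
    ∀ {X Y : A.Obj} {n : ℤ}, Expr A S X Y n → B.Hom (φ X) (φ Y) n
  | _, _, n, .of f => F.map n f
  | _, _, _, .eps U hU => e U hU
  | _, _, _, .comp h b a => B.comp h (b.eval F e) (a.eval F e)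
  | _, _, _, .add a b => a.eval F e + b.eval F e
  | _, _, _, .smul c a => c • a.eval F e

theorem Expr.Rel.eval_eq (F : GrFunctor A.toGrCat B φ) (e : ∀ U ∈ S, B.Hom (φ U) (φ U) (-1))
    {X Y : A.Obj} {n : ℤ} {a b : Expr A S X Y n} (hab : Expr.Rel a b) :
    a.eval F e = b.eval F e := by
  induction hab with
  | refl a => rfl
  | symm _ ih => exact ih.symm
  | trans _ _ ih ih' => exact ih.trans ih'
  | comp_congr h _ _ ih ih' => simp only [Expr.eval, ih, ih']
  | add_congr _ _ ih ih' => simp only [Expr.eval, ih, ih']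
  | smul_congr c _ ih => simp only [Expr.eval, ih]
  | add_assoc a b c => exact _root_.add_assoc _ _ _
  | add_comm a b => exact _root_.add_comm _ _
  | zero_add a => simp only [Expr.eval, map_zero, _root_.zero_add]
  | zero_smul a => simp only [Expr.eval, map_zero, _root_.zero_smul]
  | one_smul a => exact _root_.one_smul _ _
  | mul_smul c c' a => exact SemigroupAction.mul_smul _ _ _
  | smul_add c a b => exact _root_.smul_add _ _ _
  | add_smul c c' a => exact _root_.add_smul _ _ _
  | of_add f g => exact map_add _ _ _
  | of_smul c f => exact map_smul _ _ _
  | of_comp h b a => exact F.map_comp h b a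
  | id_comp h a => simp only [Expr.eval, F.map_id, B.id_comp]
  | comp_id h a => simp only [Expr.eval, F.map_id, B.comp_id]
  | assoc hpq hqr hs ht c b a => exact B.assoc hpq hqr hs ht _ _ _
  | add_comp h b b' a => simp only [Expr.eval, map_add, LinearMap.add_apply]
  | comp_add h b a a' => simp only [Expr.eval, map_add]
  | smul_comp h c b a => simp only [Expr.eval, map_smul, LinearMap.smul_apply]
  | comp_smul h c b a => simp only [Expr.eval, map_smul]

/-- The extension of a graded functor `F` on `A` to a DG quotient, with `e` for the values of the
`ε_U`. -/
def GrFunctor.ofQuotient (F : GrFunctor A.toGrCat B φ)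
    (e : ∀ U ∈ S, B.Hom (φ U) (φ U) (-1)) : GrFunctor (A.quotient S).toGrCat B φ where
  map n :=
    { toFun := Quotient.lift (fun a => a.eval F e) fun _ _ hab => Expr.Rel.eval_eq F e hab
      map_add' := fun x y => by
        obtain ⟨x, rfl⟩ := QHom.exists_mk x
        obtain ⟨y, rfl⟩ := QHom.exists_mk y
        rfl
      map_smul' := fun c x => by
        obtain ⟨x, rfl⟩ := QHom.exists_mk x
        rfl }
  map_id X := F.map_id X
  map_comp h b a := by
    obtain ⟨a, rfl⟩ := QHom.exists_mk a
    obtain ⟨b, rfl⟩ := QHom.exists_mk b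
    rfl

end quotientLift

/-! ### Generation of the morphisms of a DG quotient -/

section splitting
variable {k : Type w} [CommRing k]

/-- A decomposition of an object `T` of a graded category into shifts of objects in the image of
`o`: the component `o (C x)` is included with degree `s x` and projected to with degree `r x`. -/
structure GrCat.Splitting (B : GrCat.{u, v, w} k) {V : Type u'} (o : V → B.Obj) (T : B.Obj) where
  ι : Type
  [fintype : Fintype ι]
  C : ι → V
  s : ι → ℤ
  r : ι → ℤ
  s_add_r : ∀ x, s x + r x = 0
  inj : ∀ x, B.Hom (o (C x)) T (s x)
  proj : ∀ x, B.Hom T (o (C x)) (r x)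
  sum_inj_proj : ∑ x, B.comp (s_add_r x) (inj x) (proj x) = B.id T

attribute [instance] GrCat.Splitting.fintype

/-- The splitting of a twisted complex into its components. -/
def Tw.splitting {A : DGCat.{u, v, w} k} (T : A.pretr.Obj) :
    A.pretr.toGrCat.Splitting Tw.of T where
  ι := Fin (Tw.n T)
  C := Tw.C T
  s x := -Tw.r T x
  r := Tw.r T
  s_add_r _ := neg_add_cancel _
  inj x := Tw.inj T x (neg_add_cancel _)
  proj x := Tw.proj T x rfl
  sum_inj_proj := sum_inj_proj T fun _ => neg_add_cancel _

variable {B : GrCat.{u, v, w} k} {V : Type u'} {o : V → B.Obj}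

namespace GrCat.Splitting

/-- The image of a splitting under a graded functor. -/
def map {C : GrCat k} {T : B.Obj} (D : B.Splitting o T) {φ : B.Obj → C.Obj}
    (F : GrFunctor B C φ) : C.Splitting (φ ∘ o) (φ T) where
  ι := D.ι
  C := D.C
  s := D.s
  r := D.r
  s_add_r := D.s_add_r
  inj x := F.map _ (D.inj x)
  proj x := F.map _ (D.proj x)
  sum_inj_proj := by
    rw [← F.map_id, ← D.sum_inj_proj, map_sum]
    exact Finset.sum_congr rfl fun x _ => (F.map_comp _ _ _).symm

variable {T T' T'' : B.Obj} (D : B.Splitting o T) (D' : B.Splitting o T')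
  (D'' : B.Splitting o T'')

/-- The `(i, j)` entry of a morphism between objects with splittings. -/
def component (n : ℤ) (i : D'.ι) (j : D.ι) :
    B.Hom T T' n →ₗ[k] B.Hom (o (D.C j)) (o (D'.C i)) (D'.r i + n + D.s j) :=
  (B.comp rfl).flip (D.inj j) ∘ₗ B.comp rfl (D'.proj i)

theorem component_apply {n : ℤ} (i : D'.ι) (j : D.ι) (q : B.Hom T T' n) :
    D.component D' n i j q = B.comp rfl (B.comp rfl (D'.proj i) q) (D.inj j) := rfl

theorem eq_sum_inj_proj_comp {n : ℤ} (q : B.Hom T T' n) :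
    q = ∑ i, B.comp (by linear_combination D'.s_add_r i) (D'.inj i)
      (B.comp (rfl : D'.r i + n = _) (D'.proj i) q) := by
  conv_lhs => rw [← B.id_comp (zero_add n) q, ← D'.sum_inj_proj, map_sum, LinearMap.sum_apply]
  exact Finset.sum_congr rfl fun i _ => B.assoc _ _ _ _ _ _ _

theorem eq_sum_comp_inj_proj {n : ℤ} (q : B.Hom T T' n) :
    q = ∑ j, B.comp (by linear_combination D.s_add_r j) (B.comp (rfl : n + D.s j = _) q (D.inj j))
      (D.proj j) := by
  conv_lhs => rw [← B.comp_id (add_zero n) q, ← D.sum_inj_proj, map_sum]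
  exact Finset.sum_congr rfl fun j _ => (B.assoc _ _ _ _ _ _ _).symm

theorem eq_sum_component {n : ℤ} (q : B.Hom T T' n) :
    q = ∑ i, ∑ j, B.comp (by linear_combination D'.s_add_r i) (D'.inj i)
      (B.comp (by linear_combination D.s_add_r j : D'.r i + n + D.s j + D.r j = D'.r i + n)
        (D.component D' n i j q) (D.proj j)) := by
  conv_lhs => rw [D'.eq_sum_inj_proj_comp q]
  refine Finset.sum_congr rfl fun i _ => ?_
  conv_lhs => rw [D.eq_sum_comp_inj_proj (B.comp (rfl : D'.r i + n = _) (D'.proj i) q), map_sum]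
  rfl

theorem component_comp {p q n : ℤ} (h : p + q = n) (b : B.Hom T' T'' p) (a : B.Hom T T' q)
    (i : D''.ι) (j : D.ι) :
    D.component D'' n i j (B.comp h b a) =
      ∑ x, B.comp (by linear_combination D'.s_add_r x + h)
        (D'.component D'' p i x b) (D.component D' q x j a) := by
  conv_lhs => rw [D'.eq_sum_inj_proj_comp a]
  simp only [map_sum, component_apply]
  refine Finset.sum_congr rfl fun x _ => ?_
  have hx := D'.s_add_r x
  rw [← B.assoc (hpq := (rfl : p + D'.s x = _)) (hs := by linear_combination h + hx),
    ← B.assoc (hpq := (by ring : D''.r i + (p + D'.s x) = D''.r i + p + D'.s x))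
      (hs := by linear_combination h + hx),
    ← B.assoc (hpq := (rfl : D''.r i + p = _)) (hs := rfl),
    B.assoc (hqr := (rfl : D'.r x + q + D.s j = _)) (ht := by linear_combination h + hx)]

end GrCat.Splitting

/-- A family of graded submodules of the morphisms between the objects `o X` is closed under
composition. -/
def GrCat.CompClosed (B : GrCat.{u, v, w} k) {o : V → B.Obj}
    (R : ∀ (X Y : V) (n : ℤ), Submodule k (B.Hom (o X) (o Y) n)) : Prop :=
  ∀ ⦃X Y Z : V⦄ ⦃p q n : ℤ⦄ (h : p + q = n) ⦃b : B.Hom (o Y) (o Z) p⦄ ⦃a : B.Hom (o X) (o Y) q⦄,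
    b ∈ R Y Z p → a ∈ R X Y q → B.comp h b a ∈ R X Z n

/-- The morphisms between objects with splittings all of whose entries belong to `R`. -/
def GrCat.Splitting.matrices {T T' : B.Obj} (D : B.Splitting o T) (D' : B.Splitting o T')
    (R : ∀ (X Y : V) (n : ℤ), Submodule k (B.Hom (o X) (o Y) n)) (n : ℤ) :
    Submodule k (B.Hom T T' n) where
  carrier := {q | ∀ i j, D.component D' n i j q ∈ R (D.C j) (D'.C i) _}
  zero_mem' i j := by
    rw [map_zero]
    exact zero_mem _
  add_mem' h h' i j := by
    rw [map_add]
    exact add_mem (h i j) (h' i j)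
  smul_mem' c _ h i j := by
    rw [map_smul]
    exact Submodule.smul_mem _ c (h i j)

variable {R : ∀ (X Y : V) (n : ℤ), Submodule k (B.Hom (o X) (o Y) n)}

theorem GrCat.CompClosed.comp_mem_matrices (hR : B.CompClosed R) {T T' T'' : B.Obj}
    {D : B.Splitting o T} {D' : B.Splitting o T'} {D'' : B.Splitting o T''} {p q n : ℤ}
    (h : p + q = n) {b : B.Hom T' T'' p} {a : B.Hom T T' q} (hb : b ∈ D'.matrices D'' R p)
    (ha : a ∈ D.matrices D' R q) : B.comp h b a ∈ D.matrices D'' R n := fun i j => by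
  rw [D.component_comp D' D'']
  exact Submodule.sum_mem _ fun x _ => hR _ (hb i x) (ha x j)

theorem GrCat.CompClosed.mem_of_mem_matrices (hR : B.CompClosed R) {X Y : V}
    {D : B.Splitting o (o X)} {D' : B.Splitting o (o Y)} (hD : ∀ x, D.proj x ∈ R _ _ _)
    (hD' : ∀ x, D'.inj x ∈ R _ _ _) {n : ℤ} {q : B.Hom (o X) (o Y) n}
    (h : q ∈ D.matrices D' R n) : q ∈ R X Y n := by
  rw [D.eq_sum_component D' q]
  exact Submodule.sum_mem _ fun i _ => Submodule.sum_mem _ fun j _ =>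
    hR _ (hD' i) (hR _ (h i j) (hD j))

theorem QHom.mem_of_splitting {A : DGCat.{u, v, w} k} {S : Set A.Obj} {V : Type u'}
    {o : V → A.Obj} {R : ∀ (X Y : V) (n : ℤ), Submodule k (QHom A S (o X) (o Y) n)}
    (hR : (A.quotient S).toGrCat.CompClosed (o := o) R)
    (D : ∀ T : A.Obj, A.toGrCat.Splitting o T)
    (hof : ∀ {X Y : V} {n : ℤ} (f : A.Hom (o X) (o Y) n), QHom.of S f ∈ R X Y n)
    (heps : ∀ (U : A.Obj) (hU : U ∈ S),
      QHom.eps U hU ∈ ((D U).map (DGFunctor.toQuotient A S).toGrFunctor).matrices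
        ((D U).map (DGFunctor.toQuotient A S).toGrFunctor) R (-1))
    {X Y : V} {n : ℤ} (q : QHom A S (o X) (o Y) n) : q ∈ R X Y n := by
  let π := (DGFunctor.toQuotient A S).toGrFunctor
  have mk_mem {T T' : A.Obj} {n : ℤ} (a : Expr A S T T' n) :
      QHom.mk a ∈ ((D T).map π).matrices ((D T').map π) R n := by
    induction a with
    | @of T T' n f =>
      intro i j
      have hij : ((D T).map π).component ((D T').map π) n i j (QHom.of S f) =
          QHom.of S ((D T).component (D T') n i j f) :=
        ((π.map_comp _ _ _).trans (congrArg (fun z => QHom.comp rfl z _)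
          (π.map_comp _ _ _))).symm
      exact hij ▸ hof _
    | eps U hU => exact heps U hU
    | comp h b a hb ha => exact hR.comp_mem_matrices h hb ha
    | add a b ha hb => exact add_mem ha hb
    | smul c a ha => exact Submodule.smul_mem _ c ha
  obtain ⟨a, rfl⟩ := QHom.exists_mk q
  exact hR.mem_of_mem_matrices (fun _ => hof _) (fun _ => hof _) (mk_mem a)

end splitting

/-! ### `K` as a full subcategory of the DG quotient -/

section quotientFunctor
variable {k : Type w} [CommRing k]

/-- The morphisms in the image of a DG functor. -/
def DGFunctor.range {A : DGCat.{u, v, w} k} {B : DGCat.{u', v', w} k} {φ : A.Obj → B.Obj}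
    (F : DGFunctor A B φ) (X Y : A.Obj) (n : ℤ) : Submodule k (B.Hom (φ X) (φ Y) n) :=
  LinearMap.range (F.map n)

theorem DGFunctor.compClosed_range {A : DGCat.{u, v, w} k} {B : DGCat.{u', v', w} k}
    {φ : A.Obj → B.Obj} (F : DGFunctor A B φ) : B.toGrCat.CompClosed (o := φ) F.range := by
  rintro X Y Z p q n h _ _ ⟨b, rfl⟩ ⟨a, rfl⟩
  exact ⟨A.comp h b a, F.map_comp h b a⟩

theorem DGFunctor.mem_range_of_map_eq_neg {A : DGCat.{u, v, w} k} {B : DGCat.{u', v', w} k}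
    {φ : A.Obj → B.Obj} (F : DGFunctor A B φ) {X Y : A.Obj} {n : ℤ} {x : A.Hom X Y n}
    {y : B.Hom (φ X) (φ Y) n} (h : F.map n x = -y) : y ∈ F.range X Y n :=
  ⟨-x, by rw [map_neg, h, neg_neg]⟩

/-- The endomorphism of degree `-1` of `Y ⊕ X[1]` with the rows `-α₂, -u` and `g, α₁`. -/
def GrCat.coneEnd (B : GrCat.{u, v, w} k) {X Y : B.Obj} (α₂ : B.Hom Y Y (-1)) (u : B.Hom X Y (-2))
    (g : B.Hom Y X 0) (α₁ : B.Hom X X (-1)) (i j : Fin 2) :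
    B.Hom ((![Y, X] : Fin 2 → B.Obj) j) ((![Y, X] : Fin 2 → B.Obj) i)
      (-1 + (![0, 1] : Fin 2 → ℤ) i - (![0, 1] : Fin 2 → ℤ) j) :=
  match i, j with
  | 0, 0 => B.castDeg (by simp) (-α₂)
  | 0, 1 => B.castDeg (by simp) (-u)
  | 1, 0 => B.castDeg (by simp) g
  | 1, 1 => B.castDeg (by simp) α₁

/-- The extension of a graded functor `F` to a DG quotient by the single object `U`, with `e` for
the value of `ε_U`. -/
def GrFunctor.ofQuotientSingleton {A : DGCat.{u, v, w} k} {B : GrCat.{u', v', w} k}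
    {φ : A.Obj → B.Obj} (F : GrFunctor A.toGrCat B φ) (U : A.Obj)
    (e : B.Hom (φ U) (φ U) (-1)) : GrFunctor (A.quotient {U}).toGrCat B φ :=
  GrFunctor.ofQuotient F fun V hV =>
    have h : U = V := hV.symm
    h ▸ e

theorem GrFunctor.ofQuotientSingleton_component {A : DGCat.{u, v, w} k} {B : DGCat.{u', v', w} k}
    {φ : A.Obj → B.Obj} (F : GrFunctor A.toGrCat B.toGrCat φ) (U : A.pretr.Obj)
    (e : B.pretr.Hom (Tw.graded φ U) (Tw.graded φ U) (-1))
    (i j : Fin (Tw.n U)) {l m s n : ℤ} (hi : l = Tw.r U i) (hj : s + Tw.r U j = 0)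
    (hm : l + -1 = m) (h : m + s = n) (hn : -1 + Tw.r U i - Tw.r U j = n) :
    (GrFunctor.ofQuotientSingleton F.pretr U e).map n (QHom.comp h (QHom.comp hm
      (QHom.of {U} (Tw.proj U i hi)) (QHom.eps U rfl)) (QHom.of {U} (Tw.inj U j hj))) =
    Tw.ofHom (B.castDeg hn (e i j)) := by
  refine (congrArg₂ (fun p q => twComp h (twComp hm p e) q) (F.pretr_proj U i hi)
    (F.pretr_inj U j hj)).trans ?_
  funext x y
  exact (proj_twComp_inj (T := Tw.graded φ U) (T' := Tw.graded φ U) e i j hi hj hm h x y).trans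
    (GrCat.castDeg_castDeg _ _ _ _).symm

theorem GrFunctor.map_neg_eq {A : GrCat.{u, v, w} k} {B : GrCat.{u', v', w} k}
    {φ : A.Obj → B.Obj} (F : GrFunctor A B φ) {X Y : A.Obj} {n : ℤ} {x : A.Hom X Y n}
    {y : B.Hom (φ X) (φ Y) n} (h : F.map n x = y) : F.map n (-x) = -y := by
  rw [map_neg, h]

theorem Tw.neg_ofHom_neg {A : DGCat.{u, v, w} k} {X Y : A.Obj} {n : ℤ} (f : A.Hom X Y n) :
    -Tw.ofHom (-f) = Tw.ofHom f :=
  neg_eq_iff_eq_neg.mpr (map_neg (Tw.ofHomLinear X Y n) f)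

variable (k)

/-- The cone data of `Cone(f)` in the DG quotient. -/
def AmodB.coneData : ConeData (AmodB k) (X₁ := AmodB.X k x₁) (X₂ := AmodB.X k x₂) (AmodB.f k)
    (A.cone k) :=
  (Tw.coneData (A₀.f k) (A₀.f_closed k)).map (DGFunctor.toQuotient (A k) {A.cone k})

/-- The morphism `ε` of the DG quotient. -/
def AmodB.ε : (AmodB k).Hom (A.cone k) (A.cone k) (-1) := QHom.eps (A.cone k) rfl

/-- The homotopy equivalence between `X₁` and `X₂` in `A/B` given by the contraction `ε` of the
cone of `f`. -/
def AmodB.hoEquiv : HoEquiv (AmodB k) (AmodB.X k x₁) (AmodB.X k x₂) :=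
  (AmodB.coneData k).hoEquiv (AmodB.ε k) rfl

/-- The DG functor `K → A/B` that identifies `K` with the full DG subcategory on `X₁` and `X₂`. -/
def K.toAmodB : DGFunctor (K k) (AmodB k) (AmodB.X k) :=
  K.lift (B := AmodB k) (X := AmodB.X k) (AmodB.hoEquiv k)

theorem K.toAmodB_f : (K.toAmodB k).map 0 (K.gen k .f) = AmodB.f k :=
  K.lift_f (B := AmodB k) (X := AmodB.X k) (AmodB.hoEquiv k)

theorem K.toAmodB_g : (K.toAmodB k).map 0 (K.gen k .g) =
    (AmodB k).comp (add_zero 0) ((AmodB k).comp (add_neg_cancel 1) (AmodB.coneData k).p₁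
      (AmodB.ε k)) (AmodB.coneData k).i₂ :=
  K.lift_g (B := AmodB k) (X := AmodB.X k) (AmodB.hoEquiv k)

theorem K.toAmodB_α₁ : (K.toAmodB k).map (-1) (K.gen k .α₁) =
    (AmodB k).comp (zero_add (-1)) ((AmodB k).comp (add_neg_cancel 1) (AmodB.coneData k).p₁
      (AmodB.ε k)) (AmodB.coneData k).i₁ :=
  freeEval_gen _ _ KGen.α₁ _

theorem K.toAmodB_α₂ : (K.toAmodB k).map (-1) (K.gen k .α₂) =
    -(AmodB k).comp (add_zero (-1)) ((AmodB k).comp (zero_add (-1)) (AmodB.coneData k).p₂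
      (AmodB.ε k)) (AmodB.coneData k).i₂ :=
  freeEval_gen _ _ KGen.α₂ _

theorem K.toAmodB_u : (K.toAmodB k).map (-2) (K.gen k .u) =
    -(AmodB k).comp (by norm_num) ((AmodB k).comp (zero_add (-1)) (AmodB.coneData k).p₂
      (AmodB.ε k)) (AmodB.coneData k).i₁ :=
  freeEval_gen _ _ KGen.u _

/-- The inclusion of `A₀` into `K`, as a graded functor. -/
def A₀.toK : GrFunctor (A₀ k).toGrCat (K k).toGrCat id :=
  GrFunctor.ofFree (K k).toGrCat fun a b (e : ArrowGen a b) => match a, b, e with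
    | _, _, .f => K.gen k .f

theorem A₀.toK_f : (A₀.toK k).map 0 (A₀.f k) = K.gen k .f :=
  freeEval_gen _ _ ArrowGen.f _

theorem K.toAmodB_toK {a b : Two} {n : ℤ} (h : (A₀ k).Hom a b n) :
    (K.toAmodB k).map n ((A₀.toK k).map n h) =
      QHom.of (A := A k) {A.cone k} (Tw.ofHom h) := by
  refine GrFunctor.ext_free ((K.toAmodB k).toGrFunctor.comp (A₀.toK k))
    ((DGFunctor.toQuotient (A k) {A.cone k}).toGrFunctor.comp (GrFunctor.toPretr (A₀ k))) ?_ h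
  intro a b e he
  cases e
  exact (congrArg ((K.toAmodB k).map 0) (A₀.toK_f k)).trans (K.toAmodB_f k)

theorem K.toAmodB_surjective (a b : (K k).Obj) (n : ℤ) :
    Function.Surjective ((K.toAmodB k).map (X := a) (Y := b) n) := by
  intro q
  refine QHom.mem_of_splitting (A := A k) (S := {A.cone k}) (o := AmodB.X k)
    (R := (K.toAmodB k).range) (K.toAmodB k).compClosed_range Tw.splitting ?_ ?_ q
  · intro X Y n f
    obtain ⟨f, rfl⟩ := Tw.ofHom_bijective.2 f
    exact ⟨_, K.toAmodB_toK k f⟩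
  · rintro U hU
    obtain rfl : U = A.cone k := hU
    intro i j
    match i, j with
    | (0 : Fin 2), (0 : Fin 2) => exact DGFunctor.mem_range_of_map_eq_neg _ (K.toAmodB_α₂ k)
    | (0 : Fin 2), (1 : Fin 2) => exact DGFunctor.mem_range_of_map_eq_neg _ (K.toAmodB_u k)
    | (1 : Fin 2), (0 : Fin 2) => exact ⟨K.gen k .g, K.toAmodB_g k⟩
    | (1 : Fin 2), (1 : Fin 2) => exact ⟨K.gen k .α₁, K.toAmodB_α₁ k⟩

/-- The graded object underlying the image of `Cone(f)` in the twisted complexes over `K`. -/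
def K.cone : (K k).pretr.Obj := Tw.graded (A := A₀ k) (B := K k) id (A.cone k)

/-- The value of `ε` in the graded category of twisted complexes over `K`, read off from
`ConeData.hoEquiv`. -/
def K.ε : (K k).pretr.Hom (K.cone k) (K.cone k) (-1) :=
  fun i j => (K k).toGrCat.coneEnd (X := x₁) (Y := x₂) (K.gen k .α₂) (K.gen k .u) (K.gen k .g)
    (K.gen k .α₁) i j

/-- The graded functor from `A/B` to the graded category of twisted complexes over `K`. -/
def AmodB.toPretr : GrFunctor (AmodB k).toGrCat (K k).pretr.toGrCat (Tw.graded (A := A₀ k) id) :=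
  GrFunctor.ofQuotientSingleton (A₀.toK k).pretr (A.cone k) (K.ε k)

theorem AmodB.toPretr_component (i j : Fin 2) {l m s n : ℤ} (hi : l = (![0, 1] : Fin 2 → ℤ) i)
    (hj : s + (![0, 1] : Fin 2 → ℤ) j = 0) (hm : l + -1 = m) (h : m + s = n)
    (hn : -1 + (![0, 1] : Fin 2 → ℤ) i - (![0, 1] : Fin 2 → ℤ) j = n) :
    (AmodB.toPretr k).map n ((AmodB k).comp h ((AmodB k).comp hm
      (QHom.of {A.cone k} (Tw.proj (A.cone k) i hi) : (AmodB k).Hom (A.cone k) _ l) (AmodB.ε k))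
      (QHom.of {A.cone k} (Tw.inj (A.cone k) j hj) : (AmodB k).Hom _ (A.cone k) s)) =
    Tw.ofHom ((K k).castDeg hn (K.ε k i j)) :=
  GrFunctor.ofQuotientSingleton_component (A₀.toK k) (A.cone k) (K.ε k) i j hi hj hm h hn

theorem AmodB.toPretr_toAmodB {a b : (K k).Obj} {n : ℤ} (x : (K k).Hom a b n) :
    (AmodB.toPretr k).map n ((K.toAmodB k).map n x) = Tw.ofHom x := by
  refine GrFunctor.ext_free ((AmodB.toPretr k).comp (K.toAmodB k).toGrFunctor)
    (GrFunctor.toPretr (K k)) ?_ x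
  intro a b e he
  cases e
  · refine (congrArg ((AmodB.toPretr k).map 0) (K.toAmodB_f k)).trans ?_
    refine ((A₀.toK k).pretr_ofHom (A₀.f k)).trans ?_
    exact congrArg Tw.ofHom (A₀.toK_f k)
  · refine (congrArg ((AmodB.toPretr k).map 0) (K.toAmodB_g k)).trans ?_
    exact AmodB.toPretr_component k 1 0 rfl rfl _ _ rfl
  · refine (congrArg ((AmodB.toPretr k).map (-1)) (K.toAmodB_α₁ k)).trans ?_
    exact AmodB.toPretr_component k 1 1 rfl rfl _ _ rfl
  · refine (congrArg ((AmodB.toPretr k).map (-1)) (K.toAmodB_α₂ k)).trans ?_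
    refine ((AmodB.toPretr k).map_neg_eq
      (AmodB.toPretr_component k 0 0 rfl rfl _ _ rfl)).trans ?_
    exact Tw.neg_ofHom_neg (A := K k) (K.gen k .α₂)
  · refine (congrArg ((AmodB.toPretr k).map (-2)) (K.toAmodB_u k)).trans ?_
    refine ((AmodB.toPretr k).map_neg_eq
      (AmodB.toPretr_component k 0 1 rfl rfl _ _ rfl)).trans ?_
    exact Tw.neg_ofHom_neg (A := K k) (K.gen k .u)

theorem K.toAmodB_injective (a b : (K k).Obj) (n : ℤ) :
    Function.Injective ((K.toAmodB k).map (X := a) (Y := b) n) := fun x y h =>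
  Tw.ofHom_bijective.1 (((AmodB.toPretr_toAmodB k x).symm.trans
    (congrArg ((AmodB.toPretr k).map n) h)).trans (AmodB.toPretr_toAmodB k y))

theorem K.toAmodB_fullyFaithful : (K.toAmodB k).FullyFaithful := fun a b n =>
  ⟨K.toAmodB_injective k a b n, K.toAmodB_surjective k a b n⟩

theorem AmodB.isHoInverse : (AmodB k).IsHoInverse (AmodB.f k) (AmodB.hoEquiv k).g :=
  (AmodB.hoEquiv k).isHoInverse

theorem AmodB.subsingleton_ext (a b : Two) {n : ℤ} (hn : n ≠ 0) :
    Subsingleton ((AmodB k).Ext (AmodB.X k a) (AmodB.X k b) n) :=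
  have := K.subsingleton_ext k a b hn
  ((K.toAmodB_fullyFaithful k).mapExt_bijective a b n).surjective.subsingleton

variable {k}

theorem AmodB.isFreeGenerator_cls {a b : Two} {x : (K k).Hom a b 0}
    (hx : x ∈ (K k).cocycles a b 0) (hxI : (K.toI₂ k).map 0 x = I₂.arrow k a b)
    {y : (AmodB k).Hom (AmodB.X k a) (AmodB.X k b) 0} (hxy : (K.toAmodB k).map 0 x = y)
    (hy : y ∈ (AmodB k).cocycles (AmodB.X k a) (AmodB.X k b) 0) :
    IsFreeGenerator k ((AmodB k).cls ⟨y, hy⟩) := by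
  subst hxy
  exact (isFreeGenerator_map_iff ((K.toAmodB_fullyFaithful k).mapExt_bijective a b 0)).2
    (K.isFreeGenerator_cls k ⟨x, hx⟩ hxI)

theorem AmodB.isFreeGenerator_cls_id (a : Two) :
    IsFreeGenerator k ((AmodB k).cls ⟨_, (AmodB k).id_mem_cocycles (AmodB.X k a)⟩) :=
  AmodB.isFreeGenerator_cls ((K k).id_mem_cocycles a) ((K.toI₂ k).map_id a)
    ((K.toAmodB k).map_id a) _

theorem AmodB.isFreeGenerator_cls_f
    (hf : AmodB.f k ∈ (AmodB k).cocycles (AmodB.X k x₁) (AmodB.X k x₂) 0) :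
    IsFreeGenerator k ((AmodB k).cls ⟨AmodB.f k, hf⟩) :=
  AmodB.isFreeGenerator_cls (K.hoEquiv k).isHoInverse.closed_left (K.toI₂_f k) (K.toAmodB_f k) hf

theorem AmodB.isFreeGenerator_cls_g
    (hg : (AmodB.hoEquiv k).g ∈ (AmodB k).cocycles (AmodB.X k x₂) (AmodB.X k x₁) 0) :
    IsFreeGenerator k ((AmodB k).cls ⟨(AmodB.hoEquiv k).g, hg⟩) :=
  AmodB.isFreeGenerator_cls (K.hoEquiv k).isHoInverse.closed_right (K.toI₂_g k) (K.toAmodB_g k) hg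

end quotientFunctor

end DG

end

theorem corollary3p7p3 (k : Type w) [CommRing k] :
    -- `K` is a resolution of `I₂`
    (∃ F : DG.DGFunctor (DG.K k) (DG.I₂ k) id,
      F.map 0 (DG.K.gen k DG.KGen.f) = DG.I₂.arrow k DG.Two.x₁ DG.Two.x₂ ∧
      F.map 0 (DG.K.gen k DG.KGen.g) = DG.I₂.arrow k DG.Two.x₂ DG.Two.x₁ ∧
      DG.DGFunctor.IsResolution.{0, w, w, 0, w, 0} F) ∧
    -- `K` is the full DG subcategory of `A/B` with the objects `X₁` and `X₂`
    (∃ Φ : DG.DGFunctor (DG.K k) (DG.AmodB k) (DG.AmodB.X k),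
      Φ.map 0 (DG.K.gen k DG.KGen.f) = DG.AmodB.f k ∧ Φ.FullyFaithful) ∧
    -- the Ext groups in `A/B`
    (∀ (a b : DG.Two) (n : ℤ), n ≠ 0 →
      Subsingleton ((DG.AmodB k).Ext (DG.AmodB.X k a) (DG.AmodB.X k b) n)) ∧
    (∀ a : DG.Two, DG.IsFreeGenerator k
      ((DG.AmodB k).cls ⟨_, (DG.AmodB k).id_mem_cocycles (DG.AmodB.X k a)⟩)) ∧
    (∃ (hf : DG.AmodB.f k ∈ (DG.AmodB k).cocycles (DG.AmodB.X k DG.Two.x₁) (DG.AmodB.X k DG.Two.x₂) 0)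
      (g : (DG.AmodB k).Hom (DG.AmodB.X k DG.Two.x₂) (DG.AmodB.X k DG.Two.x₁) 0)
      (hg : g ∈ (DG.AmodB k).cocycles (DG.AmodB.X k DG.Two.x₂) (DG.AmodB.X k DG.Two.x₁) 0),
      (DG.AmodB k).IsHoInverse (DG.AmodB.f k) g ∧
      DG.IsFreeGenerator k ((DG.AmodB k).cls ⟨DG.AmodB.f k, hf⟩) ∧
      DG.IsFreeGenerator k ((DG.AmodB k).cls ⟨g, hg⟩)) := by
  have hΦ := DG.K.toAmodB_fullyFaithful k
  have h := DG.AmodB.isHoInverse k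
  exact ⟨⟨DG.K.toI₂ k, DG.K.toI₂_f k, DG.K.toI₂_g k, DG.K.isResolution k⟩,
    ⟨DG.K.toAmodB k, DG.K.toAmodB_f k, hΦ⟩,
    fun a b _ hn => DG.AmodB.subsingleton_ext k a b hn,
    DG.AmodB.isFreeGenerator_cls_id,
    h.closed_left, _, h.closed_right, h,
    DG.AmodB.isFreeGenerator_cls_f h.closed_left, DG.AmodB.isFreeGenerator_cls_g h.closed_right⟩
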